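/- **Complexes.** A *simple CW-complex* of dimension $d$ is a finite CW-complex that is the closure of its $d$-dimensional cells and in which the closure of each cell is a closed ball whose boundary sphere is a union of cells (a regular CW-complex of pure dimension). Such complexes are considered up to cellular homeomorphism, so each is given by its face poset: a finite poset with a dimension function in which, for every cell $x$, the order complex of $\{y<x\}$ is homeomorphic to $S^{\dim x-1}$. Fix $D\ge 0$ and a set $S$ of colors. A *colored complex* is a simple CW-complex whose cells of positive dimension are oriented and colored by $S$, such that distinct cells of equal dimension in one connected component have distinct colors. $\Sigma=\Sigma(D,S)$ is the set of isomorphism classes of connected $D$-dimensional colored complexes, and $\sigma\mapsto\sigma^*$ is induced by inversion of all orientations. A *cyclic complex* is a colored complex with a cyclic order on the vertices of each component. A *cut*, realizing a division of the vertices of a component into two nonempty groups $A,B$ compatible with the cyclic order, is a connected subspace that divides this component into two connected parts containing $A$ and $B$, meets exactly the closed cells with vertices in both $A$ and $B$, meets each of them in a closed ball of codimension 1, and has these intersections as the closed cells of a simple CW-complex. A *brane complex* is a cyclic complex of dimension $D+1$ in which each such division is realized by a cut (the empty complex is allowed). For a vertex $q$ of a brane complex, the *vertex complex* $\sigma_q$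 is the cut separating $q$ from the other vertices; each of its cells has the color of the cell of $\Omega$ containing it and is oriented as boundary of the part not containing $q$. Cutting $\Omega$ along a cut and contracting its two copies to points $q_\pm$ gives a brane complex $\Omega'$. **Theories.** Let $\mathbb K$ be a field of characteristic $0$. A family of linear forms $\Phi_\Omega:V_\Omega=\bigotimes_{q}B_{\sigma_q}\to\mathbb K$, for all $(D+1)$-dimensional brane complexes $\Omega$, where $\{B_\sigma\}_{\sigma\in\Sigma}$ are finite-dimensional vector spaces, is a *Brane Topological Field Theory* if: (1) it is invariant under isomorphisms of brane complexes; (2) if $\Omega$ has exactly two vertices $p,q$, then $\sigma_q=\sigma_p^*$ and $\Phi_\Omega$ is a nondegenerate form on $B_{\sigma_p}\times B_{\sigma_q}$; (3) there are tensors $K_\sigma\in B_\sigma\otimes B_{\sigma^*}$ such that, for every cutting $\Omega\to\Omega'$, the other vertex complexes are unchanged, $\sigma_{q_-}=\sigma_{q_+}^*$, and $\Phi_{\Omega'}(x\otimes K_{\sigma_{q_+}})=\Phi_\Omega(x)$; (4) $\Phi_{\Omega_1\sqcup\Omega_2}(x_1\otimes x_2)=\Phi_{\Omega_1}(x_1)\Phi_{\Omega_2}(x_2)$.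 **Algebras.** A brane complex is *coherent* if in each 2-cell with at least three vertices the boundary orientation runs through the vertices in their cyclic order. $\Omega(\sigma_1,\dots,\sigma_n)$ denotes the set of connected coherent brane complexes with vertices numbered $q_1,\dots,q_n$ along the cyclic order and $\sigma_{q_i}=\sigma_i$. Let $\Sigma_0\subset\Sigma$ be the set of classes of complexes with at most $|S|$ vertices (so $\Sigma_0=\Sigma$ if $S$ is infinite). A *Colored Frobenius Algebra* is a direct sum $B_\star=\bigoplus_{\sigma\in\Sigma_0}B_\sigma$ of finite-dimensional vector spaces with a nondegenerate bilinear form $(\cdot,\cdot)$ and a trilinear form $(\cdot,\cdot,\cdot)$ such that $(B_\sigma,B_\tau)=0$ for $\sigma\ne\tau^*$, $(B_{\sigma_1},B_{\sigma_2},B_{\sigma_3})=0$ if $\Omega(\sigma_1,\sigma_2,\sigma_3)=\emptyset$, and for $\Omega\in\Omega(\sigma_1,\dots,\sigma_4)$ and $x_k\in B_{\sigma_k}$ $$\sum_{i,j}(x_1,x_2,b_i)F^{ij}(b'_j,x_3,x_4)=\sum_{i,j}(x_4,x_1,c_i)E^{ij}(c'_j,x_2,x_3).$$ Here $\tau=\sigma_{q_+}$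 for a cut of $\Omega$ separating $q_1,q_2$ from $q_3,q_4$, with $q_+$ on the side of $q_1,q_2$; $\upsilon=\sigma_{q_+}$ for a cut separating $q_4,q_1$ from $q_2,q_3$, with $q_+$ on the side of $q_4,q_1$; $(b_i),(b'_j),(c_i),(c'_j)$ are any bases of $B_\tau,B_{\tau^*},B_\upsilon,B_{\upsilon^*}$; and $F,E$ are the inverse matrices: $\sum_jF^{ij}(b_k,b'_j)=\delta^i_k$, $\sum_jE^{ij}(c_k,c'_j)=\delta^i_k$. **Hurwitz numbers.** Let $G$ be a finite group. A *$G$-covering* of a simple CW-complex $\Omega$ is a simple CW-complex $\widetilde\Omega$ of the same dimension with an action of $G$ by automorphisms, such that the fixed points of each $g\in G$ form a union of closed cells, and a map $f:\widetilde\Omega\to\Omega$ that induces an isomorphism $\widetilde\Omega/G\cong\Omega$ of CW-complexes. Isomorphisms of $G$-coverings of $\Omega$ are $G$-equivariant isomorphisms over $\Omega$, and $\mathrm{Aut}^G(f)$ is the automorphism group; equivalences of $G$-coverings of colored complexes are $G$-equivariant isomorphisms over an isomorphism of the colored bases. $\Upsilon^G_\sigma$ is the set of equivalence classes of $G$-coverings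 of complexes of class $\sigma\in\Sigma$, and $C^G_\sigma$ is the $\mathbb K$-vector space with basis $\Upsilon_\sigma^G$. A $G$-covering $f$ of a brane complex restricts over $\sigma_q$ to a $G$-covering, whose class in $\Upsilon^G_{\sigma_q}$ is the local invariant of $f$ at $q$. For $\beta_q\in\Upsilon^G_{\sigma_q}$ put $H^G(\Omega,\{\beta_q\})=\sum_f 1/|\mathrm{Aut}^G(f)|$, the sum over the isomorphism classes of $G$-coverings $f$ of $\Omega$ with local invariants $\beta_q$. Let $\mathcal H^G=\{\Phi_\Omega\}$ be the linear forms on $V_\Omega=\bigotimes_qC^G_{\sigma_q}$ with $\Phi_\Omega(\bigotimes_q\beta_q)=H^G(\Omega,\{\beta_q\})$. **Theorem.** $\mathcal H^G$ is a Brane Topological Field Theory on $\{C^G_\sigma\}_{\sigma\in\Sigma}$. Moreover there is a Colored Frobenius Algebra $C^G_\star=\bigoplus_{\sigma\in\Sigma_0}C^G_\sigma$ (the "$G$-foam") with $(x_1,x_2)=\Phi_\Omega(x_1\otimes x_2)$ for all $\Omega\in\Omega(\sigma_1,\sigma_2)$, $x_k\in C^G_{\sigma_k}$, and $(x_1,x_2,x_3)=\Phi_\Omega(x_1\otimes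 x_2\otimes x_3)$ for all $\Omega\in\Omega(\sigma_1,\sigma_2,\sigma_3)$, $x_k\in C^G_{\sigma_k}$. -/

import Mathlib

open scoped TensorProduct DirectSum

noncomputable section

namespace Brane

universe u v w

/-! ### Simple CW-complexes

A simple CW-complex is a finite regular CW-complex of pure dimension. It is given by its set of
cells, partially ordered by inclusion of closures; the underlying space is the order complex of
this poset. -/

/-- The points of the order complex of a subset `s` of a finite poset: convex combinations of the
elements of `s` whose support is a chain, with the topology of `P → ℝ`. -/
def orderComplex {P : Type*} [Fintype P] [PartialOrder P] (s : Set P) : Set (P → ℝ) :=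
  {w | w ∈ stdSimplex ℝ P ∧ Function.support w ⊆ s ∧ IsChain (· ≤ ·) (Function.support w)}

/-- The order complex of `s` is homeomorphic to the unit sphere of `ℝⁿ`, of dimension `n - 1`
(this sphere is empty for `n = 0`). -/
def IsSphere {P : Type*} [Fintype P] [PartialOrder P] (s : Set P) (n : ℕ) : Prop :=
  Nonempty (orderComplex s ≃ₜ Metric.sphere (0 : EuclideanSpace ℝ (Fin n)) 1)

theorem sum_eq_sum_subtype {Q : Type*} [Fintype Q] (t : Set Q) [Fintype t] (f : Q → ℝ)
    (hf : ∀ y, y ∉ t → f y = 0) : ∑ y, f y = ∑ y : t, f y := by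
  classical
  rw [← Finset.sum_subtype (Finset.univ.filter (· ∈ t)) (by simp) f, Finset.sum_filter]
  refine Finset.sum_congr rfl fun y _ => ?_
  by_cases h : y ∈ t
  · simp [h]
  · simp [h, hf y h]

open Classical in
/-- Transport of points of order complexes along an isomorphism of posets. -/
def transferFun {P Q : Type*} [PartialOrder P] [PartialOrder Q] {s : Set P} {t : Set Q}
    (e : s ≃o t) (w : P → ℝ) : Q → ℝ :=
  fun y => if h : y ∈ t then w (e.symm ⟨y, h⟩) else 0

theorem transfer_mem {P Q : Type*} [Fintype P] [PartialOrder P] [Fintype Q] [PartialOrder Q]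
    {s : Set P} {t : Set Q} (e : s ≃o t) {w : P → ℝ} (hw : w ∈ orderComplex s) :
    transferFun e w ∈ orderComplex t := by
  classical
  obtain ⟨⟨h0, h1⟩, hs, hc⟩ := hw
  have key : ∀ y, y ∈ Function.support (transferFun e w) →
      ∃ h : y ∈ t, ((e.symm ⟨y, h⟩ : s) : P) ∈ Function.support w := by
    intro y hy
    by_cases h : y ∈ t
    · exact ⟨h, by simpa [transferFun, h] using hy⟩
    · simp [transferFun, h] at hy
  refine ⟨⟨fun y => ?_, ?_⟩, fun y hy => (key y hy).1, fun y hy z hz hyz => ?_⟩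
  · unfold transferFun
    split_ifs
    exacts [h0 _, le_rfl]
  · rw [← h1, sum_eq_sum_subtype t _ (fun y hy => by simp [transferFun, hy]),
      sum_eq_sum_subtype s w (fun y hy => by
        by_contra h
        exact hy (hs h))]
    exact Fintype.sum_equiv e.symm.toEquiv _ _ fun y => by simp [transferFun]
  · obtain ⟨hy1, hy2⟩ := key y hy
    obtain ⟨hz1, hz2⟩ := key z hz
    rcases hc.total hy2 hz2 with h | h
    · exact Or.inl (e.symm.le_iff_le.1 (show e.symm ⟨y, hy1⟩ ≤ e.symm ⟨z, hz1⟩ from h))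
    · exact Or.inr (e.symm.le_iff_le.1 (show e.symm ⟨z, hz1⟩ ≤ e.symm ⟨y, hy1⟩ from h))

theorem transfer_transfer {P Q : Type*} [Fintype P] [PartialOrder P] [PartialOrder Q]
    {s : Set P} {t : Set Q} (e : s ≃o t) {w : P → ℝ} (hw : w ∈ orderComplex s) :
    transferFun e.symm (transferFun e w) = w := by
  funext x
  by_cases h : x ∈ s
  · simp [transferFun, h]
  · have : w x = 0 := by
      by_contra h'
      exact h (hw.2.1 h')
    simp [transferFun, h, this]

theorem continuous_transferFun {P Q : Type*} [PartialOrder P] [PartialOrder Q] {s : Set P}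
    {t : Set Q} (e : s ≃o t) : Continuous (transferFun e) := by
  refine continuous_pi fun y => ?_
  by_cases h : y ∈ t
  · simpa [transferFun, h] using continuous_apply _
  · simpa [transferFun, h] using continuous_const

/-- Isomorphic posets have homeomorphic order complexes. -/
theorem IsSphere.congr {P Q : Type*} [Fintype P] [PartialOrder P] [Fintype Q] [PartialOrder Q]
    {s : Set P} {t : Set Q} {n : ℕ} (h : IsSphere s n) (e : s ≃o t) : IsSphere t n := by
  obtain ⟨φ⟩ := h
  refine ⟨Homeomorph.trans (?_ : orderComplex t ≃ₜ orderComplex s) φ⟩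
  exact
    { toFun := fun w => ⟨transferFun e.symm w.1, transfer_mem e.symm w.2⟩
      invFun := fun w => ⟨transferFun e w.1, transfer_mem e w.2⟩
      left_inv := fun w => Subtype.ext (transfer_transfer e.symm w.2)
      right_inv := fun w => Subtype.ext (transfer_transfer e w.2)
      continuous_toFun :=
        ((continuous_transferFun e.symm).comp continuous_subtype_val).subtype_mk _
      continuous_invFun := ((continuous_transferFun e).comp continuous_subtype_val).subtype_mk _ }

/-- A subset of a poset is connected: it is nonempty and any two of its elements are joined by a
path of comparable elements of it. -/
def ConnectedOn {P : Type*} [PartialOrder P] (s : Set P) : Prop :=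
  s.Nonempty ∧ ∀ x ∈ s, ∀ y ∈ s,
    Relation.ReflTransGen (fun a b => a ∈ s ∧ b ∈ s ∧ (a ≤ b ∨ b ≤ a)) x y

/-- Two cells lie in the same connected component. -/
def SameComponent {P : Type*} [PartialOrder P] (x y : P) : Prop :=
  Relation.ReflTransGen (fun a b => a ≤ b ∨ b ≤ a) x y

/-- A simple CW-complex of dimension `d`: a finite CW-complex in which the closure of every cell
is a closed ball and which is the closure of its `d`-dimensional cells, given by its face poset.
The closed cell `x` is the cone over the order complex of the set of cells below `x`; it is a ball
of dimension `dim x` with boundary a sphere of dimension `dim x - 1`. -/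
structure SimpleComplex (d : ℕ) where
  Cell : Type
  [fintypeCell : Fintype Cell]
  [orderCell : PartialOrder Cell]
  dim : Cell → ℕ
  dim_lt : ∀ {x y : Cell}, x < y → dim x < dim y
  sphere : ∀ x : Cell, IsSphere (Set.Iio x) (dim x)
  pure : ∀ x : Cell, ∃ y, x ≤ y ∧ dim y = d

attribute [instance] SimpleComplex.fintypeCell SimpleComplex.orderCell

namespace SimpleComplex

variable {d : ℕ} (c : SimpleComplex d)

/-- Vertices are the cells of dimension zero. -/
abbrev Vertex : Type := {x : c.Cell // c.dim x = 0}

/-- A full flag of cells of dimensions `0, 1, …, n`; it is a top-dimensional simplex of the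
barycentric subdivision of its last cell. -/
def IsFlag {n : ℕ} (f : Fin (n + 1) → c.Cell) : Prop :=
  StrictMono f ∧ ∀ i, c.dim (f i) = i

variable {c}

theorem Vertex.eq_of_le {p : c.Vertex} {x : c.Cell} (h : x ≤ p.1) : x = p.1 := by
  rcases h.lt_or_eq with h | h
  · have := c.dim_lt h
    have := p.2
    omega
  · exact h

theorem exists_vertex_le (x : c.Cell) : ∃ p : c.Vertex, p.1 ≤ x := by
  obtain ⟨y, hyx, hy⟩ := exists_minimal_le_of_wellFoundedLT (fun _ : c.Cell => True) x trivial
  refine ⟨⟨y, ?_⟩, hyx⟩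
  by_contra h0
  obtain ⟨φ⟩ := c.sphere y
  have : Nonempty (Fin (c.dim y)) := ⟨⟨0, Nat.pos_of_ne_zero h0⟩⟩
  obtain ⟨v, hv⟩ := (NormedSpace.sphere_nonempty (x := (0 : EuclideanSpace ℝ (Fin (c.dim y))))
    (r := 1)).2 zero_le_one
  obtain ⟨⟨h1, h2⟩, h3, -⟩ := (φ.symm ⟨v, hv⟩).2
  have hz : ∀ z, (φ.symm ⟨v, hv⟩).1 z = 0 := by
    intro z
    by_contra hz
    exact (h3 hz : z < y).not_ge (hy.2 trivial (h3 hz : z < y).le)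
  simp [hz] at h2

/-- A cell that properly contains a vertex has another vertex. -/
theorem exists_other_vertex {q : c.Vertex} {x : c.Cell} (h : q.1 < x) :
    ∃ p : c.Vertex, p ≠ q ∧ p.1 ≤ x := by
  by_contra hcon
  push Not at hcon
  obtain ⟨y, hyx, hy⟩ := exists_minimal_le_of_wellFoundedLT (fun z : c.Cell => q.1 < z) x h
  have hIio : ∀ z, z < y → z = q.1 := by
    intro z hz
    obtain ⟨p, hp⟩ := exists_vertex_le z
    have hpq : p = q := by
      by_contra hne
      exact hcon p hne (hp.trans (hz.le.trans hyx))
    subst hpq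
    rcases hp.lt_or_eq with h' | h'
    · exact absurd (hy.2 h' hz.le) hz.not_ge
    · exact h'.symm
  have hd : 0 < c.dim y := lt_of_le_of_lt (Nat.zero_le _) (c.dim_lt hy.1)
  obtain ⟨φ⟩ := c.sphere y
  have hsub : ∀ a b : orderComplex (Set.Iio y), a = b := by
    have hz : ∀ (a : orderComplex (Set.Iio y)) z, z ≠ q.1 → a.1 z = 0 := by
      intro a z hz
      by_contra h'
      exact hz (hIio z (a.2.2.1 h'))
    have h1 : ∀ a : orderComplex (Set.Iio y), a.1 q.1 = 1 := by
      intro a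
      have := a.2.1.2
      rwa [Fintype.sum_eq_single q.1 (hz a)] at this
    intro a b
    refine Subtype.ext (funext fun z => ?_)
    by_cases h' : z = q.1
    · rw [h', h1, h1]
    · rw [hz a z h', hz b z h']
  have : Nonempty (Fin (c.dim y)) := ⟨⟨0, hd⟩⟩
  obtain ⟨v, hv⟩ := (NormedSpace.sphere_nonempty (x := (0 : EuclideanSpace ℝ (Fin (c.dim y))))
    (r := 1)).2 zero_le_one
  have hv' : -v ∈ Metric.sphere (0 : EuclideanSpace ℝ (Fin (c.dim y))) 1 := by
    simpa using hv
  have h2 : v = -v := by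
    have := φ.symm.injective (hsub (φ.symm ⟨v, hv⟩) (φ.symm ⟨-v, hv'⟩))
    exact congrArg Subtype.val this
  have h3 : v = 0 := by
    have : (2 : ℝ) • v = 0 := by
      rw [two_smul]
      nth_rewrite 1 [h2]
      exact neg_add_cancel v
    simpa using this
  simp [h3] at hv

end SimpleComplex

/-! ### Colored complexes -/

/-- A colored complex of dimension `d`: all cells of positive dimension are oriented and colored,
and cells of the same dimension in the same connected component have different colors.

An orientation of a cell of dimension `n + 1` is given by the signs of the top-dimensional
simplices of its barycentric subdivision (the flags that end in it, vertices ordered by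
dimension): simplices with a common facet have opposite signs. -/
structure ColoredComplex (d : ℕ) (S : Type u) extends SimpleComplex d where
  color : {x : Cell // 0 < dim x} → S
  color_inj : ∀ x y : {x : Cell // 0 < dim x}, SameComponent x.1 y.1 → dim x.1 = dim y.1 →
    color x = color y → x = y
  /-- The sign of a flag; values on tuples that are not flags are irrelevant. -/
  ori : ∀ n : ℕ, (Fin (n + 2) → Cell) → ℤˣ
  ori_flip : ∀ (n : ℕ) (f f' : Fin (n + 2) → Cell), toSimpleComplex.IsFlag f →
    toSimpleComplex.IsFlag f' → f (Fin.last _) = f' (Fin.last _) →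
    (∃ i, f i ≠ f' i ∧ ∀ j, j ≠ i → f j = f' j) → ori n f' = - ori n f

namespace ColoredComplex

variable {d : ℕ} {S : Type u}

/-- A map of cells preserves dimensions, colors and orientations. -/
structure Preserves (c c' : ColoredComplex d S) (φ : c.Cell → c'.Cell) : Prop where
  dim : ∀ x, c'.dim (φ x) = c.dim x
  color : ∀ (x : {x : c.Cell // 0 < c.dim x}) (x' : {x : c'.Cell // 0 < c'.dim x}),
    x'.1 = φ x.1 → c'.color x' = c.color x
  ori : ∀ (n : ℕ) (f : Fin (n + 2) → c.Cell), c.IsFlag f → c'.ori n (φ ∘ f) = c.ori n f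

/-- Isomorphisms of colored complexes. -/
structure Iso (c c' : ColoredComplex d S) where
  cell : c.Cell ≃o c'.Cell
  preserves : Preserves c c' cell

def Iso.refl (c : ColoredComplex d S) : Iso c c where
  cell := OrderIso.refl _
  preserves :=
    { dim := fun _ => rfl
      color := fun x x' h => by rw [Subtype.ext h]
      ori := fun _ _ _ => rfl }

theorem Preserves.isFlag {c c' : ColoredComplex d S} {φ : c.Cell ≃o c'.Cell}
    (h : Preserves c c' φ) {n : ℕ} {f : Fin (n + 1) → c.Cell} (hf : c.IsFlag f) :
    c'.IsFlag (φ ∘ f) :=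
  ⟨φ.strictMono.comp hf.1, fun i => (h.dim _).trans (hf.2 i)⟩

def Iso.symm {c c' : ColoredComplex d S} (φ : Iso c c') : Iso c' c where
  cell := φ.cell.symm
  preserves :=
    { dim := fun x => by simpa using (φ.preserves.dim (φ.cell.symm x)).symm
      color := fun x x' h => (φ.preserves.color x' x (by simp [h])).symm
      ori := fun n f hf => by
        have hf' : c.IsFlag (φ.cell.symm ∘ f) :=
          ⟨φ.cell.symm.strictMono.comp hf.1, fun i => by
            have := φ.preserves.dim (φ.cell.symm (f i))
            simp only [OrderIso.apply_symm_apply] at this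
            exact this.symm.trans (hf.2 i)⟩
        have := φ.preserves.ori n _ hf'
        rw [← this]
        congr 1
        funext i
        simp }

def Iso.trans {c c' c'' : ColoredComplex d S} (φ : Iso c c') (ψ : Iso c' c'') : Iso c c'' where
  cell := φ.cell.trans ψ.cell
  preserves :=
    { dim := fun x => (ψ.preserves.dim _).trans (φ.preserves.dim _)
      color := fun x x' h =>
        (ψ.preserves.color ⟨φ.cell x.1, by rw [φ.preserves.dim]; exact x.2⟩ x' h).trans
          (φ.preserves.color x _ rfl)
      ori := fun n f hf =>
        (ψ.preserves.ori n _ (φ.preserves.isFlag hf)).trans (φ.preserves.ori n f hf) }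

/-- The complex with all orientations inverted. -/
def star (c : ColoredComplex d S) : ColoredComplex d S where
  toSimpleComplex := c.toSimpleComplex
  color := c.color
  color_inj := c.color_inj
  ori n f := - c.ori n f
  ori_flip n f f' h h' hl hd := by rw [c.ori_flip n f f' h h' hl hd]

def Iso.star {c c' : ColoredComplex d S} (φ : Iso c c') : Iso c.star c'.star where
  cell := φ.cell
  preserves :=
    { dim := φ.preserves.dim
      color := φ.preserves.color
      ori := fun n f hf => congrArg Neg.neg (φ.preserves.ori n f hf) }

end ColoredComplex

/-- Connected colored complexes of dimension `D`. -/
abbrev ConnectedColoredComplex (D : ℕ) (S : Type u) : Type (max 1 u) :=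
  {c : ColoredComplex D S // ConnectedOn (Set.univ : Set c.Cell)}

instance coloredSetoid (D : ℕ) (S : Type u) : Setoid (ConnectedColoredComplex D S) where
  r c c' := Nonempty (ColoredComplex.Iso c.1 c'.1)
  iseqv :=
    { refl := fun c => ⟨ColoredComplex.Iso.refl c.1⟩
      symm := fun ⟨φ⟩ => ⟨φ.symm⟩
      trans := fun ⟨φ⟩ ⟨ψ⟩ => ⟨φ.trans ψ⟩ }

/-- The set `Σ(D, S)` of isomorphism classes of connected colored complexes of dimension `D`. -/
def ColorClass (D : ℕ) (S : Type u) : Type (max 1 u) :=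
  Quotient (coloredSetoid D S)

/-- The involution of `Σ(D, S)` induced by the inversion of orientations. -/
def ColorClass.star {D : ℕ} {S : Type u} : ColorClass D S → ColorClass D S :=
  Quotient.map (fun c => ⟨c.1.star, c.2⟩) fun _ _ ⟨φ⟩ => ⟨φ.star⟩

/-! ### Brane complexes -/

/-- A cyclic complex: a colored complex with a cyclic order on the vertices of every connected
component, given by the permutation that takes a vertex to the next one. -/
structure CyclicComplex (d : ℕ) (S : Type u) extends ColoredComplex d S where
  next : Equiv.Perm toSimpleComplex.Vertex
  next_sameCycle : ∀ p q : toSimpleComplex.Vertex,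
    next.SameCycle p q ↔ SameComponent p.1 q.1

namespace CyclicComplex

variable {d : ℕ} {S : Type u} (Ω : CyclicComplex d S)

/-- The closed cell `x` has a vertex in `A`. -/
def Meets (A : Set Ω.Vertex) (x : Ω.Cell) : Prop := ∃ a ∈ A, a.1 ≤ x

/-- The cells with vertices both in `A` and outside `A`: these are the cells intersected by a cut
that separates `A` from the other vertices. -/
def crossing (A : Set Ω.Vertex) : Set Ω.Cell := {x | Ω.Meets A x ∧ Ω.Meets Aᶜ x}

/-- `A` is one of the two groups of a division, compatible with the cyclic order, of the vertices
of a connected component into two nonempty groups: going around the component along the cyclic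
order, one leaves `A` exactly once. -/
def IsArc (A : Set Ω.Vertex) : Prop :=
  (∀ a ∈ A, ∀ b ∈ A, SameComponent a.1 b.1) ∧ ∃! a, a ∈ A ∧ Ω.next a ∉ A

/-- There is a cut that separates `A` from the other vertices of its connected component: the
cells crossed by the cut, each lowered by one in dimension, are the cells of a connected complex
in which the closure of every cell is a ball, and this complex divides the component into two
connected parts. -/
structure HasCut (A : Set Ω.Vertex) : Prop where
  connected : ConnectedOn (Ω.crossing A)
  sphere : ∀ x ∈ Ω.crossing A, IsSphere {y | y ∈ Ω.crossing A ∧ y < x} (Ω.dim x - 1)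
  connected_left : ConnectedOn {x | Ω.Meets A x}
  connected_right : ConnectedOn {x | Ω.Meets Aᶜ x ∧ ∃ a ∈ A, SameComponent a.1 x}

end CyclicComplex

/-- A brane complex of dimension `d`: every division of the vertices of a connected component
that is compatible with the cyclic order is realized by a cut. -/
structure BraneComplex (d : ℕ) (S : Type u) extends CyclicComplex d S where
  hasCut : ∀ A, toCyclicComplex.IsArc A → toCyclicComplex.HasCut A

namespace BraneComplex

variable {D : ℕ} {S : Type u} (Ω : BraneComplex (D + 1) S)

theorem isArc_singleton (q : Ω.Vertex) : Ω.IsArc {q} := by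
  refine ⟨?_, q, ⟨rfl, ?_⟩, fun a ha => ha.1⟩
  · rintro a rfl b rfl
    exact Relation.ReflTransGen.refl
  · intro hq
    obtain ⟨y, hqy, hy⟩ := Ω.pure q.1
    have hlt : q.1 < y := by
      refine lt_of_le_of_ne hqy fun h => ?_
      have := q.2
      rw [h] at this
      omega
    obtain ⟨p, hpq, hp⟩ := SimpleComplex.exists_other_vertex hlt
    have hs : SameComponent q.1 p.1 :=
      Relation.ReflTransGen.tail (b := y) (Relation.ReflTransGen.single (Or.inl hqy)) (Or.inr hp)
    have := (Ω.next_sameCycle q p).2 hs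
    exact hpq ((Equiv.Perm.SameCycle.eq_of_left this hq).symm)

theorem crossing_singleton (q : Ω.Vertex) : Ω.crossing {q} = {x | q.1 < x} := by
  ext x
  constructor
  · rintro ⟨⟨a, rfl, ha⟩, b, hb, hbx⟩
    refine lt_of_le_of_ne ha fun h => hb ?_
    subst h
    exact Subtype.ext (SimpleComplex.Vertex.eq_of_le hbx)
  · intro h
    obtain ⟨p, hp, hpx⟩ := SimpleComplex.exists_other_vertex h
    exact ⟨⟨q, rfl, le_of_lt h⟩, p, hp, hpx⟩

variable {Ω} in
theorem sameComponent_of_link {q : Ω.Vertex} (x y : {x : Ω.Cell // q.1 < x}) :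
    SameComponent x.1 y.1 :=
  Relation.ReflTransGen.tail (b := q.1) (Relation.ReflTransGen.single (Or.inr x.2.le))
    (Or.inl y.2.le)

theorem dim_pos_of_link {q : Ω.Vertex} (x : {x : Ω.Cell // q.1 < x}) : 0 < Ω.dim x.1 :=
  lt_of_le_of_lt (Nat.zero_le _) (Ω.dim_lt x.2)

/-- The order isomorphism between the cells below `x` of the link of `q` as a subset of the link
and as a subset of the complex. -/
def linkIso {P : Type*} [PartialOrder P] (q : P) (x : {x : P // q < x}) :
    {y : P | q < y ∧ y < x.1} ≃o (Set.Iio x : Set {x : P // q < x}) where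
  toFun y := ⟨⟨y.1, y.2.1⟩, y.2.2⟩
  invFun y := ⟨y.1.1, y.1.2, y.2⟩
  left_inv _ := rfl
  right_inv _ := rfl
  map_rel_iff' := Iff.rfl

theorem isFlag_cons {q : Ω.Vertex} {n : ℕ} {f : Fin (n + 1) → {x : Ω.Cell // q.1 < x}}
    (hf : StrictMono f) (hd : ∀ i, Ω.dim (f i).1 - 1 = i) :
    Ω.IsFlag (Fin.cons q.1 (fun i => (f i).1) : Fin (n + 2) → Ω.Cell) := by
  constructor
  · refine Fin.strictMono_iff_lt_succ.2 fun i => ?_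
    induction i using Fin.cases with
    | zero => simpa using (f 0).2
    | succ j =>
      rw [← Fin.succ_castSucc, Fin.cons_succ, Fin.cons_succ]
      exact hf j.castSucc_lt_succ
  · intro i
    induction i using Fin.cases with
    | zero => simpa using q.2
    | succ j =>
      have := hd j
      have := Ω.dim_pos_of_link (f j)
      simp only [Fin.cons_succ, Fin.val_succ]
      omega

/-- The vertex complex of `q`: the cut that separates `q` from the other vertices. Its cells are
the intersections with the cells that contain `q`, with their colors. A cell is oriented as a
boundary of the part not containing `q`, which is the opposite of the facet orientation of the
simplices opposite to `q`. -/
def vertexComplex (q : Ω.Vertex) : ColoredComplex D S where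
  Cell := {x : Ω.Cell // q.1 < x}
  fintypeCell := @Subtype.fintype _ _ (Classical.decPred _) _
  dim x := Ω.dim x.1 - 1
  dim_lt {x y} h := by
    have h1 := Ω.dim_lt (show x.1 < y.1 from h)
    have h2 := Ω.dim_pos_of_link x
    omega
  sphere x := by
    have h := (Ω.hasCut _ (Ω.isArc_singleton q)).sphere x.1
      (by rw [Ω.crossing_singleton q]; exact x.2)
    rw [Ω.crossing_singleton q] at h
    exact @IsSphere.congr _ _ _ _ (_) _ _ _ _ h (linkIso q.1 x)
  pure x := by
    obtain ⟨y, hxy, hy⟩ := Ω.pure x.1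
    exact ⟨⟨y, x.2.trans_le hxy⟩, hxy, by simp [hy]⟩
  color x := Ω.color ⟨x.1.1, Ω.dim_pos_of_link x.1⟩
  color_inj x y _ hd hc := by
    have h1 := Ω.dim_pos_of_link x.1
    have h2 := Ω.dim_pos_of_link y.1
    have := Ω.color_inj _ _ (sameComponent_of_link x.1 y.1) (by simp only; omega) hc
    have h3 : x.1.1 = y.1.1 := Subtype.mk.inj this
    have h4 : x.1 = y.1 := Subtype.ext h3
    exact Subtype.ext h4
  ori n f := - Ω.ori (n + 1) (Fin.cons q.1 fun i => (f i).1)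
  ori_flip n f f' hf hf' hl hd := by
    obtain ⟨i, hi, hj⟩ := hd
    rw [Ω.ori_flip (n + 1) _ _ (Ω.isFlag_cons hf.1 hf.2) (Ω.isFlag_cons hf'.1 hf'.2)
      (by
        rw [← Fin.succ_last, Fin.cons_succ, Fin.cons_succ, hl])
      ⟨i.succ, by simpa [Subtype.ext_iff] using hi, fun j hij => by
        induction j using Fin.cases with
        | zero => rfl
        | succ j =>
          rw [Fin.cons_succ, Fin.cons_succ, hj j fun h => hij (by rw [h])]⟩]

theorem vertexComplex_connected (q : Ω.Vertex) :
    ConnectedOn (Set.univ : Set (Ω.vertexComplex q).Cell) := by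
  have h := (Ω.hasCut _ (Ω.isArc_singleton q)).connected
  rw [Ω.crossing_singleton q] at h
  obtain ⟨⟨x, hx⟩, h⟩ := h
  refine ⟨⟨⟨x, hx⟩, trivial⟩, fun a _ b _ => ?_⟩
  have key : ∀ z, Relation.ReflTransGen (fun a b => a ∈ {x | q.1 < x} ∧ b ∈ {x | q.1 < x} ∧
      (a ≤ b ∨ b ≤ a)) a.1 z → ∀ hz : q.1 < z,
      Relation.ReflTransGen (fun a b : (Ω.vertexComplex q).Cell => a ∈ Set.univ ∧
        b ∈ Set.univ ∧ (a ≤ b ∨ b ≤ a)) a ⟨z, hz⟩ := by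
    intro z hz
    induction hz with
    | refl => exact fun _ => Relation.ReflTransGen.refl
    | tail _ hbc ih => exact fun _ => (ih hbc.1).tail ⟨trivial, trivial, hbc.2.2⟩
  exact key b.1 (h a.1 a.2 b.1 b.2) b.2

/-- The class in `Σ(D, S)` of the vertex complex of `q`. -/
def cls (q : Ω.Vertex) : ColorClass D S :=
  Quotient.mk (coloredSetoid D S) ⟨Ω.vertexComplex q, Ω.vertexComplex_connected q⟩

end BraneComplex

/-! ### Morphisms of brane complexes -/

section Morphisms

variable {D : ℕ} {S : Type u}

/-- The vertex map of a dimension-preserving map of cells. -/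
def vertexMap {d : ℕ} {c c' : ColoredComplex d S} {φ : c.Cell → c'.Cell}
    (h : ColoredComplex.Preserves c c' φ) (q : c.Vertex) : c'.Vertex :=
  ⟨φ q.1, (h.dim q.1).trans q.2⟩

/-- Isomorphisms of brane complexes. -/
structure BraneIso (Ω Ω' : BraneComplex (D + 1) S) extends
    ColoredComplex.Iso Ω.toColoredComplex Ω'.toColoredComplex where
  next : ∀ q, Ω'.next (vertexMap preserves q) = vertexMap preserves (Ω.next q)

/-- The brane complex `Ω` is the disjoint union of `Ω₁` and `Ω₂`. -/
structure DisjointUnion (Ω Ω₁ Ω₂ : BraneComplex (D + 1) S) where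
  inl : Ω₁.Cell ↪o Ω.Cell
  inr : Ω₂.Cell ↪o Ω.Cell
  cover : ∀ x, x ∈ Set.range inl ∨ x ∈ Set.range inr
  not_inl_le_inr : ∀ x y, ¬ inl x ≤ inr y
  not_inr_le_inl : ∀ x y, ¬ inr y ≤ inl x
  preserves_inl : ColoredComplex.Preserves Ω₁.toColoredComplex Ω.toColoredComplex inl
  preserves_inr : ColoredComplex.Preserves Ω₂.toColoredComplex Ω.toColoredComplex inr
  next_inl : ∀ q, Ω.next (vertexMap preserves_inl q) = vertexMap preserves_inl (Ω₁.next q)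
  next_inr : ∀ q, Ω.next (vertexMap preserves_inr q) = vertexMap preserves_inr (Ω₂.next q)

/-- The cells of the complex `Ω'` obtained from `Ω` by cutting along a cut that separates the
vertices `A` from the others and contracting the two copies of the cut to the points `plus` (on
the side of `A`) and `minus`. Every cell of `Ω` that meets `A` gives a cell on the side of `A`,
every cell with a vertex outside `A` gives a cell on the other side, so the cells that cross the
cut are split into two; there are two further cells, `plus` and `minus`. -/
structure CutCells (Ω Ω' : BraneComplex (D + 1) S) where
  A : Set Ω.Vertex
  arc : Ω.IsArc A
  left : {x // Ω.Meets A x} ↪o Ω'.Cell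
  right : {x // Ω.Meets Aᶜ x} ↪o Ω'.Cell
  plus : Ω'.Vertex
  minus : Ω'.Vertex
  cover : ∀ x, x ∈ Set.range left ∨ x ∈ Set.range right ∨ x = plus.1 ∨ x = minus.1
  plus_ne_minus : plus ≠ minus
  left_ne : ∀ x, left x ≠ plus.1 ∧ left x ≠ minus.1
  right_ne : ∀ x, right x ≠ plus.1 ∧ right x ≠ minus.1
  not_left_le_right : ∀ x y, ¬ left x ≤ right y
  not_right_le_left : ∀ x y, ¬ right y ≤ left x
  plus_le_left : ∀ x, plus.1 ≤ left x ↔ x.1 ∈ Ω.crossing A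
  minus_le_right : ∀ x, minus.1 ≤ right x ↔ x.1 ∈ Ω.crossing A
  not_plus_le_right : ∀ x, ¬ plus.1 ≤ right x
  not_minus_le_left : ∀ x, ¬ minus.1 ≤ left x
  dim_left : ∀ x, Ω'.dim (left x) = Ω.dim x.1
  dim_right : ∀ x, Ω'.dim (right x) = Ω.dim x.1
  color_left : ∀ x h h', Ω'.color ⟨left x, h'⟩ = Ω.color ⟨x.1, h⟩
  color_right : ∀ x h h', Ω'.color ⟨right x, h'⟩ = Ω.color ⟨x.1, h⟩
  ori_left : ∀ (n : ℕ) (f : Fin (n + 2) → {x // Ω.Meets A x}), Ω.IsFlag (fun i => (f i).1) →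
    Ω'.ori n (left ∘ f) = Ω.ori n fun i => (f i).1
  ori_right : ∀ (n : ℕ) (f : Fin (n + 2) → {x // Ω.Meets Aᶜ x}), Ω.IsFlag (fun i => (f i).1) →
    Ω'.ori n (right ∘ f) = Ω.ori n fun i => (f i).1

open Classical in
/-- The vertices of `Ω` as vertices of the cut complex. -/
def CutCells.vert {Ω Ω' : BraneComplex (D + 1) S} (η : CutCells Ω Ω') (q : Ω.Vertex) :
    Ω'.Vertex :=
  if h : q ∈ η.A then ⟨η.left ⟨q.1, q, h, le_rfl⟩, (η.dim_left _).trans q.2⟩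
  else ⟨η.right ⟨q.1, q, h, le_rfl⟩, (η.dim_right _).trans q.2⟩

/-- A cut morphism from `Ω` to the brane complex `Ω'` obtained by cutting and contracting. The
cyclic order is kept on each side, with the new vertex in the place of the removed ones. -/
structure CutMorphism (Ω Ω' : BraneComplex (D + 1) S) extends CutCells Ω Ω' where
  next_same : ∀ q, (q ∈ A ↔ Ω.next q ∈ A) →
    Ω'.next (toCutCells.vert q) = toCutCells.vert (Ω.next q)
  next_leave : ∀ q, q ∈ A → Ω.next q ∉ A →
    Ω'.next (toCutCells.vert q) = plus ∧ Ω'.next minus = toCutCells.vert (Ω.next q)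
  next_enter : ∀ q, q ∉ A → Ω.next q ∈ A →
    Ω'.next (toCutCells.vert q) = minus ∧ Ω'.next plus = toCutCells.vert (Ω.next q)

end Morphisms

/-! ### Brane topological field theories -/

section Theory

variable {𝕂 : Type v} [Field 𝕂] {D : ℕ} {S : Type u}

/-- The identification `B σ = B τ` for equal indices. -/
def transport {ι : Type*} {B : ι → Type w} [∀ i, AddCommGroup (B i)] [∀ i, Module 𝕂 (B i)]
    {σ τ : ι} (h : σ = τ) : B σ ≃ₗ[𝕂] B τ :=
  h ▸ LinearEquiv.refl 𝕂 (B σ)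

open Classical in
/-- The linear map that takes `u ⊗ v` to the tensor product of the vectors `x i`, with the factors
at `p` and `q` replaced by `u` and `v`. -/
def insertPair {ι : Type*} {M : ι → Type w} [∀ i, AddCommGroup (M i)] [∀ i, Module 𝕂 (M i)]
    (x : ∀ i, M i) (p q : ι) (hpq : p ≠ q) : M p ⊗[𝕂] M q →ₗ[𝕂] ⨂[𝕂] i, M i :=
  TensorProduct.lift <| LinearMap.mk₂ 𝕂
    (fun u v => PiTensorProduct.tprod 𝕂 (Function.update (Function.update x p u) q v))
    (fun u u' v => by simp only [Function.update_comm hpq, MultilinearMap.map_update_add])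
    (fun c u v => by simp only [Function.update_comm hpq, MultilinearMap.map_update_smul])
    (fun u v v' => by simp only [MultilinearMap.map_update_add])
    (fun c u v => by simp only [MultilinearMap.map_update_smul])

variable (B : ColorClass D S → Type w) [∀ σ, AddCommGroup (B σ)] [∀ σ, Module 𝕂 (B σ)]

variable (𝕂) in
/-- The vector space `V_Ω`. -/
abbrev VSpace (Ω : BraneComplex (D + 1) S) : Type _ :=
  ⨂[𝕂] q : Ω.Vertex, B (Ω.cls q)

variable {B}

/-- The bilinear form of a complex with two vertices `p`, `q`, as a form on `B_{σ_p} × B_{σ_q}`. -/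
def twoVertexForm {Ω : BraneComplex (D + 1) S} (Φ : VSpace 𝕂 B Ω →ₗ[𝕂] 𝕂) (p q : Ω.Vertex)
    (hpq : p ≠ q) : B (Ω.cls p) →ₗ[𝕂] B (Ω.cls q) →ₗ[𝕂] 𝕂 :=
  TensorProduct.curry (Φ ∘ₗ insertPair (M := fun r => B (Ω.cls r)) 0 p q hpq)

/-- The element `η_*(x) = x ⊗ K` of `V_{Ω'}` for a cut morphism `η : Ω → Ω'`: the vectors at the
vertices of `Ω` are those of the family `x'`, and `K ∈ B_σ ⊗ B_{σ^*}` is inserted at the vertices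
`plus` and `minus`. -/
def cutTensor {Ω Ω' : BraneComplex (D + 1) S} (η : CutMorphism Ω Ω')
    (h : Ω'.cls η.minus = (Ω'.cls η.plus).star)
    (K : B (Ω'.cls η.plus) ⊗[𝕂] B (Ω'.cls η.plus).star)
    (x' : ∀ q, B (Ω'.cls q)) : VSpace 𝕂 B Ω' :=
  insertPair x' η.plus η.minus η.plus_ne_minus
    (TensorProduct.map LinearMap.id (transport (B := B) h.symm).toLinearMap K)

/-- A family of linear forms on the spaces `V_Ω` is a brane topological field theory on the
family `B` of finite-dimensional vector spaces, for suitable tensors `K_σ ∈ B_σ ⊗ B_{σ^*}`.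
In each axiom the identities between classes of vertex complexes that it presupposes are part of
what is asserted. -/
structure IsBraneTFT (Φ : ∀ Ω : BraneComplex (D + 1) S, VSpace 𝕂 B Ω →ₗ[𝕂] 𝕂) : Prop where
  finite : ∀ σ, Module.Finite 𝕂 (B σ)
  invariance : ∀ (Ω Ω' : BraneComplex (D + 1) S) (φ : BraneIso Ω Ω'),
    ∃ h : ∀ q, Ω.cls q = Ω'.cls (vertexMap φ.preserves q),
      ∀ (x : ∀ q, B (Ω.cls q)) (x' : ∀ q, B (Ω'.cls q)),
        (∀ q, x' (vertexMap φ.preserves q) = transport (𝕂 := 𝕂) (h q) (x q)) →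
          Φ Ω' (PiTensorProduct.tprod 𝕂 x') = Φ Ω (PiTensorProduct.tprod 𝕂 x)
  nondegeneracy : ∀ (Ω : BraneComplex (D + 1) S) (p q : Ω.Vertex) (hpq : p ≠ q),
    (∀ r, r = p ∨ r = q) → Ω.cls q = (Ω.cls p).star ∧
      (twoVertexForm (Φ Ω) p q hpq).Nondegenerate
  cut : ∃ K : ∀ σ, B σ ⊗[𝕂] B σ.star,
    ∀ (Ω Ω' : BraneComplex (D + 1) S) (η : CutMorphism Ω Ω'),
      ∃ (h : ∀ q, Ω.cls q = Ω'.cls (η.vert q)) (h' : Ω'.cls η.minus = (Ω'.cls η.plus).star),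
        ∀ (x : ∀ q, B (Ω.cls q)) (x' : ∀ q, B (Ω'.cls q)),
          (∀ q, x' (η.vert q) = transport (𝕂 := 𝕂) (h q) (x q)) →
            Φ Ω' (cutTensor η h' (K _) x') = Φ Ω (PiTensorProduct.tprod 𝕂 x)
  multiplicativity : ∀ (Ω Ω₁ Ω₂ : BraneComplex (D + 1) S) (θ : DisjointUnion Ω Ω₁ Ω₂),
    ∃ (h₁ : ∀ q, Ω₁.cls q = Ω.cls (vertexMap θ.preserves_inl q))
      (h₂ : ∀ q, Ω₂.cls q = Ω.cls (vertexMap θ.preserves_inr q)),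
      ∀ (x₁ : ∀ q, B (Ω₁.cls q)) (x₂ : ∀ q, B (Ω₂.cls q)) (x : ∀ q, B (Ω.cls q)),
        (∀ q, x (vertexMap θ.preserves_inl q) = transport (𝕂 := 𝕂) (h₁ q) (x₁ q)) →
        (∀ q, x (vertexMap θ.preserves_inr q) = transport (𝕂 := 𝕂) (h₂ q) (x₂ q)) →
          Φ Ω (PiTensorProduct.tprod 𝕂 x) =
            Φ Ω₁ (PiTensorProduct.tprod 𝕂 x₁) * Φ Ω₂ (PiTensorProduct.tprod 𝕂 x₂)

end Theory

/-! ### Colored Frobenius algebras -/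

section Algebra

variable {D : ℕ} {S : Type u}

/-- `b` comes after `a` and `c` comes after `b` in the cyclic order of a component. -/
def CyclicComplex.CyclicallyOrdered {d : ℕ} (Ω : CyclicComplex d S) (a b c : Ω.Vertex) : Prop :=
  ∃ i j : ℕ, 0 < i ∧ i < j ∧ (Ω.next ^ i) a = b ∧ (Ω.next ^ j) a = c ∧
    ∀ k, 0 < k → k ≤ j → (Ω.next ^ k) a ≠ a

/-- The orientation agrees with the cyclic order: in every 2-cell with at least three vertices,
if the edge with ends `a`, `b` leads from `a` to `b` in the cyclic order of the vertices of the
2-cell, then it leads from `a` to `b` along the orientation of the boundary of the 2-cell. -/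
def CyclicComplex.Coherent {d : ℕ} (Ω : CyclicComplex d S) : Prop :=
  ∀ (a b v : Ω.Vertex) (f : Fin 3 → Ω.Cell), Ω.IsFlag f → f 0 = a.1 → b.1 ≤ f 1 → v.1 ≤ f 2 →
    Ω.CyclicallyOrdered a b v → Ω.ori 1 f = 1

/-- `Ω` is compatible with the sequence `σ`: it is connected and its vertices are numbered along
the cyclic order so that `σ i` is the class of the vertex complex of the `i`-th vertex. The
orientation of the 2-cells is required to agree with the cyclic order: otherwise the classes of
the vertex complexes do not determine `Ω` even up to the orientations and colors of the edges
(inverting the orientation of a single triangle preserves these classes, but not the order of the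
factors in the trilinear form). -/
structure Compatible {n : ℕ} (Ω : BraneComplex (D + 1) S) (σ : Fin n → ColorClass D S) where
  connected : ConnectedOn (Set.univ : Set Ω.Cell)
  coherent : Ω.Coherent
  vert : Fin n ≃ Ω.Vertex
  cls : ∀ i, σ i = Ω.cls (vert i)
  next : ∀ i, Ω.next (vert i) = vert (finRotate n i)

/-- The set `Ω(σ₁, …, σₙ)` is nonempty. -/
def CompatibleExists {n : ℕ} (σ : Fin n → ColorClass D S) : Prop :=
  ∃ Ω : BraneComplex (D + 1) S, Nonempty (Compatible Ω σ)

/-- `τ` is the class of a cut of `Ω` that separates the vertices `A` from the others, oriented as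
the vertex complex of the point to which it is contracted on the side of `A`. -/
def IsCutClass (Ω : BraneComplex (D + 1) S) (A : Set Ω.Vertex) (τ : ColorClass D S) : Prop :=
  ∃ (Ω' : BraneComplex (D + 1) S) (η : CutMorphism Ω Ω'), η.A = A ∧ Ω'.cls η.plus = τ

variable (D S) in
/-- The classes of connected colored complexes with at most `|S|` vertices (all classes, if `S`
is infinite). These are the classes of vertex complexes of brane complexes, because the vertices
of a vertex complex are the traces of edges of different colors. -/
abbrev AdmissibleClass : Type (max 1 u) :=
  {σ : ColorClass D S // ∃ c : ConnectedColoredComplex D S,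
    Quotient.mk (coloredSetoid D S) c = σ ∧ Nonempty (c.1.Vertex ↪ S)}

/-- The involution on admissible classes. -/
def AdmissibleClass.star (σ : AdmissibleClass D S) : AdmissibleClass D S :=
  ⟨σ.1.star, by
    obtain ⟨c, hc, hS⟩ := σ.2
    exact ⟨⟨c.1.star, c.2⟩, by rw [← hc]; rfl, hS⟩⟩

open Classical in
/-- Colored Frobenius algebras on `B_⋆ = ⨁ B_σ`. In the last axiom `(bᵢ)` and `(b'ⱼ)` are bases of
`B_τ` and `B_{τ^*}` and `F` is inverse to the matrix `M = (bᵢ, b'ⱼ)` in the sense that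
`∑ j, F i j * M k j` is the identity matrix; similarly for `υ`. -/
structure ColoredFrobeniusAlgebra (𝕂 : Type v) [Field 𝕂] (B : AdmissibleClass D S → Type w)
    [∀ σ, AddCommGroup (B σ)] [∀ σ, Module 𝕂 (B σ)] where
  finite : ∀ σ, Module.Finite 𝕂 (B σ)
  pair : (⨁ σ, B σ) →ₗ[𝕂] (⨁ σ, B σ) →ₗ[𝕂] 𝕂
  triple : (⨁ σ, B σ) →ₗ[𝕂] (⨁ σ, B σ) →ₗ[𝕂] (⨁ σ, B σ) →ₗ[𝕂] 𝕂
  nondegenerate : pair.Nondegenerate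
  pair_eq_zero : ∀ σ τ : AdmissibleClass D S, σ ≠ τ.star → ∀ x y,
    pair (DirectSum.lof 𝕂 _ B σ x) (DirectSum.lof 𝕂 _ B τ y) = 0
  triple_eq_zero : ∀ σ : Fin 3 → AdmissibleClass D S,
    ¬ CompatibleExists (fun i => (σ i).1) → ∀ x : ∀ i, B (σ i),
      triple (DirectSum.lof 𝕂 _ B (σ 0) (x 0)) (DirectSum.lof 𝕂 _ B (σ 1) (x 1))
        (DirectSum.lof 𝕂 _ B (σ 2) (x 2)) = 0
  assoc : ∀ (σ : Fin 4 → AdmissibleClass D S) (Ω : BraneComplex (D + 1) S)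
    (e : Compatible Ω fun i => (σ i).1) (τ υ : AdmissibleClass D S),
    IsCutClass Ω {e.vert 0, e.vert 1} τ.1 → IsCutClass Ω {e.vert 3, e.vert 0} υ.1 →
    ∀ (x : ∀ i, B (σ i)) (m n : ℕ)
      (b : Module.Basis (Fin m) 𝕂 (B τ)) (b' : Module.Basis (Fin m) 𝕂 (B τ.star))
      (c : Module.Basis (Fin n) 𝕂 (B υ)) (c' : Module.Basis (Fin n) 𝕂 (B υ.star)),
      let X : Fin 4 → ⨁ σ, B σ := fun i => DirectSum.lof 𝕂 _ B (σ i) (x i)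
      let b₁ := fun i => DirectSum.lof 𝕂 _ B τ (b i)
      let b₂ := fun i => DirectSum.lof 𝕂 _ B τ.star (b' i)
      let c₁ := fun i => DirectSum.lof 𝕂 _ B υ (c i)
      let c₂ := fun i => DirectSum.lof 𝕂 _ B υ.star (c' i)
      let F : Matrix (Fin m) (Fin m) 𝕂 := (Matrix.of fun i j => pair (b₁ i) (b₂ j)).transpose⁻¹
      let E : Matrix (Fin n) (Fin n) 𝕂 := (Matrix.of fun i j => pair (c₁ i) (c₂ j)).transpose⁻¹
      ∑ i, ∑ j, triple (X 0) (X 1) (b₁ i) * F i j * triple (b₂ j) (X 2) (X 3) =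
        ∑ i, ∑ j, triple (X 3) (X 0) (c₁ i) * E i j * triple (c₂ j) (X 1) (X 2)

/-- The element of `V_Ω` given by vectors `x i ∈ B (σ i)` placed at the numbered vertices. -/
def Compatible.place {𝕂 : Type v} [Field 𝕂] {B : ColorClass D S → Type w}
    [∀ σ, AddCommGroup (B σ)] [∀ σ, Module 𝕂 (B σ)] {n : ℕ} {Ω : BraneComplex (D + 1) S}
    {σ : Fin n → ColorClass D S} (e : Compatible Ω σ) (x : ∀ i, B (σ i)) : VSpace 𝕂 B Ω :=
  PiTensorProduct.tprod 𝕂 fun q =>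
    transport (𝕂 := 𝕂) (show σ (e.vert.symm q) = Ω.cls q by simp [e.cls]) (x (e.vert.symm q))

open Classical in
/-- The forms of the algebra are the values of the theory `Φ` on the complexes with two and three
vertices. -/
structure ColoredFrobeniusAlgebra.IsGeneratedBy {𝕂 : Type v} [Field 𝕂]
    {B : ColorClass D S → Type w} [∀ σ, AddCommGroup (B σ)] [∀ σ, Module 𝕂 (B σ)]
    (C : ColoredFrobeniusAlgebra 𝕂 (fun σ : AdmissibleClass D S => B σ.1))
    (Φ : ∀ Ω : BraneComplex (D + 1) S, VSpace 𝕂 B Ω →ₗ[𝕂] 𝕂) : Prop where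
  pair : ∀ (σ : Fin 2 → AdmissibleClass D S) (Ω : BraneComplex (D + 1) S)
    (e : Compatible Ω fun i => (σ i).1) (x : ∀ i, B (σ i).1),
    C.pair (DirectSum.lof 𝕂 _ (fun σ : AdmissibleClass D S => B σ.1) (σ 0) (x 0))
      (DirectSum.lof 𝕂 _ (fun σ : AdmissibleClass D S => B σ.1) (σ 1) (x 1)) = Φ Ω (e.place x)
  triple : ∀ (σ : Fin 3 → AdmissibleClass D S) (Ω : BraneComplex (D + 1) S)
    (e : Compatible Ω fun i => (σ i).1) (x : ∀ i, B (σ i).1),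
    C.triple (DirectSum.lof 𝕂 _ (fun σ : AdmissibleClass D S => B σ.1) (σ 0) (x 0))
      (DirectSum.lof 𝕂 _ (fun σ : AdmissibleClass D S => B σ.1) (σ 1) (x 1))
      (DirectSum.lof 𝕂 _ (fun σ : AdmissibleClass D S => B σ.1) (σ 2) (x 2)) = Φ Ω (e.place x)

end Algebra

/-! ### `G`-coverings and Hurwitz numbers -/

section Hurwitz

variable {G : Type w} [Group G] {S : Type u}

/-- A `G`-covering of a simple complex `c`: an action of `G` by automorphisms on a simple complex
`total`, such that the fixed points of every `g` form a union of closed cells, with a projection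
that induces an isomorphism of the quotient with `c`. -/
structure GCovering (G : Type w) [Group G] {d : ℕ} (c : SimpleComplex d) where
  total : SimpleComplex d
  [act : MulAction G total.Cell]
  smul_le_smul : ∀ (g : G) (x y : total.Cell), x ≤ y → g • x ≤ g • y
  dim_smul : ∀ (g : G) (x : total.Cell), total.dim (g • x) = total.dim x
  smul_eq_of_le : ∀ (g : G) (x y : total.Cell), g • x = x → y ≤ x → g • y = y
  proj : total.Cell → c.Cell
  dim_proj : ∀ x, c.dim (proj x) = total.dim x
  proj_surjective : Function.Surjective proj
  /-- The fibers are the orbits. -/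
  proj_eq_iff : ∀ x y, proj x = proj y ↔ ∃ g : G, g • x = y
  /-- Every closed cell is mapped bijectively onto a closed cell. -/
  bijOn : ∀ x, Set.BijOn proj (Set.Iic x) (Set.Iic (proj x))

attribute [instance] GCovering.act

namespace GCovering

/-- An equivariant isomorphism of the total complexes of two `G`-coverings over an isomorphism
of the bases. -/
structure IsoOver {d : ℕ} {c c' : SimpleComplex d} (φ : c.Cell ≃o c'.Cell) (f : GCovering G c)
    (f' : GCovering G c') where
  cell : f.total.Cell ≃o f'.total.Cell
  equivariant : ∀ (g : G) x, cell (g • x) = g • cell x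
  proj : ∀ x, f'.proj (cell x) = φ (f.proj x)

variable {d : ℕ}

def IsoOver.refl {c : SimpleComplex d} (f : GCovering G c) : IsoOver (OrderIso.refl _) f f where
  cell := OrderIso.refl _
  equivariant _ _ := rfl
  proj _ := rfl

def IsoOver.symm {c c' : SimpleComplex d} {φ : c.Cell ≃o c'.Cell} {f : GCovering G c}
    {f' : GCovering G c'} (ψ : IsoOver φ f f') : IsoOver φ.symm f' f where
  cell := ψ.cell.symm
  equivariant g x := by
    apply ψ.cell.injective
    rw [ψ.equivariant]
    simp
  proj x := by
    apply φ.injective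
    rw [← ψ.proj]
    simp

def IsoOver.trans {c c' c'' : SimpleComplex d} {φ : c.Cell ≃o c'.Cell} {φ' : c'.Cell ≃o c''.Cell}
    {f : GCovering G c} {f' : GCovering G c'} {f'' : GCovering G c''} (ψ : IsoOver φ f f')
    (ψ' : IsoOver φ' f' f'') : IsoOver (φ.trans φ') f f'' where
  cell := ψ.cell.trans ψ'.cell
  equivariant g x := by simp [ψ.equivariant, ψ'.equivariant]
  proj x := by simp [ψ.proj, ψ'.proj]

/-- Isomorphisms of `G`-coverings of the same complex. -/
abbrev Iso {c : SimpleComplex d} (f f' : GCovering G c) : Type :=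
  IsoOver (OrderIso.refl c.Cell) f f'

/-- The number of automorphisms of a `G`-covering. -/
def autCard {c : SimpleComplex d} (f : GCovering G c) : ℕ := Nat.card (Iso f f)

instance isoSetoid (G : Type w) [Group G] (c : SimpleComplex d) : Setoid (GCovering G c) where
  r f f' := Nonempty (Iso f f')
  iseqv :=
    { refl := fun f => ⟨IsoOver.refl f⟩
      symm := fun ⟨φ⟩ => ⟨φ.symm⟩
      trans := fun ⟨φ⟩ ⟨ψ⟩ => ⟨φ.trans ψ⟩ }

/-- Isomorphism classes of `G`-coverings of `c`. -/
def IsoClass (G : Type w) [Group G] (c : SimpleComplex d) : Type (max 1 w) :=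
  Quotient (isoSetoid G c)

theorem proj_mono {c : SimpleComplex d} (f : GCovering G c) {x y : f.total.Cell} (h : x ≤ y) :
    f.proj x ≤ f.proj y :=
  (f.bijOn y).mapsTo h

theorem proj_smul {c : SimpleComplex d} (f : GCovering G c) (g : G) (x : f.total.Cell) :
    f.proj (g • x) = f.proj x :=
  ((f.proj_eq_iff x (g • x)).2 ⟨g, rfl⟩).symm

/-- Order isomorphism of the cells below a cell with the cells below its projection, inside the
preimage of the link of `q` and inside the link of `q`. -/
def linkIso {c : SimpleComplex d} (f : GCovering G c) (q : c.Cell)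
    (x : {x : f.total.Cell // q < f.proj x}) :
    (Set.Iio (⟨f.proj x.1, x.2⟩ : {x : c.Cell // q < x})) ≃o
      (Set.Iio x : Set {x : f.total.Cell // q < f.proj x}) := by
  have hlt : ∀ y, y < x.1 → f.proj y < f.proj x.1 := fun y hy =>
    lt_of_le_of_ne (f.proj_mono hy.le) fun h => hy.ne ((f.bijOn x.1).injOn hy.le le_rfl h)
  let F : ↥(Set.Iio x : Set {x : f.total.Cell // q < f.proj x}) →
      Set.Iio (⟨f.proj x.1, x.2⟩ : {x : c.Cell // q < x}) :=
    fun y => ⟨⟨f.proj y.1.1, y.1.2⟩, hlt y.1.1 y.2⟩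
  have hF : Function.Bijective F := by
    constructor
    · intro y z h
      have h' : f.proj y.1.1 = f.proj z.1.1 := congrArg (fun t => t.1.1) h
      exact Subtype.ext (Subtype.ext ((f.bijOn x.1).injOn (le_of_lt y.2) (le_of_lt z.2) h'))
    · rintro ⟨⟨z, hz⟩, hzx⟩
      have hzx' : z < f.proj x.1 := hzx
      obtain ⟨y, hy, rfl⟩ := (f.bijOn x.1).surjOn hzx'.le
      refine ⟨⟨⟨y, hz⟩, lt_of_le_of_ne hy fun h => hzx'.ne ?_⟩, rfl⟩
      exact congrArg f.proj h
  refine OrderIso.symm ⟨Equiv.ofBijective F hF, ?_⟩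
  intro y z
  constructor
  · intro h
    have h' : f.proj y.1.1 ≤ f.proj z.1.1 := h
    obtain ⟨t, ht, hty⟩ := (f.bijOn z.1.1).surjOn h'
    have hz : z.1.1 ≤ x.1 := le_of_lt z.2
    have : t = y.1.1 :=
      (f.bijOn x.1).injOn (le_trans (show t ≤ z.1.1 from ht) hz) (le_of_lt y.2) hty
    subst this
    exact ht
  · intro h
    exact f.proj_mono (show y.1.1 ≤ z.1.1 from h)

variable {D : ℕ}

/-- The covering of the vertex complex of `q` generated by a covering of a brane complex: the
preimage of the vertex complex. -/
def restrict {Ω : BraneComplex (D + 1) S} (f : GCovering G Ω.toSimpleComplex) (q : Ω.Vertex) :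
    GCovering G (Ω.vertexComplex q).toSimpleComplex where
  total :=
    { Cell := {x : f.total.Cell // q.1 < f.proj x}
      fintypeCell := @Subtype.fintype _ _ (Classical.decPred _) _
      dim := fun x => f.total.dim x.1 - 1
      dim_lt := fun {x y} h => by
        have h1 := f.total.dim_lt (show x.1 < y.1 from h)
        have h2 := Ω.dim_lt x.2
        rw [f.dim_proj] at h2
        omega
      sphere := fun x => by
        have h := (Ω.vertexComplex q).sphere ⟨f.proj x.1, x.2⟩
        rw [← f.dim_proj]
        exact @IsSphere.congr _ _ _ _ (_) _ _ _ _ h (f.linkIso q.1 x)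
      pure := fun x => by
        obtain ⟨y, hxy, hy⟩ := f.total.pure x.1
        exact ⟨⟨y, x.2.trans_le (f.proj_mono hxy)⟩, hxy, by simp [hy]⟩ }
  act :=
    { smul := fun g x => ⟨g • x.1, by rw [f.proj_smul]; exact x.2⟩
      one_smul := fun x => Subtype.ext (one_smul G x.1)
      mul_smul := fun g h x => Subtype.ext (mul_smul g h x.1) }
  smul_le_smul g x y h := f.smul_le_smul g x.1 y.1 h
  dim_smul g x := congrArg (· - 1) (f.dim_smul g x.1)
  smul_eq_of_le g x y h hyx :=
    Subtype.ext (f.smul_eq_of_le g x.1 y.1 (congrArg Subtype.val h) hyx)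
  proj x := ⟨f.proj x.1, x.2⟩
  dim_proj x := congrArg (· - 1) (f.dim_proj x.1)
  proj_surjective y := by
    obtain ⟨x, hx⟩ := f.proj_surjective y.1
    exact ⟨⟨x, by rw [hx]; exact y.2⟩, Subtype.ext hx⟩
  proj_eq_iff x y := by
    refine (Iff.trans ⟨fun h => congrArg Subtype.val h, fun h => Subtype.ext h⟩
      (f.proj_eq_iff x.1 y.1)).trans (exists_congr fun g => ?_)
    exact ⟨fun h => Subtype.ext h, fun h => congrArg Subtype.val h⟩
  bijOn x := by
    refine ⟨fun y hy => f.proj_mono (show y.1 ≤ x.1 from hy), fun y hy z hz h => ?_,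
      fun z hz => ?_⟩
    · exact Subtype.ext ((f.bijOn x.1).injOn hy hz (congrArg Subtype.val h))
    · obtain ⟨y, hy, hyz⟩ := (f.bijOn x.1).surjOn (show z.1 ≤ f.proj x.1 from hz)
      exact ⟨⟨y, by rw [hyz]; exact z.2⟩, hy, Subtype.ext hyz⟩

end GCovering

variable {D : ℕ}

/-- `G`-coverings of connected colored complexes up to equivalence. -/
instance coveringSetoid (G : Type w) [Group G] (D : ℕ) (S : Type u) :
    Setoid (Σ c : ConnectedColoredComplex D S, GCovering G c.1.toSimpleComplex) where
  r f f' := ∃ φ : ColoredComplex.Iso f.1.1 f'.1.1, Nonempty (GCovering.IsoOver φ.cell f.2 f'.2)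
  iseqv :=
    { refl := fun f => ⟨ColoredComplex.Iso.refl _, ⟨GCovering.IsoOver.refl f.2⟩⟩
      symm := fun ⟨φ, ⟨ψ⟩⟩ => ⟨φ.symm, ⟨ψ.symm⟩⟩
      trans := fun ⟨φ, ⟨ψ⟩⟩ ⟨φ', ⟨ψ'⟩⟩ => ⟨φ.trans φ', ⟨ψ.trans ψ'⟩⟩ }

/-- Equivalence classes of `G`-coverings of connected colored complexes of dimension `D`. -/
def CoveringClass (G : Type w) [Group G] (D : ℕ) (S : Type u) : Type (max 1 u w) :=
  Quotient (coveringSetoid G D S)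

/-- The class of the base of a covering. -/
def CoveringClass.base : CoveringClass G D S → ColorClass D S :=
  Quotient.map' (fun f => f.1) fun _ _ ⟨φ, _⟩ => ⟨φ⟩

/-- The set `Υ_σ^G` of equivalence classes of `G`-coverings over complexes of class `σ`. -/
abbrev Upsilon (G : Type w) [Group G] (σ : ColorClass D S) : Type (max 1 u w) :=
  {β : CoveringClass G D S // β.base = σ}

/-- The local invariant at the vertex `q` of a `G`-covering of a brane complex. -/
def GCovering.localInvariant {Ω : BraneComplex (D + 1) S} (f : GCovering G Ω.toSimpleComplex)
    (q : Ω.Vertex) : Upsilon G (Ω.cls q) :=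
  ⟨Quotient.mk (coveringSetoid G D S)
    ⟨⟨Ω.vertexComplex q, Ω.vertexComplex_connected q⟩, f.restrict q⟩, rfl⟩

/-- The Hurwitz number `H^G(Ω, {β_q})`: the sum of `1 / |Aut f|` over the isomorphism classes of
`G`-coverings `f` of `Ω` with local invariants `β_q`. -/
def hurwitzNumber (𝕂 : Type v) [Field 𝕂] (Ω : BraneComplex (D + 1) S)
    (β : ∀ q, Upsilon G (Ω.cls q)) : 𝕂 :=
  ∑ᶠ F ∈ {F : GCovering.IsoClass G Ω.toSimpleComplex |
    ∀ q, GCovering.localInvariant (Quotient.out F) q = β q},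
    1 / ((GCovering.autCard (Quotient.out F) : ℕ) : 𝕂)

/-- The vector space `C_σ^G` with basis `Υ_σ^G`. -/
abbrev hurwitzSpace (𝕂 : Type v) [Field 𝕂] (G : Type w) [Group G] (σ : ColorClass D S) :
    Type (max 1 u v w) :=
  Upsilon G σ →₀ 𝕂

/-- The linear forms `H^G` on `V_Ω`, whose values on the basis are the Hurwitz numbers. -/
def hurwitzForm (𝕂 : Type v) [Field 𝕂] (G : Type w) [Group G] (Ω : BraneComplex (D + 1) S) :
    VSpace 𝕂 (hurwitzSpace 𝕂 G) Ω →ₗ[𝕂] 𝕂 :=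
  (Basis.piTensorProduct fun q : Ω.Vertex =>
    (Finsupp.basisSingleOne : Module.Basis (Upsilon G (Ω.cls q)) 𝕂 _)).constr 𝕂
      (hurwitzNumber 𝕂 Ω)

end Hurwitz

end Brane

end

/-!
# Hurwitz numbers of brane complexes

A `G`-covering together with a base point in every fiber is determined up to unique isomorphism by
the sets `{g | g • b x ≤ b y}`; such data are called frames (`Brane.Frame`), and `P → G` acts on
them by changes of base points ("gauge transformations"). If a frame has the inverse of the number
of choices of base points as its weight, then `1 / |Aut f|` is the sum of the weights of the frames
of `f` (`Brane.GCovering.one_div_autCard`). So the Hurwitz form is a weighted sum over frames,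
`BraneComplex.partition`, and these sums are local: if the cells are the union of two upper sets,
a frame is a pair of frames that agree on the intersection, and the sum is an integral over the
frames on the intersection (`IsAmalgam.integral_eq`). This gives multiplicativity for disjoint
unions. It also evaluates a complex with two vertices, which is the union of two cones over the
vertex complex (`partition_two_vertices`), and it splits a complex along a cut.

Contracting a copy of a cut to a point glues in a cone over it, and this multiplies the
contribution of a side by the weighted number `coneNumber` of extensions of the covering to the
cone. The decisive fact is rigidity (`ColoredComplex.Iso.rigid`): a connected colored complex has
no nontrivial automorphisms, since cells of positive dimension are distinguished by their colors
and the two ends of an edge by its orientation. Hence two frames on such a complex that give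
equivalent coverings differ by a gauge transformation (`exists_smul_of_covClass_eq`), and gauge
invariant functions are constant on the frames of a class. This turns the integral over a cut into
a sum over classes `γ` with coefficients `1 / classNorm γ` (`CutCells.partition_eq_sum`), where
`classNorm γ`, the value of a two-vertex complex at `γ ⊗ γ*`, is a nonzero number, namely a positive
rational. So the forms of complexes with two vertices are diagonal and nondegenerate, and
`K = ∑ γ ⊗ γ* / classNorm γ` is the tensor of the cut axiom.

For the algebra, the form of a coherent connected complex with three vertices has to depend on the
vertex complexes only. Isomorphisms of the three pairs of vertex complexes agree on common cells,
for cells of dimension at least two by their colors and for edges by comparing the signs of flags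
with the coherent orientations, so that they glue to an isomorphism of the posets of cells
(`agree_of_compatible`, `partition_three_vertices`). A cut of a complex with four vertices into two
pairs of neighbors gives two coherent components with three vertices (`CutSide.compatible`), so that
the cut formula expresses the four-vertex form by two trilinear forms (`partition_four_vertices`).
Both sides of the associativity equation are this form, computed with the given numbering of the
vertices and with a rotated one; that the bases may be arbitrary is `sum_inverse_matrix`.
-/

noncomputable section

namespace Brane

universe u v w

/-! ### Frames on finite posets -/

/-- A frame on a poset `P` is a `G`-covering of `P` with a chosen base point `b x` in every fiber,
up to unique isomorphism; it is recorded by the sets `arr x y = {g | g • b x ≤ b y}`. Thus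
`arr x x` is the stabilizer of `b x`, and `inv_mul_mem` says that a cell of the covering has at
most one face over each face of its projection. -/
@[ext]
structure Frame (G : Type w) [Group G] (P : Type*) [PartialOrder P] where
  arr : P → P → Set G
  one_mem : ∀ x, 1 ∈ arr x x
  mul_mem : ∀ {x y z : P} {g h : G}, g ∈ arr x y → h ∈ arr y z → h * g ∈ arr x z
  inv_mul_mem : ∀ {x y : P} {g h : G}, g ∈ arr x y → h ∈ arr x y → g⁻¹ * h ∈ arr x x
  nonempty_iff : ∀ x y, (arr x y).Nonempty ↔ x ≤ y

namespace Frame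

variable {G : Type w} [Group G] {P Q T : Type*} [PartialOrder P] [PartialOrder Q] [PartialOrder T]

theorem le_of_mem (R : Frame G P) {x y : P} {g : G} (h : g ∈ R.arr x y) : x ≤ y :=
  (R.nonempty_iff x y).1 ⟨g, h⟩

theorem arr_injective : Function.Injective (Frame.arr : Frame G P → P → P → Set G) :=
  fun _ _ h => Frame.ext h

instance [Finite G] [Finite P] : Finite (Frame G P) :=
  Finite.of_injective _ arr_injective

instance [Finite G] [Finite P] : Fintype (Frame G P) := Fintype.ofFinite _

/-- Restriction of a frame along an order embedding. -/
def res (j : Q ↪o P) (R : Frame G P) : Frame G Q where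
  arr x y := R.arr (j x) (j y)
  one_mem _ := R.one_mem _
  mul_mem := R.mul_mem
  inv_mul_mem := R.inv_mul_mem
  nonempty_iff _ _ := (R.nonempty_iff _ _).trans j.le_iff_le

theorem res_res (j : Q ↪o P) (i : T ↪o Q) (R : Frame G P) :
    (R.res j).res i = R.res (i.trans j) := rfl

theorem res_congr {j j' : Q ↪o P} (h : ∀ x, j x = j' x) (R : Frame G P) :
    R.res j = R.res j' := by
  rw [show j = j' from RelEmbedding.ext h]

/-- Change of the base points `b x` of a frame to `t x • b x`, up to inversion of `t`. -/
instance : MulAction (P → G) (Frame G P) where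
  smul t R :=
    { arr := fun x y => {g | (t y)⁻¹ * g * t x ∈ R.arr x y}
      one_mem := fun x => by simpa using R.one_mem x
      mul_mem := fun hg hh => by
        have := R.mul_mem hg hh
        simpa [mul_assoc] using this
      inv_mul_mem := fun hg hh => by
        have := R.inv_mul_mem hg hh
        simpa [mul_assoc] using this
      nonempty_iff := fun x y => by
        rw [← R.nonempty_iff]
        constructor
        · rintro ⟨g, hg⟩
          exact ⟨_, hg⟩
        · rintro ⟨g, hg⟩
          exact ⟨t y * g * (t x)⁻¹, by simpa [mul_assoc] using hg⟩ }
  one_smul R := Frame.ext (by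
    funext x y
    change {g | ((1 : G))⁻¹ * g * (1 : G) ∈ R.arr x y} = _
    simp)
  mul_smul s t R := Frame.ext (by
    funext x y
    ext g
    change (s y * t y)⁻¹ * g * (s x * t x) ∈ R.arr x y ↔
      (t y)⁻¹ * ((s y)⁻¹ * g * s x) * t x ∈ R.arr x y
    simp [mul_assoc])

theorem mem_smul {t : P → G} {R : Frame G P} {x y : P} {g : G} :
    g ∈ (t • R).arr x y ↔ (t y)⁻¹ * g * t x ∈ R.arr x y := Iff.rfl

theorem res_smul (j : Q ↪o P) (t : P → G) (R : Frame G P) :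
    (t • R).res j = (t ∘ j) • R.res j := rfl

section Weight

variable (𝕂 : Type v) [Field 𝕂]

/-- The weight of a frame: the inverse of the product of the cardinalities of the fibers of the
covering. -/
def weight [Finite P] (R : Frame G P) : 𝕂 :=
  letI := Fintype.ofFinite P
  ∏ x, ((Nat.card (R.arr x x) : 𝕂) / Nat.card G)

theorem weight_eq [Fintype P] (R : Frame G P) :
    R.weight 𝕂 = ∏ x, ((Nat.card (R.arr x x) : 𝕂) / Nat.card G) := by
  unfold weight
  congr!

theorem weight_smul [Finite P] (t : P → G) (R : Frame G P) : (t • R).weight 𝕂 = R.weight 𝕂 := by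
  unfold weight
  refine Finset.prod_congr rfl fun x _ => ?_
  congr 2
  refine Nat.card_congr ((MulAut.conj (t x)⁻¹).toEquiv.subtypeEquiv fun g => ?_)
  simp [mem_smul]

theorem weight_res_iso [Finite P] [Finite Q] (φ : Q ≃o P) (R : Frame G P) :
    (R.res φ.toOrderEmbedding).weight 𝕂 = R.weight 𝕂 := by
  have := Fintype.ofFinite P
  have := Fintype.ofFinite Q
  rw [weight_eq, weight_eq]
  exact Fintype.prod_equiv φ.toEquiv _ _ fun x => rfl

theorem weight_of_isEmpty [Finite P] [IsEmpty P] (R : Frame G P) : R.weight 𝕂 = 1 := by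
  have := Fintype.ofFinite P
  rw [weight_eq]
  exact Fintype.prod_empty _

/-- Up to a nonzero constant, the weight is a positive integer. -/
theorem exists_weight_eq [Finite P] [Finite G] (R : Frame G P) :
    ∃ n : ℕ, 0 < n ∧ R.weight 𝕂 = n / (Nat.card G : 𝕂) ^ Nat.card P := by
  have := Fintype.ofFinite P
  refine ⟨∏ x, Nat.card (R.arr x x), Finset.prod_pos fun x _ => ?_, ?_⟩
  · have : Nonempty (R.arr x x) := ⟨⟨1, R.one_mem x⟩⟩
    exact Nat.card_pos
  · rw [weight_eq, Finset.prod_div_distrib]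
    simp

theorem weight_ne_zero [CharZero 𝕂] [Finite P] [Finite G] (R : Frame G P) : R.weight 𝕂 ≠ 0 := by
  obtain ⟨n, hn, h⟩ := R.exists_weight_eq 𝕂
  rw [h]
  have : (Nat.card G : 𝕂) ≠ 0 := Nat.cast_ne_zero.2 Nat.card_pos.ne'
  exact div_ne_zero (Nat.cast_ne_zero.2 hn.ne') (pow_ne_zero _ this)

end Weight

end Frame

/-! ### Integration over frames -/

section Integral

variable {𝕂 : Type v} [Field 𝕂] {G : Type w} [Group G] [Finite G]
variable {P Q U V I : Type*} [PartialOrder P] [PartialOrder Q] [PartialOrder U] [PartialOrder V]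
  [PartialOrder I] [Finite P] [Finite Q] [Finite U] [Finite V] [Finite I]

/-- The weighted sum of a function over all frames. -/
def integral (a : Frame G P → 𝕂) : 𝕂 := ∑ R, R.weight 𝕂 * a R

/-- A function of frames is gauge invariant if it does not depend on the base points. -/
def GaugeInvariant {α : Type*} (a : Frame G P → α) : Prop :=
  ∀ (t : P → G) (R : Frame G P), a (t • R) = a R

omit [Finite G] [Finite P] in
theorem GaugeInvariant.prod {ι : Type*} {s : Finset ι} {a : ι → Frame G P → 𝕂}
    (ha : ∀ i ∈ s, GaugeInvariant (a i)) : GaugeInvariant fun R => ∏ i ∈ s, a i R :=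
  fun t R => Finset.prod_congr rfl fun i hi => ha i hi t R

/-- Restriction along an order isomorphism, as an equivalence. -/
def Frame.resEquiv (φ : Q ≃o P) : Frame G P ≃ Frame G Q where
  toFun R := R.res φ.toOrderEmbedding
  invFun R := R.res φ.symm.toOrderEmbedding
  left_inv R := (R.res_res _ _).trans (R.res_congr (j' := RelEmbedding.refl _) (by simp))
  right_inv R := (R.res_res _ _).trans (R.res_congr (j' := RelEmbedding.refl _) (by simp))

theorem integral_res_iso (φ : Q ≃o P) (a : Frame G Q → 𝕂) :
    integral (fun R : Frame G P => a (R.res φ.toOrderEmbedding)) = integral a := by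
  refine Fintype.sum_equiv (Frame.resEquiv φ) _ _ fun R => ?_
  rw [← R.weight_res_iso 𝕂 φ]
  rfl

open Classical in
/-- The integral of `a` over the frames with given restriction along `i`. -/
def push (i : I ↪o U) (a : Frame G U → 𝕂) (ψ : Frame G I) : 𝕂 :=
  ∑ R, if R.res i = ψ then R.weight 𝕂 / ψ.weight 𝕂 * a R else 0

theorem GaugeInvariant.push (i : I ↪o U) {a : Frame G U → 𝕂} (ha : GaugeInvariant a) :
    GaugeInvariant (push i a) := by
  classical
  intro t ψ
  -- the change of base points over `I` is extended to `U` by the identity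
  let s : U → G := fun u => if h : ∃ x, i x = u then t h.choose else 1
  have hs : s ∘ i = t := by
    funext x
    have h : ∃ y, i y = i x := ⟨x, rfl⟩
    have : h.choose = x := i.injective h.choose_spec
    simp only [s, Function.comp_apply, dif_pos h, this]
  unfold Brane.push
  symm
  refine Fintype.sum_equiv (MulAction.toPerm s) _ _ fun R => ?_
  simp only [MulAction.toPerm_apply, Frame.res_smul, hs, Frame.weight_smul, ha s R]
  simp only [smul_left_cancel_iff]

theorem push_mul_res (i : I ↪o U) (a : Frame G U → 𝕂) (c : Frame G I → 𝕂) (ψ : Frame G I) :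
    push i (fun R => a R * c (R.res i)) ψ = push i a ψ * c ψ := by
  unfold push
  rw [Finset.sum_mul]
  refine Finset.sum_congr rfl fun R _ => ?_
  split_ifs with h
  · simp only [h, mul_assoc]
  · simp

/-- The poset `P` is the union of two upper sets `U` and `V` with intersection `I`. Comparable
elements then lie together in `U` or in `V`, so that a covering of `P` is a pair of coverings of
`U` and `V` that agree on `I`. -/
structure IsAmalgam (jU : U ↪o P) (jV : V ↪o P) (iU : I ↪o U) (iV : I ↪o V) : Prop where
  comm : ∀ x, jU (iU x) = jV (iV x)
  cover : ∀ x, (∃ u, jU u = x) ∨ ∃ v, jV v = x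
  pull : ∀ u v, jU u = jV v → ∃ x, iU x = u ∧ iV x = v
  upperU : ∀ u x, jU u ≤ x → ∃ u', jU u' = x
  upperV : ∀ v x, jV v ≤ x → ∃ v', jV v' = x

namespace IsAmalgam

variable {jU : U ↪o P} {jV : V ↪o P} {iU : I ↪o U} {iV : I ↪o V}

omit [Finite P] [Finite U] [Finite V] [Finite I] in
theorem symm (h : IsAmalgam jU jV iU iV) : IsAmalgam jV jU iV iU where
  comm x := (h.comm x).symm
  cover x := (h.cover x).symm
  pull u v huv := by
    obtain ⟨x, h1, h2⟩ := h.pull v u huv.symm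
    exact ⟨x, h2, h1⟩
  upperU := h.upperV
  upperV := h.upperU

/-- The arrows of the frame on `P` glued from frames on `U` and `V`. -/
def arr (jU : U ↪o P) (jV : V ↪o P) (RU : Frame G U) (RV : Frame G V) (x y : P) : Set G :=
  {g | (∃ u u', jU u = x ∧ jU u' = y ∧ g ∈ RU.arr u u') ∨
    ∃ v v', jV v = x ∧ jV v' = y ∧ g ∈ RV.arr v v'}

omit [Finite G] [Finite P] [Finite U] [Finite V] in
theorem arr_swap (RU : Frame G U) (RV : Frame G V) (x y : P) :
    arr jU jV RU RV x y = arr jV jU RV RU x y := by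
  ext g
  exact or_comm

omit [Finite G] [Finite P] [Finite U] [Finite V] [Finite I] in
theorem arr_left (h : IsAmalgam jU jV iU iV) {RU : Frame G U} {RV : Frame G V}
    (hR : RU.res iU = RV.res iV) (u u' : U) :
    arr jU jV RU RV (jU u) (jU u') = RU.arr u u' := by
  ext g
  constructor
  · rintro (⟨a, b, ha, hb, hg⟩ | ⟨a, b, ha, hb, hg⟩)
    · rwa [jU.injective ha, jU.injective hb] at hg
    · obtain ⟨x, rfl, rfl⟩ := h.pull _ _ ha.symm
      obtain ⟨y, rfl, rfl⟩ := h.pull _ _ hb.symm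
      change g ∈ (RU.res iU).arr x y
      rw [hR]
      exact hg
  · intro hg
    exact Or.inl ⟨u, u', rfl, rfl, hg⟩

omit [Finite G] [Finite P] [Finite U] [Finite V] [Finite I] in
theorem arr_right (h : IsAmalgam jU jV iU iV) {RU : Frame G U} {RV : Frame G V}
    (hR : RU.res iU = RV.res iV) (v v' : V) :
    arr jU jV RU RV (jV v) (jV v') = RV.arr v v' := by
  rw [arr_swap, h.symm.arr_left hR.symm]

omit [Finite G] [Finite P] [Finite U] [Finite V] [Finite I] in
theorem le_of_mem_arr {RU : Frame G U} {RV : Frame G V} {x y : P} {g : G}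
    (hg : g ∈ arr jU jV RU RV x y) : x ≤ y := by
  rcases hg with ⟨u, u', rfl, rfl, hg⟩ | ⟨u, u', rfl, rfl, hg⟩
  · exact jU.monotone (RU.le_of_mem hg)
  · exact jV.monotone (RV.le_of_mem hg)

/-- Gluing of frames. -/
def glue (h : IsAmalgam jU jV iU iV) (RU : Frame G U) (RV : Frame G V)
    (hR : RU.res iU = RV.res iV) : Frame G P where
  arr := arr jU jV RU RV
  one_mem x := by
    rcases h.cover x with ⟨u, rfl⟩ | ⟨v, rfl⟩
    · exact Or.inl ⟨u, u, rfl, rfl, RU.one_mem u⟩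
    · exact Or.inr ⟨v, v, rfl, rfl, RV.one_mem v⟩
  mul_mem {x y z g k} hg hk := by
    have hxy := le_of_mem_arr hg
    have hyz := le_of_mem_arr hk
    rcases h.cover x with ⟨u, rfl⟩ | ⟨u, rfl⟩
    · obtain ⟨u', rfl⟩ := h.upperU _ _ hxy
      obtain ⟨u'', rfl⟩ := h.upperU _ _ hyz
      rw [h.arr_left hR] at hg hk ⊢
      exact RU.mul_mem hg hk
    · obtain ⟨u', rfl⟩ := h.upperV _ _ hxy
      obtain ⟨u'', rfl⟩ := h.upperV _ _ hyz
      rw [h.arr_right hR] at hg hk ⊢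
      exact RV.mul_mem hg hk
  inv_mul_mem {x y g k} hg hk := by
    have hxy := le_of_mem_arr hg
    rcases h.cover x with ⟨u, rfl⟩ | ⟨u, rfl⟩
    · obtain ⟨u', rfl⟩ := h.upperU _ _ hxy
      rw [h.arr_left hR] at hg hk ⊢
      exact RU.inv_mul_mem hg hk
    · obtain ⟨u', rfl⟩ := h.upperV _ _ hxy
      rw [h.arr_right hR] at hg hk ⊢
      exact RV.inv_mul_mem hg hk
  nonempty_iff x y := by
    refine ⟨fun ⟨g, hg⟩ => le_of_mem_arr hg, fun hxy => ?_⟩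
    rcases h.cover x with ⟨u, rfl⟩ | ⟨u, rfl⟩
    · obtain ⟨u', rfl⟩ := h.upperU _ _ hxy
      rw [h.arr_left hR, RU.nonempty_iff]
      exact jU.le_iff_le.1 hxy
    · obtain ⟨u', rfl⟩ := h.upperV _ _ hxy
      rw [h.arr_right hR, RV.nonempty_iff]
      exact jV.le_iff_le.1 hxy

omit [Finite G] [Finite P] [Finite U] [Finite V] [Finite I] in
theorem res_inj (h : IsAmalgam jU jV iU iV) {R R' : Frame G P} (hU : R.res jU = R'.res jU)
    (hV : R.res jV = R'.res jV) : R = R' := by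
  have key : ∀ {R R' : Frame G P}, R.res jU = R'.res jU → R.res jV = R'.res jV →
      ∀ x y g, g ∈ R.arr x y → g ∈ R'.arr x y := by
    intro R R' hU hV x y g hg
    have hxy := R.le_of_mem hg
    rcases h.cover x with ⟨u, rfl⟩ | ⟨u, rfl⟩
    · obtain ⟨u', rfl⟩ := h.upperU _ _ hxy
      change g ∈ (R'.res jU).arr u u'
      rw [← hU]
      exact hg
    · obtain ⟨u', rfl⟩ := h.upperV _ _ hxy
      change g ∈ (R'.res jV).arr u u'
      rw [← hV]
      exact hg
  refine Frame.ext (funext fun x => funext fun y => Set.ext fun g => ?_)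
  exact ⟨key hU hV x y g, key hU.symm hV.symm x y g⟩

/-- A frame on an amalgam is a pair of frames that agree on the intersection. -/
def frameEquiv (h : IsAmalgam jU jV iU iV) :
    Frame G P ≃ {p : Frame G U × Frame G V // p.1.res iU = p.2.res iV} where
  toFun R := ⟨(R.res jU, R.res jV), by
    rw [Frame.res_res, Frame.res_res]
    exact R.res_congr h.comm⟩
  invFun p := h.glue p.1.1 p.1.2 p.2
  left_inv R := by
    have hR : (R.res jU).res iU = (R.res jV).res iV :=
      R.res_congr (j := iU.trans jU) (j' := iV.trans jV) h.comm
    refine h.res_inj (Frame.ext ?_) (Frame.ext ?_)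
    · exact funext fun u => funext fun u' => h.arr_left hR u u'
    · exact funext fun u => funext fun u' => h.arr_right hR u u'
  right_inv p := by
    refine Subtype.ext (Prod.ext (Frame.ext ?_) (Frame.ext ?_))
    · exact funext fun u => funext fun u' => h.arr_left p.2 u u'
    · exact funext fun u => funext fun u' => h.arr_right p.2 u u'

omit [Finite G] in
theorem weight_mul (h : IsAmalgam jU jV iU iV) (R : Frame G P) :
    R.weight 𝕂 * ((R.res jU).res iU).weight 𝕂 = (R.res jU).weight 𝕂 * (R.res jV).weight 𝕂 := by
  classical
  have := Fintype.ofFinite P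
  have := Fintype.ofFinite U
  have := Fintype.ofFinite V
  have := Fintype.ofFinite I
  let f : P → 𝕂 := fun x => (Nat.card (R.arr x x) : 𝕂) / Nat.card G
  have h1 : R.weight 𝕂 = ∏ x ∈ Finset.univ.map jU.toEmbedding ∪ Finset.univ.map jV.toEmbedding,
      f x := by
    rw [Frame.weight_eq]
    refine Finset.prod_congr ?_ fun x _ => rfl
    symm
    refine Finset.eq_univ_iff_forall.2 fun x => ?_
    simpa using h.cover x
  have h2 : ((R.res jU).res iU).weight 𝕂 =
      ∏ x ∈ Finset.univ.map jU.toEmbedding ∩ Finset.univ.map jV.toEmbedding, f x := by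
    rw [Frame.weight_eq]
    have : Finset.univ.map jU.toEmbedding ∩ Finset.univ.map jV.toEmbedding =
        Finset.univ.map (iU.trans jU).toEmbedding := by
      ext x
      simp only [Finset.mem_inter, Finset.mem_map, Finset.mem_univ, true_and]
      constructor
      · rintro ⟨⟨u, rfl⟩, v, hv⟩
        obtain ⟨x, rfl, rfl⟩ := h.pull _ _ hv.symm
        exact ⟨x, rfl⟩
      · rintro ⟨i, rfl⟩
        exact ⟨⟨iU i, rfl⟩, iV i, (h.comm i).symm⟩
    rw [this, Finset.prod_map]
    rfl
  rw [h1, h2, Finset.prod_union_inter, Finset.prod_map, Finset.prod_map, Frame.weight_eq,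
    Frame.weight_eq]
  rfl

/-- Integration over the frames on an amalgam. The weight of a glued frame is the product of the
weights on the two parts divided by the weight on the intersection, and `push` contains one factor
of this denominator in excess, which the weight of `ψ` in the integral cancels. -/
theorem integral_eq [CharZero 𝕂] (h : IsAmalgam jU jV iU iV) (a : Frame G U → 𝕂)
    (b : Frame G V → 𝕂) :
    integral (fun R : Frame G P => a (R.res jU) * b (R.res jV)) =
      integral (fun ψ : Frame G I => push iU a ψ * push iV b ψ) := by
  classical
  have hw : ∀ ψ : Frame G I, ψ.weight 𝕂 ≠ 0 := fun ψ => ψ.weight_ne_zero 𝕂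
  have h1 : integral (fun R : Frame G P => a (R.res jU) * b (R.res jV)) =
      ∑ p : {p : Frame G U × Frame G V // p.1.res iU = p.2.res iV},
        p.1.1.weight 𝕂 * p.1.2.weight 𝕂 / (p.1.1.res iU).weight 𝕂 * (a p.1.1 * b p.1.2) := by
    refine Fintype.sum_equiv h.frameEquiv _ _ fun R => ?_
    change _ = (R.res jU).weight 𝕂 * (R.res jV).weight 𝕂 / ((R.res jU).res iU).weight 𝕂 *
      (a (R.res jU) * b (R.res jV))
    rw [← h.weight_mul R, mul_div_assoc, div_self (hw _), mul_one]
  have h2 : ∀ ψ : Frame G I, ψ.weight 𝕂 * (push iU a ψ * push iV b ψ) =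
      ∑ p : Frame G U × Frame G V, if p.1.res iU = ψ ∧ p.2.res iV = ψ then
        p.1.weight 𝕂 * p.2.weight 𝕂 / ψ.weight 𝕂 * (a p.1 * b p.2) else 0 := by
    intro ψ
    unfold push
    rw [Finset.sum_mul_sum, Finset.mul_sum, Fintype.sum_prod_type]
    refine Finset.sum_congr rfl fun RU _ => ?_
    rw [Finset.mul_sum]
    refine Finset.sum_congr rfl fun RV _ => ?_
    have := hw ψ
    by_cases h1 : RU.res iU = ψ <;> by_cases h2 : RV.res iV = ψ <;> simp [h1, h2]
    field_simp
  rw [h1]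
  unfold integral
  rw [Finset.sum_congr rfl fun ψ _ => h2 ψ, Finset.sum_comm]
  rw [← Finset.sum_subtype (Finset.univ.filter fun p : Frame G U × Frame G V =>
    p.1.res iU = p.2.res iV) (by simp) (fun p : Frame G U × Frame G V =>
      p.1.weight 𝕂 * p.2.weight 𝕂 / (p.1.res iU).weight 𝕂 * (a p.1 * b p.2)), Finset.sum_filter]
  refine Finset.sum_congr rfl fun p _ => ?_
  split_ifs with hp
  · rw [Finset.sum_eq_single (p.1.res iU)]
    · simp [hp]
    · intro ψ _ hψ
      rw [if_neg fun h => hψ h.1.symm]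
    · simp
  · symm
    refine Finset.sum_eq_zero fun ψ _ => if_neg fun h => hp (h.1.trans h.2.symm)

/-- Integration over the frames on a disjoint union. -/
theorem integral_eq_of_isEmpty [CharZero 𝕂] [IsEmpty I] (h : IsAmalgam jU jV iU iV)
    (a : Frame G U → 𝕂) (b : Frame G V → 𝕂) :
    integral (fun R : Frame G P => a (R.res jU) * b (R.res jV)) = integral a * integral b := by
  rw [h.integral_eq]
  have hs : ∀ ψ ψ' : Frame G I, ψ = ψ' := fun ψ ψ' =>
    Frame.ext (funext fun x => (IsEmpty.false x).elim)
  -- the only frame on the empty poset, of weight one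
  let ψ₀ : Frame G I :=
    { arr := fun x => (IsEmpty.false x).elim
      one_mem := fun x => (IsEmpty.false x).elim
      mul_mem := fun {x _ _ _ _} => (IsEmpty.false x).elim
      inv_mul_mem := fun {x _ _ _} => (IsEmpty.false x).elim
      nonempty_iff := fun x => (IsEmpty.false x).elim }
  have h0 : ∀ c : Frame G I → 𝕂, integral c = c ψ₀ := by
    intro c
    unfold integral
    rw [Finset.sum_eq_single ψ₀ (fun ψ _ h => absurd (hs ψ ψ₀) h)
      (fun h => absurd (Finset.mem_univ _) h), Frame.weight_of_isEmpty, one_mul]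
  rw [h0]
  congr 1
  · unfold push integral
    refine Finset.sum_congr rfl fun R _ => ?_
    rw [if_pos (hs _ _), Frame.weight_of_isEmpty 𝕂 ψ₀, div_one]
  · unfold push integral
    refine Finset.sum_congr rfl fun R _ => ?_
    rw [if_pos (hs _ _), Frame.weight_of_isEmpty 𝕂 ψ₀, div_one]

end IsAmalgam

/-- The embedding of a poset in the poset with a bottom element added. -/
def coneEmb (P : Type*) [PartialOrder P] : P ↪o WithBot P := WithBot.coeOrderHom

/-- The number of ways, counted with weights, to extend a covering of `P` to the cone over `P`,
that is, to add an orbit of points below the whole covering. -/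
def coneNumber (𝕂 : Type v) [Field 𝕂] (ψ : Frame G P) : 𝕂 :=
  push (coneEmb P) (fun _ => 1) ψ

theorem coneNumber_smul (t : P → G) (ψ : Frame G P) :
    coneNumber 𝕂 (t • ψ) = coneNumber 𝕂 ψ :=
  GaugeInvariant.push (coneEmb P) (fun _ _ => rfl) t ψ

theorem push_coneEmb (c : Frame G P → 𝕂) (ψ : Frame G P) :
    push (coneEmb P) (fun R => c (R.res (coneEmb P))) ψ = coneNumber 𝕂 ψ * c ψ := by
  have := push_mul_res (coneEmb P) (fun _ => (1 : 𝕂)) c ψ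
  simp only [one_mul] at this
  exact this

theorem coneNumber_ne_zero [CharZero 𝕂] (ψ : Frame G P) : coneNumber 𝕂 ψ ≠ 0 := by
  classical
  -- the extension of `ψ` by a fixed point
  let R₀ : Frame G (WithBot P) :=
    { arr := fun x y => {g | ∀ a : P, x = a → ∃ b : P, y = b ∧ g ∈ ψ.arr a b}
      one_mem := fun x a ha => ⟨a, ha, ψ.one_mem a⟩
      mul_mem := fun {x y z g h} hg hh a ha => by
        obtain ⟨b, hb, hgb⟩ := hg a ha
        obtain ⟨c, hc, hhc⟩ := hh b hb
        exact ⟨c, hc, ψ.mul_mem hgb hhc⟩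
      inv_mul_mem := fun {x y g h} hg hh a ha => by
        obtain ⟨b, hb, hgb⟩ := hg a ha
        obtain ⟨c, hc, hhc⟩ := hh a ha
        obtain rfl : b = c := WithBot.coe_injective (hb.symm.trans hc)
        exact ⟨a, ha, ψ.inv_mul_mem hgb hhc⟩
      nonempty_iff := fun x y => by
        induction x using WithBot.recBotCoe with
        | bot => exact iff_of_true ⟨1, fun a ha => absurd ha WithBot.bot_ne_coe⟩ bot_le
        | coe x =>
          constructor
          · rintro ⟨g, hg⟩
            obtain ⟨b, rfl, hb⟩ := hg x rfl
            exact WithBot.coe_le_coe.2 (ψ.le_of_mem hb)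
          · intro hxy
            induction y using WithBot.recBotCoe with
            | bot => exact absurd hxy (WithBot.not_coe_le_bot x)
            | coe y =>
              obtain ⟨g, hg⟩ := (ψ.nonempty_iff x y).2 (WithBot.coe_le_coe.1 hxy)
              refine ⟨g, fun a ha => ⟨y, rfl, ?_⟩⟩
              rwa [← WithBot.coe_injective ha] }
  have hR₀ : R₀.res (coneEmb P) = ψ := by
    refine Frame.ext (funext fun x => funext fun y => Set.ext fun g => ?_)
    constructor
    · intro hg
      obtain ⟨b, hb, hgb⟩ := hg x rfl
      rwa [← WithBot.coe_injective hb] at hgb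
    · intro hg a ha
      refine ⟨y, rfl, ?_⟩
      rwa [← WithBot.coe_injective ha]
  -- up to a nonzero factor, a sum of natural numbers in which `R₀` has a positive term
  choose n hn hw using fun R : Frame G (WithBot P) => R.exists_weight_eq 𝕂
  have hG : (Nat.card G : 𝕂) ≠ 0 := Nat.cast_ne_zero.2 Nat.card_pos.ne'
  have : coneNumber 𝕂 ψ = ((∑ R : Frame G (WithBot P),
      if R.res (coneEmb P) = ψ then n R else 0 : ℕ) : 𝕂) /
      ((Nat.card G : 𝕂) ^ Nat.card (WithBot P) * ψ.weight 𝕂) := by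
    unfold coneNumber push
    rw [Nat.cast_sum, Finset.sum_div]
    refine Finset.sum_congr rfl fun R _ => ?_
    split_ifs
    · rw [hw R, mul_one, div_div]
    · simp
  rw [this]
  refine div_ne_zero (Nat.cast_ne_zero.2 ?_) (mul_ne_zero (pow_ne_zero _ hG) (ψ.weight_ne_zero 𝕂))
  refine (Finset.sum_pos' (fun _ _ => Nat.zero_le _) ⟨R₀, Finset.mem_univ _, ?_⟩).ne'
  rw [if_pos hR₀]
  exact hn R₀

end Integral

/-! ### Coverings with chosen base points -/

namespace Frame

section Total

variable {G : Type w} [Group G] [Finite G] {P : Type} [PartialOrder P]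

/-- The points `g • b x` of the covering with base points `b x` described by a frame, before
identification of equal points. The elements of `G` are numbered, so that the universe of `G` does
not matter. -/
@[nolint unusedArguments]
def Point (_ : Frame G P) : Type := P × Fin (Nat.card G)

instance (R : Frame G P) : Preorder R.Point where
  le a b := ((Finite.equivFin G).symm b.2)⁻¹ * (Finite.equivFin G).symm a.2 ∈ R.arr a.1 b.1
  le_refl a := by simpa using R.one_mem a.1
  le_trans a b c hab hbc := by simpa [mul_assoc] using R.mul_mem hab hbc

/-- The total poset of the covering described by a frame. -/
def Total (R : Frame G P) : Type := Antisymmetrization R.Point (· ≤ ·)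

instance (R : Frame G P) : PartialOrder R.Total :=
  inferInstanceAs (PartialOrder (Antisymmetrization R.Point (· ≤ ·)))

variable (R : Frame G P)

/-- The point `g • b x`. -/
def pt (x : P) (g : G) : R.Total :=
  toAntisymmetrization (α := R.Point) (· ≤ ·) (x, Finite.equivFin G g)

variable {R}

theorem pt_le_pt {x y : P} {g h : G} : R.pt x g ≤ R.pt y h ↔ h⁻¹ * g ∈ R.arr x y := by
  refine (toAntisymmetrization_le_toAntisymmetrization_iff (α := R.Point)).trans ?_
  change ((Finite.equivFin G).symm _)⁻¹ * (Finite.equivFin G).symm _ ∈ R.arr x y ↔ _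
  simp

theorem exists_eq_pt (t : R.Total) : ∃ (x : P) (g : G), R.pt x g = t := by
  induction t using Antisymmetrization.ind with
  | _ a =>
    refine ⟨a.1, (Finite.equivFin G).symm a.2, ?_⟩
    simp only [pt, Equiv.apply_symm_apply]
    rfl

instance [Finite P] : Finite R.Total := by
  have : Function.Surjective fun p : P × G => R.pt p.1 p.2 := fun t => by
    obtain ⟨x, g, h⟩ := exists_eq_pt t
    exact ⟨(x, g), h⟩
  exact Finite.of_surjective _ this

/-- The cell of the base below a point of the covering. -/
def proj (t : R.Total) : P := (exists_eq_pt t).choose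

/-- An element `g` such that the point is `g • b x`. -/
def coord (t : R.Total) : G := (exists_eq_pt t).choose_spec.choose

theorem pt_proj_coord (t : R.Total) : R.pt (proj t) (coord t) = t :=
  (exists_eq_pt t).choose_spec.choose_spec

theorem pt_eq_pt {x y : P} {g h : G} : R.pt x g = R.pt y h ↔ x = y ∧ h⁻¹ * g ∈ R.arr x y := by
  constructor
  · intro heq
    have h1 := pt_le_pt.1 heq.le
    exact ⟨le_antisymm (R.le_of_mem h1) (R.le_of_mem (pt_le_pt.1 heq.ge)), h1⟩
  · rintro ⟨rfl, h1⟩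
    refine le_antisymm (pt_le_pt.2 h1) (pt_le_pt.2 ?_)
    simpa using R.inv_mul_mem h1 (R.one_mem x)

@[simp]
theorem proj_pt (x : P) (g : G) : proj (R.pt x g) = x :=
  (pt_eq_pt.1 (pt_proj_coord (R.pt x g))).1

theorem coord_pt (x : P) (g : G) : (coord (R.pt x g))⁻¹ * g ∈ R.arr x x := by
  have := (pt_eq_pt.1 (pt_proj_coord (R.pt x g)).symm).2
  simpa using this

variable (R) in
theorem forall_total {p : R.Total → Prop} (h : ∀ x g, p (R.pt x g)) (t : R.Total) : p t := by
  rw [← pt_proj_coord t]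
  exact h _ _

instance : MulAction G R.Total where
  smul g t := R.pt (proj t) (g * coord t)
  one_smul t := by
    change R.pt (proj t) (1 * coord t) = t
    rw [one_mul, pt_proj_coord]
  mul_smul g h t := by
    change R.pt (proj t) (g * h * coord t) =
      R.pt (proj (R.pt (proj t) (h * coord t))) (g * coord (R.pt (proj t) (h * coord t)))
    rw [proj_pt, pt_eq_pt]
    refine ⟨rfl, ?_⟩
    have := coord_pt (R := R) (proj t) (h * coord t)
    simpa [mul_assoc] using this

@[simp]
theorem smul_pt (g : G) (x : P) (h : G) : g • R.pt x h = R.pt x (g * h) := by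
  change R.pt (proj (R.pt x h)) (g * coord (R.pt x h)) = _
  rw [proj_pt, pt_eq_pt]
  refine ⟨rfl, ?_⟩
  have := R.inv_mul_mem (coord_pt (R := R) x h) (R.one_mem x)
  simpa [mul_assoc] using this

theorem smul_mono (g : G) {s t : R.Total} (h : s ≤ t) : g • s ≤ g • t := by
  rw [← pt_proj_coord s, ← pt_proj_coord t, pt_le_pt] at h
  rw [← pt_proj_coord s, ← pt_proj_coord t, smul_pt, smul_pt, pt_le_pt]
  simpa [mul_assoc] using h

theorem proj_mono {s t : R.Total} (h : s ≤ t) : proj s ≤ proj t := by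
  rw [← pt_proj_coord s, ← pt_proj_coord t, pt_le_pt] at h
  exact R.le_of_mem h

theorem le_of_proj_le {s t r : R.Total} (hs : s ≤ r) (ht : t ≤ r) (h : proj s ≤ proj t) :
    s ≤ t := by
  rw [← pt_proj_coord s, ← pt_proj_coord r, pt_le_pt] at hs
  rw [← pt_proj_coord t, ← pt_proj_coord r, pt_le_pt] at ht
  rw [← pt_proj_coord s, ← pt_proj_coord t, pt_le_pt]
  obtain ⟨m, hm⟩ := (R.nonempty_iff _ _).2 h
  have := R.mul_mem (R.inv_mul_mem (R.mul_mem hm ht) hs) hm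
  simpa [mul_assoc] using this

theorem exists_le_of_le_proj (t : R.Total) {x : P} (h : x ≤ proj t) : ∃ s ≤ t, proj s = x := by
  obtain ⟨m, hm⟩ := (R.nonempty_iff _ _).2 h
  refine ⟨R.pt x (coord t * m), ?_, proj_pt _ _⟩
  nth_rewrite 2 [← pt_proj_coord t]
  rw [pt_le_pt]
  simpa using hm

theorem exists_ge_of_proj_le (t : R.Total) {y : P} (h : proj t ≤ y) : ∃ s ≥ t, proj s = y := by
  obtain ⟨m, hm⟩ := (R.nonempty_iff _ _).2 h
  refine ⟨R.pt y (coord t * m⁻¹), ?_, proj_pt _ _⟩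
  change t ≤ _
  nth_rewrite 1 [← pt_proj_coord t]
  rw [pt_le_pt]
  simpa using hm

/-- The cells below a point of the covering correspond to the cells below its projection. -/
def iioIso (t : R.Total) : (Set.Iio t) ≃o (Set.Iio (proj t)) :=
  RelIso.ofSurjective
    (OrderEmbedding.ofMapLEIff (fun s : Set.Iio t => (⟨proj s.1, by
      refine lt_of_le_of_ne (proj_mono (le_of_lt s.2)) fun h => ?_
      exact s.2.not_ge (le_of_proj_le le_rfl (le_of_lt s.2) h.ge)⟩ : Set.Iio (proj t)))
      fun a b => ⟨fun h => le_of_proj_le (le_of_lt a.2) (le_of_lt b.2) h, fun h => proj_mono h⟩)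
    (by
      rintro ⟨x, hx⟩
      obtain ⟨s, hs, rfl⟩ := exists_le_of_le_proj t (le_of_lt hx)
      exact ⟨⟨s, lt_of_le_of_ne hs fun h => (ne_of_lt hx) (congrArg proj h)⟩, rfl⟩)

end Total

variable {G : Type w} [Group G]

/-- The covering described by a frame. -/
def toCovering [Finite G] {d : ℕ} (c : SimpleComplex d) (R : Frame G c.Cell) : GCovering G c where
  total :=
    { Cell := R.Total
      fintypeCell := Fintype.ofFinite _
      dim := fun t => c.dim (proj t)
      dim_lt := fun {s t} h => c.dim_lt <| lt_of_le_of_ne (proj_mono h.le) fun h' =>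
        h.not_ge (le_of_proj_le le_rfl h.le h'.ge)
      sphere := fun t =>
        @IsSphere.congr _ _ _ _ (_) _ _ _ _ (c.sphere (proj t)) (iioIso t).symm
      pure := fun t => by
        obtain ⟨y, hy, hd⟩ := c.pure (proj t)
        obtain ⟨s, hs, rfl⟩ := exists_ge_of_proj_le t hy
        exact ⟨s, hs, hd⟩ }
  act := (inferInstance : MulAction G R.Total)
  smul_le_smul g _ _ h := smul_mono (R := R) g h
  dim_smul g := R.forall_total fun x h => by
    change c.dim (proj (g • R.pt x h)) = c.dim (proj (R.pt x h))
    simp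
  smul_eq_of_le g x y hx hyx := by
    have hg : g • y ≤ x := by
      rw [← hx]
      exact smul_mono (R := R) g hyx
    have hp : proj (R := R) (g • y) = proj (R := R) y :=
      R.forall_total (p := fun y => proj (g • y) = proj y) (fun x h => by simp) y
    exact le_antisymm (le_of_proj_le (R := R) hg hyx hp.le) (le_of_proj_le (R := R) hyx hg hp.ge)
  proj := proj (R := R)
  dim_proj _ := rfl
  proj_surjective x := ⟨R.pt x 1, proj_pt x 1⟩
  proj_eq_iff := R.forall_total fun x h => R.forall_total fun y k => by
    change proj (R.pt x h) = proj (R.pt y k) ↔ ∃ g : G, g • R.pt x h = R.pt y k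
    simp only [proj_pt, smul_pt, pt_eq_pt]
    constructor
    · rintro rfl
      exact ⟨k * h⁻¹, rfl, by simpa using R.one_mem x⟩
    · rintro ⟨-, h, -⟩
      exact h
  bijOn t := ⟨fun s hs => proj_mono hs,
    fun s hs r hr h => le_antisymm (le_of_proj_le hs hr h.le) (le_of_proj_le hr hs h.ge),
    fun x hx => exists_le_of_le_proj t hx⟩

end Frame

namespace GCovering

variable {G : Type w} [Group G] {d : ℕ} {c c' : SimpleComplex d}

/-- A choice of a base point in every fiber. -/
abbrev BaseSection (f : GCovering G c) : Type :=
  {b : c.Cell → f.total.Cell // ∀ x, f.proj (b x) = x}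

theorem nonempty_baseSection (f : GCovering G c) : Nonempty f.BaseSection :=
  ⟨⟨Function.surjInv f.proj_surjective, Function.surjInv_eq f.proj_surjective⟩⟩

theorem smul_le_smul_iff (f : GCovering G c) (g : G) (x y : f.total.Cell) :
    g • x ≤ g • y ↔ x ≤ y := by
  refine ⟨fun h => ?_, f.smul_le_smul g x y⟩
  simpa using f.smul_le_smul g⁻¹ _ _ h

/-- The frame of a covering with base points. -/
def frame (f : GCovering G c) (b : f.BaseSection) : Frame G c.Cell where
  arr x y := {g | g • b.1 x ≤ b.1 y}
  one_mem x := by simp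
  mul_mem {x y z g h} hg hh := by
    change (h * g) • b.1 x ≤ b.1 z
    rw [mul_smul]
    exact (f.smul_le_smul h _ _ hg).trans hh
  inv_mul_mem {x y g h} hg hh := by
    change (g⁻¹ * h) • b.1 x ≤ b.1 x
    have : h • b.1 x = g • b.1 x :=
      (f.bijOn (b.1 y)).injOn hh hg (by rw [f.proj_smul, f.proj_smul])
    rw [mul_smul, this, inv_smul_smul]
  nonempty_iff x y := by
    constructor
    · rintro ⟨g, hg⟩
      have := f.proj_mono hg
      rwa [f.proj_smul, b.2, b.2] at this
    · intro h
      rw [← b.2 y] at h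
      obtain ⟨t, ht, htx⟩ := (f.bijOn (b.1 y)).surjOn h
      obtain ⟨g, rfl⟩ := (f.proj_eq_iff (b.1 x) t).1 ((b.2 x).trans htx.symm)
      exact ⟨g, ht⟩

theorem mem_frame (f : GCovering G c) (b : f.BaseSection) {x y : c.Cell} {g : G} :
    g ∈ (f.frame b).arr x y ↔ g • b.1 x ≤ b.1 y := Iff.rfl

/-- The base points of the covering described by a frame. -/
def baseSection [Finite G] (R : Frame G c.Cell) : (R.toCovering c).BaseSection :=
  ⟨fun x => R.pt x 1, fun x => Frame.proj_pt x 1⟩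

theorem frame_baseSection [Finite G] (R : Frame G c.Cell) :
    (R.toCovering c).frame (baseSection R) = R := by
  refine Frame.ext (funext fun x => funext fun y => Set.ext fun g => ?_)
  change g • R.pt x 1 ≤ R.pt y 1 ↔ _
  rw [Frame.smul_pt, Frame.pt_le_pt]
  simp

/-- Frames of the same covering are gauge equivalent. -/
theorem exists_frame_eq_smul (f : GCovering G c) (b b' : f.BaseSection) :
    ∃ t : c.Cell → G, f.frame b' = t • f.frame b := by
  choose t ht using fun x => (f.proj_eq_iff (b.1 x) (b'.1 x)).1 ((b.2 x).trans (b'.2 x).symm)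
  refine ⟨t, Frame.ext (funext fun x => funext fun y => Set.ext fun g => ?_)⟩
  rw [Frame.mem_smul, mem_frame, mem_frame, ← ht x, ← ht y, mul_smul, mul_smul,
    ← f.smul_le_smul_iff (t y)⁻¹, inv_smul_smul]

/-- The base points translated by a gauge transformation. -/
theorem exists_frame_smul (f : GCovering G c) (b : f.BaseSection) (t : c.Cell → G) :
    ∃ b' : f.BaseSection, f.frame b' = t • f.frame b := by
  refine ⟨⟨fun x => t x • b.1 x, fun x => by rw [f.proj_smul, b.2]⟩,
    Frame.ext (funext fun x => funext fun y => Set.ext fun g => ?_)⟩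
  rw [Frame.mem_smul, mem_frame, mem_frame, mul_smul, mul_smul,
    ← f.smul_le_smul_iff (t y)⁻¹, inv_smul_smul]

/-- Isomorphisms take base points to base points. -/
def IsoOver.mapSection {φ : c.Cell ≃o c'.Cell} {f : GCovering G c} {f' : GCovering G c'}
    (ψ : IsoOver φ f f') (b : f.BaseSection) : f'.BaseSection :=
  ⟨fun x => ψ.cell (b.1 (φ.symm x)), fun x => by rw [ψ.proj, b.2]; simp⟩

theorem IsoOver.frame_mapSection {φ : c.Cell ≃o c'.Cell} {f : GCovering G c} {f' : GCovering G c'}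
    (ψ : IsoOver φ f f') (b : f.BaseSection) :
    (f'.frame (ψ.mapSection b)).res φ.toOrderEmbedding = f.frame b := by
  refine Frame.ext (funext fun x => funext fun y => Set.ext fun g => ?_)
  change g • ψ.cell (b.1 (φ.symm (φ x))) ≤ ψ.cell (b.1 (φ.symm (φ y))) ↔ g • b.1 x ≤ b.1 y
  rw [← ψ.equivariant]
  simp

theorem IsoOver.ext' {φ : c.Cell ≃o c'.Cell} {f : GCovering G c} {f' : GCovering G c'}
    {ψ ψ' : IsoOver φ f f'} (h : ∀ x, ψ.cell x = ψ'.cell x) : ψ = ψ' := by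
  cases ψ
  cases ψ'
  congr
  exact OrderIso.ext (funext h)

/-- A covering is determined by its frame. -/
def isoOfFrame [Finite G] (φ : c.Cell ≃o c'.Cell) (R : Frame G c.Cell) (f : GCovering G c')
    (b : f.BaseSection) (h : (f.frame b).res φ.toOrderEmbedding = R) :
    IsoOver φ (R.toCovering c) f :=
  have hle : ∀ (x y : c.Cell) (g k : G),
      g • b.1 (φ x) ≤ k • b.1 (φ y) ↔ R.pt x g ≤ R.pt y k := fun x y g k => by
    rw [Frame.pt_le_pt, ← h]
    change _ ↔ (k⁻¹ * g) • b.1 (φ x) ≤ b.1 (φ y)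
    rw [mul_smul, ← f.smul_le_smul_iff k⁻¹, inv_smul_smul]
  have hmk : ∀ x g, Frame.coord (R.pt x g) • b.1 (φ (Frame.proj (R.pt x g))) = g • b.1 (φ x) :=
    fun x g => by
      apply le_antisymm <;> rw [hle, Frame.pt_proj_coord]
  { cell := RelIso.ofSurjective
      (OrderEmbedding.ofMapLEIff (fun t : R.Total => Frame.coord t • b.1 (φ (Frame.proj t)))
        fun s t => (hle _ _ _ _).trans (iff_of_eq (congrArg₂ (· ≤ ·)
          (Frame.pt_proj_coord (R := R) s) (Frame.pt_proj_coord (R := R) t))))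
      (fun y => by
        obtain ⟨g, hg⟩ := (f.proj_eq_iff (b.1 (f.proj y)) y).1 (b.2 _)
        refine ⟨R.pt (φ.symm (f.proj y)) g, (hmk _ _).trans ?_⟩
        rw [OrderIso.apply_symm_apply, hg])
    equivariant := fun g => R.forall_total fun x k => by
      change Frame.coord (g • R.pt x k) • b.1 (φ (Frame.proj (g • R.pt x k))) =
        g • Frame.coord (R.pt x k) • b.1 (φ (Frame.proj (R.pt x k)))
      rw [Frame.smul_pt, hmk, hmk, mul_smul]
    proj := R.forall_total fun x k => by
      change f.proj (Frame.coord (R.pt x k) • b.1 (φ (Frame.proj (R.pt x k)))) =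
        φ (Frame.proj (R.pt x k))
      rw [f.proj_smul, b.2] }

/-- Isomorphisms over `φ` of coverings given by frames are gauge equivalences. -/
theorem nonempty_isoOver_iff [Finite G] (φ : c.Cell ≃o c'.Cell) (R : Frame G c.Cell)
    (R' : Frame G c'.Cell) :
    Nonempty (IsoOver φ (R.toCovering c) (R'.toCovering c')) ↔
      ∃ t : c.Cell → G, R = t • R'.res φ.toOrderEmbedding := by
  constructor
  · rintro ⟨ψ⟩
    obtain ⟨t, ht⟩ := exists_frame_eq_smul _ (baseSection R') (ψ.mapSection (baseSection R))
    refine ⟨t ∘ φ, ?_⟩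
    have := ψ.frame_mapSection (baseSection R)
    rw [ht, frame_baseSection, frame_baseSection] at this
    exact this.symm
  · rintro ⟨t, rfl⟩
    obtain ⟨b, hb⟩ := exists_frame_smul _ (baseSection R') (t ∘ φ.symm)
    refine ⟨isoOfFrame φ _ _ b ?_⟩
    rw [hb, frame_baseSection, Frame.res_smul]
    congr 1
    funext x
    simp

theorem nonempty_iso_frame [Finite G] (f : GCovering G c) (b : f.BaseSection) :
    Nonempty (Iso ((f.frame b).toCovering c) f) :=
  ⟨isoOfFrame _ _ f b rfl⟩

/-! ### The mass of a covering -/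

section Mass

variable [Finite G] (f : GCovering G c)

/-- Base points in a covering are the same as an isomorphism with the covering of a frame. -/
def sigmaIsoEquiv : (Σ R : Frame G c.Cell, Iso (R.toCovering c) f) ≃ f.BaseSection :=
  have hframe : ∀ p : Σ R : Frame G c.Cell, Iso (R.toCovering c) f,
      f.frame (p.2.mapSection (baseSection p.1)) = p.1 := fun p =>
    (p.2.frame_mapSection (baseSection p.1)).trans (frame_baseSection p.1)
  Equiv.ofBijective (fun p => p.2.mapSection (baseSection p.1)) (by
    constructor
    · intro p p' h
      have hR : p.1 = p'.1 :=
        (hframe p).symm.trans ((congrArg f.frame h).trans (hframe p'))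
      obtain ⟨R, ψ⟩ := p
      obtain ⟨R', ψ'⟩ := p'
      obtain rfl : R = R' := hR
      congr 1
      refine IsoOver.ext' (R.forall_total fun x g => ?_)
      have h1 : ψ.cell (R.pt x 1) = ψ'.cell (R.pt x 1) := congrFun (congrArg Subtype.val h) x
      have h2 : R.pt x g = g • R.pt x 1 := by simp
      rw [h2]
      exact (ψ.equivariant g (R.pt x 1)).trans
        ((congrArg (g • ·) h1).trans (ψ'.equivariant g (R.pt x 1)).symm)
    · intro b
      refine ⟨⟨f.frame b, isoOfFrame _ _ f b rfl⟩, Subtype.ext (funext fun x => ?_)⟩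
      have : (f.frame b).pt x (Frame.coord ((f.frame b).pt x 1)) = (f.frame b).pt x 1 := by
        have := Frame.pt_proj_coord ((f.frame b).pt x 1)
        rwa [Frame.proj_pt] at this
      change Frame.coord ((f.frame b).pt x 1) • b.1 (Frame.proj ((f.frame b).pt x 1)) = b.1 x
      rw [Frame.proj_pt]
      have h1 := Frame.pt_le_pt.1 this.le
      have h2 := Frame.pt_le_pt.1 this.ge
      refine le_antisymm ?_ ?_
      · simpa [mem_frame] using h1
      · rw [mem_frame, mul_one] at h2
        rw [← f.smul_le_smul_iff (Frame.coord ((f.frame b).pt x 1))⁻¹, inv_smul_smul]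
        exact h2)

instance : Finite f.BaseSection := by
  infer_instance

instance (R : Frame G c.Cell) : Finite (Iso (R.toCovering c) f) :=
  Finite.of_injective (fun ψ => f.sigmaIsoEquiv ⟨R, ψ⟩) fun ψ ψ' h => by
    simpa using f.sigmaIsoEquiv.injective h

theorem card_iso_eq (R : Frame G c.Cell) (ψ : Iso (R.toCovering c) f) :
    Nat.card (Iso (R.toCovering c) f) = f.autCard :=
  Nat.card_congr
    { toFun := fun χ => ψ.symm.trans χ
      invFun := fun χ => ψ.trans χ
      left_inv := fun χ => IsoOver.ext' fun x => by
        change χ.cell (ψ.cell.symm (ψ.cell x)) = χ.cell x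
        simp
      right_inv := fun χ => IsoOver.ext' fun x => by
        change χ.cell (ψ.cell (ψ.cell.symm x)) = χ.cell x
        simp }

omit [Finite G] in
/-- The orbit–stabilizer theorem: the fibers are orbits, and `arr x x` is a stabilizer. -/
theorem card_fiber_mul (b : f.BaseSection) (x : c.Cell) :
    Nat.card {t // f.proj t = x} * Nat.card ((f.frame b).arr x x) = Nat.card G := by
  have h1 : Nat.card {t // f.proj t = x} = Nat.card (MulAction.orbit G (b.1 x)) := by
    refine Nat.card_congr (Equiv.subtypeEquivRight fun t => ?_)
    have h := f.proj_eq_iff (b.1 x) t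
    rw [b.2] at h
    exact eq_comm.trans h
  have h2 : Nat.card ((f.frame b).arr x x) = Nat.card (MulAction.stabilizer G (b.1 x)) := by
    refine Nat.card_congr (Equiv.subtypeEquivRight fun g => ?_)
    rw [MulAction.mem_stabilizer_iff, mem_frame]
    refine ⟨fun h => (f.bijOn (b.1 x)).injOn h le_rfl (f.proj_smul g _), fun h => h.le⟩
  rw [h1, h2, ← Nat.card_prod]
  exact Nat.card_congr (MulAction.orbitProdStabilizerEquivGroup G (b.1 x))

/-- All frames of a covering have the same weight, the inverse of the number of choices of base
points. -/
theorem weight_frame (𝕂 : Type v) [Field 𝕂] [CharZero 𝕂] (b : f.BaseSection) :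
    (f.frame b).weight 𝕂 = 1 / (Nat.card f.BaseSection : 𝕂) := by
  have h1 : Nat.card f.BaseSection = ∏ x, Nat.card {t // f.proj t = x} := by
    rw [← Nat.card_pi]
    exact Nat.card_congr (Equiv.subtypePiEquivPi (p := fun x t => f.proj t = x))
  rw [h1, Frame.weight_eq, Nat.cast_prod, one_div, ← Finset.prod_inv_distrib]
  refine Finset.prod_congr rfl fun x _ => ?_
  rw [← f.card_fiber_mul b x]
  have h2 : (Nat.card ((f.frame b).arr x x) : 𝕂) ≠ 0 := by
    have : Nonempty ((f.frame b).arr x x) := ⟨⟨1, (f.frame b).one_mem x⟩⟩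
    exact Nat.cast_ne_zero.2 Nat.card_pos.ne'
  have h3 : (Nat.card {t // f.proj t = x} : 𝕂) ≠ 0 := by
    have : Nonempty {t // f.proj t = x} := ⟨⟨b.1 x, b.2 x⟩⟩
    exact Nat.cast_ne_zero.2 Nat.card_pos.ne'
  push_cast
  field_simp

open Classical in
/-- The inverse of the order of the automorphism group of a covering is the sum of the weights of
the frames of this covering: by `sigmaIsoEquiv` every such frame comes from as many choices of
base points as there are automorphisms. -/
theorem one_div_autCard (𝕂 : Type v) [Field 𝕂] [CharZero 𝕂] :
    1 / (f.autCard : 𝕂) =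
      ∑ R : Frame G c.Cell, if Nonempty (Iso (R.toCovering c) f) then R.weight 𝕂 else 0 := by
  obtain ⟨b⟩ := f.nonempty_baseSection
  have hS : (Nat.card f.BaseSection : 𝕂) ≠ 0 := by
    have : Nonempty f.BaseSection := ⟨b⟩
    exact Nat.cast_ne_zero.2 Nat.card_pos.ne'
  have hA : (f.autCard : 𝕂) ≠ 0 := by
    obtain ⟨ψ⟩ := f.nonempty_iso_frame b
    rw [← f.card_iso_eq _ ψ]
    have : Nonempty (Iso ((f.frame b).toCovering c) f) := ⟨ψ⟩
    exact Nat.cast_ne_zero.2 Nat.card_pos.ne'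
  have hsum : (Nat.card f.BaseSection : 𝕂) =
      ∑ R : Frame G c.Cell, (Nat.card (Iso (R.toCovering c) f) : 𝕂) := by
    rw [← Nat.card_congr f.sigmaIsoEquiv, Nat.card_sigma, Nat.cast_sum]
  rw [div_eq_iff hA, Finset.sum_mul, ← div_self hS]
  nth_rewrite 1 [hsum]
  rw [Finset.sum_div]
  refine Finset.sum_congr rfl fun R _ => ?_
  split_ifs with h
  · obtain ⟨ψ⟩ := h
    have hw : R.weight 𝕂 = 1 / (Nat.card f.BaseSection : 𝕂) := by
      rw [← f.weight_frame 𝕂 (ψ.mapSection (baseSection R))]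
      congr 1
      exact ((ψ.frame_mapSection (baseSection R)).trans (frame_baseSection R)).symm
    rw [hw, f.card_iso_eq R ψ]
    ring
  · have : IsEmpty (Iso (R.toCovering c) f) := not_nonempty_iff.1 h
    simp

end Mass

end GCovering

/-! ### Rigidity of connected colored complexes -/

namespace SimpleComplex

variable {d : ℕ} {c : SimpleComplex d}

theorem dim_mono {x y : c.Cell} (h : x ≤ y) : c.dim x ≤ c.dim y := by
  rcases h.lt_or_eq with h | rfl
  · exact (c.dim_lt h).le
  · exact le_rfl

theorem dim_le (x : c.Cell) : c.dim x ≤ d := by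
  obtain ⟨y, hxy, hy⟩ := c.pure x
  exact (dim_mono hxy).trans hy.le

theorem eq_of_le_of_dim_eq {x y : c.Cell} (h : x ≤ y) (hd : c.dim x = c.dim y) : x = y := by
  rcases h.lt_or_eq with h | h
  · exact absurd (c.dim_lt h) hd.not_lt
  · exact h

/-- Every vertex of a complex of positive dimension lies in an edge: for a minimal cell `z` that
properly contains the vertex `v`, the vertex is an isolated point of the boundary sphere of `z`,
so that this sphere has dimension zero. -/
theorem exists_edge (hd : 0 < d) (v : c.Vertex) : ∃ e, v.1 < e ∧ c.dim e = 1 := by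
  classical
  obtain ⟨y, hvy, hy⟩ := c.pure v.1
  have hlt : v.1 < y := lt_of_le_of_ne hvy fun h => by
    have := v.2
    rw [h] at this
    omega
  obtain ⟨z, -, hz⟩ := exists_minimal_le_of_wellFoundedLT (fun z : c.Cell => v.1 < z) y hlt
  refine ⟨z, hz.1, ?_⟩
  have h0 := c.dim_lt hz.1
  have hv := v.2
  by_contra h1
  obtain ⟨φ⟩ := c.sphere z
  have hpre : PreconnectedSpace (orderComplex (Set.Iio z)) := by
    have : PreconnectedSpace (Metric.sphere (0 : EuclideanSpace ℝ (Fin (c.dim z))) 1) := by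
      refine Subtype.preconnectedSpace (isPreconnected_sphere ?_ _ _)
      rw [← Module.finrank_eq_rank, finrank_euclideanSpace_fin]
      exact_mod_cast (by omega : 1 < c.dim z)
    refine ⟨?_⟩
    rw [← φ.symm.surjective.range_eq]
    exact isPreconnected_range φ.symm.continuous
  have hsingle : ∀ u : c.Cell, u < z → (Pi.single u 1 : c.Cell → ℝ) ∈ orderComplex (Set.Iio z) := by
    intro u hu
    have hs : Function.support (Pi.single u (1 : ℝ)) = {u} :=
      Pi.support_single_of_ne one_ne_zero
    refine ⟨single_mem_stdSimplex ℝ u, ?_, ?_⟩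
    · rw [hs]
      rintro _ rfl
      exact hu
    · rw [hs]
      exact Set.pairwise_singleton _ _
  obtain ⟨p, hpv, hpz⟩ := exists_other_vertex hz.1
  have hpz' : p.1 < z := lt_of_le_of_ne hpz fun h => by
    have := p.2
    rw [h] at this
    omega
  -- On a connected sphere the barycentric coordinate of `v` takes the value `1 / 2`; the support
  -- of such a point is a chain of cells below `z`, which contains `v` only, as `z` is minimal.
  obtain ⟨w, hw⟩ := mem_range_of_exists_le_of_exists_ge
    (f := fun w : orderComplex (Set.Iio z) => w.1 v.1) (c := 1 / 2)
    ((continuous_apply _).comp continuous_subtype_val)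
    ⟨⟨_, hsingle _ hpz'⟩, by
      have : v.1 ≠ p.1 := fun h => hpv (Subtype.ext h.symm)
      simp [this]⟩
    ⟨⟨_, hsingle _ hz.1⟩, by norm_num [Pi.single_eq_same]⟩
  obtain ⟨⟨-, hsum⟩, hsupp, hchain⟩ := w.2
  have hw' : w.1 v.1 = 1 / 2 := hw
  have hmem : v.1 ∈ Function.support w.1 := by
    rw [Function.mem_support, hw']
    norm_num
  have hzero : ∀ u, u ≠ v.1 → w.1 u = 0 := by
    intro u hu
    by_contra hne
    rcases hchain.total hmem hne with h | h
    · have hlt : v.1 < u := lt_of_le_of_ne h (Ne.symm hu)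
      exact (hsupp hne : u < z).not_ge (hz.2 hlt (hsupp hne : u < z).le)
    · exact hu (Vertex.eq_of_le h)
  rw [Fintype.sum_eq_single v.1 hzero, hw'] at hsum
  norm_num at hsum

theorem isFlag_pair {v e : c.Cell} (h : v < e) (hv : c.dim v = 0) (he : c.dim e = 1) :
    c.IsFlag (n := 1) ![v, e] := by
  constructor
  · refine Fin.strictMono_iff_lt_succ.2 fun i => ?_
    fin_cases i
    exact h
  · intro i
    fin_cases i
    exacts [hv, he]

end SimpleComplex

theorem ConnectedOn.sameComponent {P : Type*} [PartialOrder P]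
    (h : ConnectedOn (Set.univ : Set P)) (x y : P) : SameComponent x y :=
  Relation.ReflTransGen.mono (fun _ _ hab => hab.2.2) _ _ (h.2 x trivial y trivial)

theorem ConnectedOn.subsingleton {c : SimpleComplex 0}
    (h : ConnectedOn (Set.univ : Set c.Cell)) (x y : c.Cell) : x = y := by
  have key : ∀ a b : c.Cell, a ≤ b → a = b := fun a b hab =>
    SimpleComplex.eq_of_le_of_dim_eq hab (by
      have := SimpleComplex.dim_le a
      have := SimpleComplex.dim_le b
      omega)
  have := h.sameComponent x y
  induction this with
  | refl => rfl
  | tail _ hbc ih =>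
    rcases hbc with hbc | hbc
    · exact ih.trans (key _ _ hbc)
    · exact ih.trans (key _ _ hbc).symm

namespace ColoredComplex

variable {d : ℕ} {S : Type u}

theorem ori_vertex_flip (c : ColoredComplex d S) {v v' e : c.Cell} (hv : c.dim v = 0)
    (hv' : c.dim v' = 0) (he : c.dim e = 1) (h : v < e) (h' : v' < e) (hne : v ≠ v') :
    c.ori 0 ![v', e] = - c.ori 0 ![v, e] :=
  c.ori_flip 0 _ _ (SimpleComplex.isFlag_pair h hv he) (SimpleComplex.isFlag_pair h' hv' he) rfl
    ⟨0, hne, fun j hj => by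
      fin_cases j
      · exact absurd rfl hj
      · rfl⟩

/-- Connected colored complexes have no nontrivial automorphisms: cells of positive dimension are
fixed because of their colors, and vertices because of the orientations of the edges. -/
theorem Iso.rigid {c : ColoredComplex d S} (hc : ConnectedOn (Set.univ : Set c.Cell))
    (φ : Iso c c) (x : c.Cell) : φ.cell x = x := by
  have hpos : ∀ x, 0 < c.dim x → φ.cell x = x := by
    intro x hx
    have hx' : 0 < c.dim (φ.cell x) := by rwa [φ.preserves.dim]
    have := c.color_inj ⟨φ.cell x, hx'⟩ ⟨x, hx⟩ (hc.sameComponent _ _) (φ.preserves.dim x)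
      (φ.preserves.color ⟨x, hx⟩ ⟨φ.cell x, hx'⟩ rfl)
    exact congrArg Subtype.val this
  rcases Nat.eq_zero_or_pos (c.dim x) with hx | hx
  · rcases Nat.eq_zero_or_pos d with rfl | hd
    · exact hc.subsingleton (c := c.toSimpleComplex) _ _
    · obtain ⟨e, hxe, he⟩ := SimpleComplex.exists_edge hd (⟨x, hx⟩ : c.Vertex)
      have hxe : x < e := hxe
      by_contra hne
      have hx' : c.dim (φ.cell x) = 0 := by rwa [φ.preserves.dim]
      have hee : φ.cell e = e := hpos e (by omega)
      have hxe' : φ.cell x < e := by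
        rw [← hee]
        exact φ.cell.strictMono hxe
      have h1 := c.ori_vertex_flip hx hx' he hxe hxe' (Ne.symm hne)
      have h2 := φ.preserves.ori 0 ![x, e] (SimpleComplex.isFlag_pair hxe hx he)
      have h3 : φ.cell ∘ ![x, e] = ![φ.cell x, e] := by
        funext i
        fin_cases i
        · rfl
        · exact hee
      rw [h3, h1] at h2
      exact units_ne_neg_self _ h2.symm
  · exact hpos x hx

end ColoredComplex

/-! ### Classes of coverings in terms of frames -/

section Classes

variable {G : Type w} [Group G] {D : ℕ} {S : Type u}

/-- The involution on classes of coverings that inverts the orientations of the base. -/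
def CoveringClass.star : CoveringClass G D S → CoveringClass G D S :=
  Quotient.map (fun f => ⟨⟨f.1.1.star, f.1.2⟩, f.2⟩) fun _ _ ⟨φ, ψ⟩ => ⟨φ.star, ψ⟩

theorem ColorClass.star_star (σ : ColorClass D S) : σ.star.star = σ := by
  induction σ using Quotient.inductionOn with
  | _ c =>
  refine Quotient.sound ⟨⟨OrderIso.refl _, ?_⟩⟩
  exact
    { dim := fun _ => rfl
      color := fun x x' h => by rw [Subtype.ext h]; rfl
      ori := fun n f _ => (neg_neg (c.1.ori n f)).symm }

theorem CoveringClass.star_star (β : CoveringClass G D S) : β.star.star = β := by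
  induction β using Quotient.inductionOn with
  | _ f =>
  obtain ⟨c, f⟩ := f
  refine Quotient.sound ⟨⟨OrderIso.refl _, ?_⟩, ⟨GCovering.IsoOver.refl f⟩⟩
  exact
    { dim := fun _ => rfl
      color := fun x x' h => by rw [Subtype.ext h]; rfl
      ori := fun n f _ => (neg_neg (c.1.ori n f)).symm }

theorem CoveringClass.base_star (β : CoveringClass G D S) : β.star.base = β.base.star := by
  induction β using Quotient.inductionOn with
  | _ f => rfl

variable [Finite G]

/-- The class of the covering of a colored complex described by a frame. -/
def covClass (c : ConnectedColoredComplex D S) (R : Frame G c.1.Cell) : CoveringClass G D S :=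
  Quotient.mk (coveringSetoid G D S) ⟨c, R.toCovering c.1.toSimpleComplex⟩

theorem covClass_base (c : ConnectedColoredComplex D S) (R : Frame G c.1.Cell) :
    (covClass c R).base = Quotient.mk (coloredSetoid D S) c := rfl

theorem covClass_res {c c' : ConnectedColoredComplex D S} (φ : ColoredComplex.Iso c.1 c'.1)
    (R : Frame G c'.1.Cell) : covClass c (R.res φ.cell.toOrderEmbedding) = covClass c' R :=
  Quotient.sound ⟨φ, (GCovering.nonempty_isoOver_iff φ.cell _ R).2 ⟨1, (one_smul _ _).symm⟩⟩

theorem covClass_smul (c : ConnectedColoredComplex D S) :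
    GaugeInvariant (covClass (G := G) c) := fun t R =>
  Quotient.sound ⟨ColoredComplex.Iso.refl _,
    (GCovering.nonempty_isoOver_iff (OrderIso.refl _) (t • R) R).2 ⟨t, rfl⟩⟩

/-- The class of a covering determines the frame up to gauge equivalence: an equivalence of
coverings covers an automorphism of the base, which is the identity by rigidity. -/
theorem exists_smul_of_covClass_eq {c : ConnectedColoredComplex D S} {R R' : Frame G c.1.Cell}
    (h : covClass c R = covClass c R') : ∃ t : c.1.Cell → G, R = t • R' := by
  obtain ⟨φ, ψ⟩ := Quotient.exact h
  obtain ⟨t, ht⟩ := (GCovering.nonempty_isoOver_iff φ.cell R R').1 ψ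
  refine ⟨t, ht.trans ?_⟩
  congr 1
  exact R'.res_congr (j' := RelEmbedding.refl _) fun x => φ.rigid c.2 x

theorem covClass_eq_of_frame {c : ConnectedColoredComplex D S}
    (f : GCovering G c.1.toSimpleComplex) (b : f.BaseSection) :
    covClass c (f.frame b) = Quotient.mk (coveringSetoid G D S) ⟨c, f⟩ :=
  Quotient.sound ⟨ColoredComplex.Iso.refl _, f.nonempty_iso_frame b⟩

theorem exists_covClass_eq (c : ConnectedColoredComplex D S) (β : CoveringClass G D S)
    (h : β.base = Quotient.mk (coloredSetoid D S) c) :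
    ∃ R : Frame G c.1.Cell, covClass c R = β := by
  induction β using Quotient.inductionOn with
  | _ f =>
  obtain ⟨c', f⟩ := f
  obtain ⟨φ⟩ : Nonempty (ColoredComplex.Iso c'.1 c.1) := Quotient.exact h
  obtain ⟨b⟩ := f.nonempty_baseSection
  refine ⟨(f.frame b).res φ.symm.cell.toOrderEmbedding, ?_⟩
  rw [covClass_res (c := c) (c' := c') φ.symm, covClass_eq_of_frame]

/-- The complex with inverted orientations. -/
def ConnectedColoredComplex.star (c : ConnectedColoredComplex D S) : ConnectedColoredComplex D S :=
  ⟨c.1.star, c.2⟩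

theorem star_covClass_eq {c c' : ConnectedColoredComplex D S}
    (φ : ColoredComplex.Iso c.1 c'.star.1) (R : Frame G c.1.Cell) (R' : Frame G c'.1.Cell)
    (h : ∀ x y, R.arr x y = R'.arr (φ.cell x) (φ.cell y)) : (covClass c R).star = covClass c' R' := by
  have h1 : R = Frame.res (P := c'.star.1.Cell) φ.cell.toOrderEmbedding R' :=
    Frame.ext (funext fun x => funext fun y => h x y)
  have h2 : covClass c R = (covClass c' R').star := by
    rw [h1]
    exact covClass_res φ R'
  rw [h2, CoveringClass.star_star]

instance (σ : ColorClass D S) : Finite (Upsilon G σ) := by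
  obtain ⟨c, rfl⟩ := Quotient.exists_rep σ
  refine Finite.of_surjective
    (fun R : Frame G c.1.Cell => (⟨covClass c R, covClass_base c R⟩ : Upsilon G _)) ?_
  rintro ⟨β, hβ⟩
  obtain ⟨R, rfl⟩ := exists_covClass_eq c β hβ
  exact ⟨R, rfl⟩

instance (σ : ColorClass D S) : Fintype (Upsilon G σ) := Fintype.ofFinite _

/-- The involution as a bijection of sets of classes of coverings. -/
def Upsilon.star {σ : ColorClass D S} (β : Upsilon G σ) : Upsilon G σ.star :=
  ⟨β.1.star, by rw [β.1.base_star, β.2]⟩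

end Classes

/-! ### The norm of a class of coverings -/

section Norm

variable {𝕂 : Type v} [Field 𝕂] {G : Type w} [Group G] [Finite G] {D : ℕ} {S : Type u}

theorem coneNumber_res_iso {P Q : Type*} [PartialOrder P] [PartialOrder Q] [Finite P] [Finite Q]
    (φ : Q ≃o P) (ψ : Frame G P) :
    coneNumber 𝕂 (ψ.res φ.toOrderEmbedding) = coneNumber 𝕂 ψ := by
  classical
  symm
  refine Fintype.sum_equiv (Frame.resEquiv φ.withBotCongr) _ _ fun R => ?_
  have h1 : (R.res φ.withBotCongr.toOrderEmbedding).res (coneEmb Q) =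
      (R.res (coneEmb P)).res φ.toOrderEmbedding :=
    R.res_congr (j := (coneEmb Q).trans φ.withBotCongr.toOrderEmbedding)
      (j' := φ.toOrderEmbedding.trans (coneEmb P)) fun x => rfl
  have h2 : (R.res φ.withBotCongr.toOrderEmbedding).res (coneEmb Q) =
      ψ.res φ.toOrderEmbedding ↔ R.res (coneEmb P) = ψ := by
    rw [h1]
    exact (Frame.resEquiv φ).injective.eq_iff
  change _ = if (R.res φ.withBotCongr.toOrderEmbedding).res (coneEmb Q) =
      ψ.res φ.toOrderEmbedding then (R.res φ.withBotCongr.toOrderEmbedding).weight 𝕂 /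
      (ψ.res φ.toOrderEmbedding).weight 𝕂 * 1 else 0
  rw [Frame.weight_res_iso, Frame.weight_res_iso]
  simp only [h2]

open Classical in
variable (𝕂) in
/-- The value of the form of the complex with two vertices on the pair of a class of coverings of
the vertex complex and the inverse class: the weighted number of coverings of the suspension of the
vertex complex that restrict to the given class. -/
def classNorm (γ : CoveringClass G D S) : 𝕂 :=
  integral fun ψ : Frame G (Quotient.out γ).1.1.Cell =>
    if covClass (Quotient.out γ).1 ψ = γ then coneNumber 𝕂 ψ * coneNumber 𝕂 ψ else 0

open Classical in
theorem classNorm_eq (c : ConnectedColoredComplex D S) (γ : CoveringClass G D S)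
    (h : γ.base = Quotient.mk (coloredSetoid D S) c) :
    classNorm 𝕂 γ = integral fun ψ : Frame G c.1.Cell =>
      if covClass c ψ = γ then coneNumber 𝕂 ψ * coneNumber 𝕂 ψ else 0 := by
  have h' : Quotient.mk (coloredSetoid D S) (Quotient.out γ).1 =
      Quotient.mk (coloredSetoid D S) c := by
    rw [← h]
    conv_rhs => rw [← Quotient.out_eq γ]
    rfl
  obtain ⟨φ⟩ : Nonempty (ColoredComplex.Iso (Quotient.out γ).1.1 c.1) := Quotient.exact h'
  unfold classNorm
  rw [← integral_res_iso φ.cell]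
  congr 1
  funext ψ
  rw [covClass_res φ ψ, coneNumber_res_iso]

/-- The weights are positive rational numbers. -/
theorem integral_indicator_ne_zero [CharZero 𝕂] {P : Type*} [PartialOrder P] [Finite P]
    (p : Frame G P → Prop) [DecidablePred p] (h : ∃ ψ, p ψ) :
    integral (fun ψ : Frame G P => if p ψ then (1 : 𝕂) else 0) ≠ 0 := by
  choose n hn hw using fun R : Frame G P => R.exists_weight_eq 𝕂
  have hG : (Nat.card G : 𝕂) ≠ 0 := Nat.cast_ne_zero.2 Nat.card_pos.ne'
  have : integral (fun ψ : Frame G P => if p ψ then (1 : 𝕂) else 0) =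
      ((∑ R, if p R then n R else 0 : ℕ) : 𝕂) / (Nat.card G : 𝕂) ^ Nat.card P := by
    unfold integral
    rw [Nat.cast_sum, Finset.sum_div]
    refine Finset.sum_congr rfl fun R _ => ?_
    dsimp only
    split_ifs
    · rw [hw R, mul_one]
    · simp
  rw [this]
  refine div_ne_zero (Nat.cast_ne_zero.2 ?_) (pow_ne_zero _ hG)
  obtain ⟨ψ, hψ⟩ := h
  refine (Finset.sum_pos' (fun _ _ => Nat.zero_le _) ⟨ψ, Finset.mem_univ _, ?_⟩).ne'
  rw [if_pos hψ]
  exact hn ψ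

open Classical in
/-- Gauge invariant functions are constant on the frames of a class, so that they can be exchanged
between the integrals over this class. -/
theorem integral_mul_integral {c : ConnectedColoredComplex D S} {a b h : Frame G c.1.Cell → 𝕂}
    (hb : GaugeInvariant b) (hh : GaugeInvariant h) (γ : CoveringClass G D S) :
    (integral fun ψ => if covClass c ψ = γ then a ψ * h ψ else 0) *
        (integral fun ψ => if covClass c ψ = γ then b ψ * h ψ else 0) =
      (integral fun ψ => if covClass c ψ = γ then a ψ * b ψ else 0) *
        integral fun ψ => if covClass c ψ = γ then h ψ * h ψ else 0 := by
  unfold integral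
  rw [Finset.sum_mul_sum, Finset.sum_mul_sum]
  refine Finset.sum_congr rfl fun ψ _ => Finset.sum_congr rfl fun ψ' _ => ?_
  dsimp only
  split_ifs with h1 h2 h2
  · obtain ⟨t, rfl⟩ := exists_smul_of_covClass_eq (h1.trans h2.symm)
    rw [hb, hh]
    ring
  all_goals simp

/-- On the frames of a class `coneNumber` is a nonzero constant. -/
theorem classNorm_ne_zero [CharZero 𝕂] (γ : CoveringClass G D S) : classNorm 𝕂 γ ≠ 0 := by
  classical
  obtain ⟨c, hc⟩ : ∃ c, Quotient.mk (coloredSetoid D S) c = γ.base := Quotient.exists_rep _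
  obtain ⟨ψ₀, hψ₀⟩ := exists_covClass_eq c γ hc.symm
  rw [classNorm_eq c γ hc.symm]
  have : (fun ψ : Frame G c.1.Cell => if covClass c ψ = γ then
      coneNumber 𝕂 ψ * coneNumber 𝕂 ψ else 0) = fun ψ => if covClass c ψ = γ then
      (coneNumber 𝕂 ψ₀ * coneNumber 𝕂 ψ₀) else 0 := by
    funext ψ
    split_ifs with h
    · obtain ⟨t, rfl⟩ := exists_smul_of_covClass_eq (h.trans hψ₀.symm)
      rw [coneNumber_smul]
    · rfl
  rw [this]
  have h2 : integral (fun ψ : Frame G c.1.Cell => if covClass c ψ = γ then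
      (coneNumber 𝕂 ψ₀ * coneNumber 𝕂 ψ₀) else 0) = (coneNumber 𝕂 ψ₀ * coneNumber 𝕂 ψ₀) *
      integral (fun ψ : Frame G c.1.Cell => if covClass c ψ = γ then (1 : 𝕂) else 0) := by
    unfold integral
    rw [Finset.mul_sum]
    refine Finset.sum_congr rfl fun ψ _ => ?_
    dsimp only
    split_ifs <;> ring
  rw [h2]
  have h0 := coneNumber_ne_zero (𝕂 := 𝕂) ψ₀
  exact mul_ne_zero (mul_ne_zero h0 h0) (integral_indicator_ne_zero _ ⟨ψ₀, hψ₀⟩)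

end Norm

/-! ### Hurwitz numbers as sums over frames -/

section Partition

variable {𝕂 : Type v} [Field 𝕂] {G : Type w} [Group G] {D : ℕ} {S : Type u}

namespace BraneComplex

/-- The vertex complex as a connected colored complex. -/
def link (Ω : BraneComplex (D + 1) S) (q : Ω.Vertex) : ConnectedColoredComplex D S :=
  ⟨Ω.vertexComplex q, Ω.vertexComplex_connected q⟩

/-- The cells of the vertex complex of `q` are the cells that properly contain `q`. -/
def linkEmb (Ω : BraneComplex (D + 1) S) (q : Ω.Vertex) : (Ω.link q).1.Cell ↪o Ω.Cell :=
  OrderEmbedding.subtype _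

theorem cls_eq (Ω : BraneComplex (D + 1) S) (q : Ω.Vertex) :
    Ω.cls q = Quotient.mk (coloredSetoid D S) (Ω.link q) := rfl

variable [Finite G] (Ω : BraneComplex (D + 1) S)

/-- The local invariant at `q` of the covering described by a frame. -/
def frameInvariant (q : Ω.Vertex) (R : Frame G Ω.Cell) : CoveringClass G D S :=
  covClass (Ω.link q) (R.res (Ω.linkEmb q))

theorem localInvariant_eq (f : GCovering G Ω.toSimpleComplex) (b : f.BaseSection) (q : Ω.Vertex) :
    (f.localInvariant q).1 = Ω.frameInvariant q (f.frame b) := by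
  let b' : (f.restrict q).BaseSection :=
    ⟨fun x => ⟨b.1 x.1, by rw [b.2]; exact x.2⟩, fun x => Subtype.ext (b.2 x.1)⟩
  exact (covClass_eq_of_frame (c := Ω.link q) (f.restrict q) b').symm

/-- The sum over all coverings of `Ω` of the product of the functions `X q` of the local
invariants, every covering being counted with the inverse of the order of its automorphism
group. -/
def partition (X : Ω.Vertex → CoveringClass G D S → 𝕂) : 𝕂 :=
  integral fun R : Frame G Ω.Cell => ∏ q, X q (Ω.frameInvariant q R)

open Classical in
theorem hurwitzNumber_eq [CharZero 𝕂] (β : ∀ q, Upsilon G (Ω.cls q)) :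
    hurwitzNumber 𝕂 Ω β = ∑ R : Frame G Ω.Cell,
      if ∀ q, Ω.frameInvariant q R = (β q).1 then R.weight 𝕂 else 0 := by
  let ob : Frame G Ω.Cell → GCovering.IsoClass G Ω.toSimpleComplex := fun R =>
    Quotient.mk (GCovering.isoSetoid G Ω.toSimpleComplex) (R.toCovering Ω.toSimpleComplex)
  have hob : Function.Surjective ob := fun F => by
    induction F using Quotient.inductionOn with
    | _ f =>
    obtain ⟨b⟩ := f.nonempty_baseSection
    exact ⟨f.frame b, Quotient.sound (f.nonempty_iso_frame b)⟩
  have := Finite.of_surjective ob hob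
  have := Fintype.ofFinite (GCovering.IsoClass G Ω.toSimpleComplex)
  have hiso : ∀ (R : Frame G Ω.Cell) (F : GCovering.IsoClass G Ω.toSimpleComplex),
      Nonempty (GCovering.Iso (R.toCovering Ω.toSimpleComplex) (Quotient.out F)) ↔ ob R = F := by
    intro R F
    conv_rhs => rw [← Quotient.out_eq F]
    exact ⟨fun h => Quotient.sound h, fun h => Quotient.exact h⟩
  have hinv : ∀ (R : Frame G Ω.Cell) (q : Ω.Vertex),
      (GCovering.localInvariant (Quotient.out (ob R)) q).1 = Ω.frameInvariant q R := by
    intro R q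
    obtain ⟨ψ⟩ := (hiso R (ob R)).2 rfl
    rw [Ω.localInvariant_eq _ (ψ.mapSection (GCovering.baseSection R)) q]
    congr 1
    exact (ψ.frame_mapSection _).trans (GCovering.frame_baseSection R)
  unfold hurwitzNumber
  rw [finsum_mem_def, finsum_eq_sum_of_fintype]
  have h1 : ∀ F : GCovering.IsoClass G Ω.toSimpleComplex,
      Set.indicator {F : GCovering.IsoClass G Ω.toSimpleComplex |
        ∀ q, GCovering.localInvariant (Quotient.out F) q = β q}
        (fun F => 1 / ((GCovering.autCard (Quotient.out F) : ℕ) : 𝕂)) F =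
      ∑ R : Frame G Ω.Cell, if ob R = F then
        (if ∀ q, Ω.frameInvariant q R = (β q).1 then R.weight 𝕂 else 0) else 0 := by
    intro F
    rw [Set.indicator_apply]
    by_cases hF : F ∈ {F : GCovering.IsoClass G Ω.toSimpleComplex |
        ∀ q, GCovering.localInvariant (Quotient.out F) q = β q}
    · rw [if_pos hF, GCovering.one_div_autCard]
      refine Finset.sum_congr rfl fun R _ => ?_
      simp only [hiso]
      split_ifs with h2 h3
      · rfl
      · refine absurd (fun q => ?_) h3
        rw [← hinv, h2, hF q]
      · rfl
    · rw [if_neg hF]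
      symm
      refine Finset.sum_eq_zero fun R _ => ?_
      split_ifs with h2 h3
      · refine absurd (fun q => Subtype.ext ?_) hF
        rw [← h2, hinv, h3 q]
      · rfl
      · rfl
  rw [Finset.sum_congr rfl fun F _ => h1 F, Finset.sum_comm]
  refine Finset.sum_congr rfl fun R _ => ?_
  rw [Finset.sum_ite_eq, if_pos (Finset.mem_univ _)]

end BraneComplex

open Classical in
/-- A vector of `C_σ^G`, as a function on all classes of coverings that vanishes outside
`Υ_σ^G`. -/
def classFun {σ : ColorClass D S} (x : hurwitzSpace 𝕂 G σ) (β : CoveringClass G D S) : 𝕂 :=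
  if h : β.base = σ then x ⟨β, h⟩ else 0

theorem classFun_of_base {σ : ColorClass D S} (x : hurwitzSpace 𝕂 G σ) {β : CoveringClass G D S}
    (h : β.base = σ) : classFun x β = x ⟨β, h⟩ := dif_pos h

theorem classFun_transport {σ τ : ColorClass D S} (h : σ = τ) (x : hurwitzSpace 𝕂 G σ) :
    classFun (transport (𝕂 := 𝕂) (B := hurwitzSpace 𝕂 G) h x) = classFun x := by
  subst h
  rfl

open Classical in
theorem classFun_single {σ : ColorClass D S} (β : Upsilon G σ) (a : 𝕂)
    (γ : CoveringClass G D S) :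
    classFun (Finsupp.single β a) γ = if γ = β.1 then a else 0 := by
  unfold classFun
  split_ifs with h1 h2 h2
  · rw [Finsupp.single_apply, if_pos (Subtype.ext h2.symm)]
  · rw [Finsupp.single_apply, if_neg fun h => h2 (congrArg Subtype.val h).symm]
  · exact absurd (by rw [h2, β.2]) h1
  · rfl

theorem hurwitzForm_tprod [CharZero 𝕂] [Finite G] (Ω : BraneComplex (D + 1) S)
    (x : ∀ q, hurwitzSpace 𝕂 G (Ω.cls q)) :
    hurwitzForm 𝕂 G Ω (PiTensorProduct.tprod 𝕂 x) = Ω.partition fun q => classFun (x q) := by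
  classical
  unfold hurwitzForm
  rw [Module.Basis.constr_apply_fintype]
  have h1 : ∀ β : ∀ q, Upsilon G (Ω.cls q),
      (Basis.piTensorProduct fun q : Ω.Vertex =>
        (Finsupp.basisSingleOne : Module.Basis (Upsilon G (Ω.cls q)) 𝕂 _)).equivFun
          (PiTensorProduct.tprod 𝕂 x) β = ∏ q, x q (β q) := by
    intro β
    simp [Module.Basis.equivFun_apply, Basis.piTensorProduct_repr_tprod_apply]
  simp only [h1, Ω.hurwitzNumber_eq, smul_eq_mul, Finset.mul_sum]
  rw [Finset.sum_comm]
  refine Finset.sum_congr rfl fun R _ => ?_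
  rw [Finset.sum_eq_single fun q => ⟨Ω.frameInvariant q R, rfl⟩]
  · rw [if_pos fun q => rfl, mul_comm]
    congr 1
    exact Finset.prod_congr rfl fun q _ => (classFun_of_base (x q) rfl).symm
  · intro β _ hβ
    rw [if_neg, mul_zero]
    exact fun h => hβ (funext fun q => Subtype.ext (h q).symm)
  · simp

end Partition

/-! ### Functoriality of the sums over coverings -/

section Functoriality

variable {𝕂 : Type v} [Field 𝕂] {G : Type w} [Group G] [Finite G] {D : ℕ} {S : Type u}

/-- Comparison of local invariants along a map of cells that induces an isomorphism of vertex
complexes. -/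
theorem frameInvariant_res {Ω Ω' : BraneComplex (D + 1) S} (q : Ω.Vertex) (q' : Ω'.Vertex)
    (φ : ColoredComplex.Iso (Ω.link q).1 (Ω'.link q').1) {P : Type*} [PartialOrder P]
    (i : P ↪o Ω.Cell) (j : P ↪o Ω'.Cell) (k : (Ω.link q).1.Cell ↪o P)
    (hi : ∀ x, i (k x) = Ω.linkEmb q x) (hj : ∀ x, j (k x) = Ω'.linkEmb q' (φ.cell x))
    (R : Frame G Ω.Cell) (R' : Frame G Ω'.Cell) (h : R.res i = R'.res j) :
    Ω.frameInvariant q R = Ω'.frameInvariant q' R' := by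
  unfold BraneComplex.frameInvariant
  rw [← covClass_res φ]
  congr 1
  have h1 : R.res (Ω.linkEmb q) = (R.res i).res k :=
    R.res_congr (j' := k.trans i) fun x => (hi x).symm
  rw [h1, h]
  exact R'.res_congr (j := k.trans j) (j' := φ.cell.toOrderEmbedding.trans (Ω'.linkEmb q')) hj

/-- Invariance of the sums under isomorphisms of posets of cells that induce isomorphisms of
the vertex complexes. -/
theorem partition_congr {Ω Ω' : BraneComplex (D + 1) S} (Ψ : Ω.Cell ≃o Ω'.Cell)
    (ν : Ω.Vertex ≃ Ω'.Vertex) (φ : ∀ q, ColoredComplex.Iso (Ω.link q).1 (Ω'.link (ν q)).1)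
    (hφ : ∀ q x, ((φ q).cell x).1 = Ψ x.1) (X : Ω'.Vertex → CoveringClass G D S → 𝕂) :
    Ω.partition (fun q => X (ν q)) = Ω'.partition X := by
  unfold BraneComplex.partition
  rw [← integral_res_iso Ψ]
  congr 1
  funext R
  refine Fintype.prod_equiv ν _ _ fun q => ?_
  congr 1
  exact frameInvariant_res q (ν q) (φ q) (RelEmbedding.refl _) Ψ.toOrderEmbedding (Ω.linkEmb q)
    (fun x => rfl) (fun x => (hφ q x).symm) _ R rfl

end Functoriality

/-! ### Isomorphisms of vertex complexes -/

section LinkIso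

variable {D : ℕ} {S : Type u}

/-- An isomorphism of vertex complexes from a comparison of cells of the brane complexes. -/
def linkIsoOf {Ω Ω' : BraneComplex (D + 1) S} (q : Ω.Vertex) (q' : Ω'.Vertex)
    (e : (Ω.link q).1.Cell ≃o (Ω'.link q').1.Cell)
    (hdim : ∀ x, Ω'.dim (e x).1 = Ω.dim x.1)
    (hcolor : ∀ x h h', Ω'.color ⟨(e x).1, h'⟩ = Ω.color ⟨x.1, h⟩)
    (hori : ∀ (n : ℕ) (f : Fin (n + 2) → (Ω.link q).1.Cell),
      Ω.IsFlag (n := n + 2) (Fin.cons q.1 fun i => (f i).1) →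
      Ω'.ori (n + 1) (Fin.cons q'.1 fun i => (e (f i)).1) =
        Ω.ori (n + 1) (Fin.cons q.1 fun i => (f i).1)) :
    ColoredComplex.Iso (Ω.link q).1 (Ω'.link q').1 where
  cell := e
  preserves :=
    { dim := fun x => congrArg (· - 1) (hdim x)
      color := by
        rintro x ⟨x', hx'⟩ h
        subst h
        exact hcolor _ _ _
      ori := fun n f hf => congrArg Neg.neg (hori n f (Ω.isFlag_cons hf.1 hf.2)) }

/-- An isomorphism of a vertex complex with a vertex complex with inverted orientations. -/
def linkStarIsoOf {Ω Ω' : BraneComplex (D + 1) S} (q : Ω.Vertex) (q' : Ω'.Vertex)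
    (e : (Ω.link q).1.Cell ≃o (Ω'.link q').1.Cell)
    (hdim : ∀ x, Ω'.dim (e x).1 = Ω.dim x.1)
    (hcolor : ∀ x h h', Ω'.color ⟨(e x).1, h'⟩ = Ω.color ⟨x.1, h⟩)
    (hori : ∀ (n : ℕ) (f : Fin (n + 2) → (Ω.link q).1.Cell),
      Ω.IsFlag (n := n + 2) (Fin.cons q.1 fun i => (f i).1) →
      Ω'.ori (n + 1) (Fin.cons q'.1 fun i => (e (f i)).1) =
        - Ω.ori (n + 1) (Fin.cons q.1 fun i => (f i).1)) :
    ColoredComplex.Iso (Ω.link q).1 (Ω'.link q').star.1 where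
  cell := e
  preserves :=
    { dim := fun x => congrArg (· - 1) (hdim x)
      color := by
        rintro x ⟨x', hx'⟩ h
        subst h
        exact hcolor _ _ _
      ori := fun n f hf =>
        (neg_neg _).trans (hori n f (Ω.isFlag_cons hf.1 hf.2)) }

theorem cls_eq_of_iso {Ω Ω' : BraneComplex (D + 1) S} {q : Ω.Vertex} {q' : Ω'.Vertex}
    (φ : ColoredComplex.Iso (Ω.link q).1 (Ω'.link q').1) : Ω.cls q = Ω'.cls q' :=
  Quotient.sound ⟨φ⟩

theorem cls_eq_star_of_iso {Ω Ω' : BraneComplex (D + 1) S} {q : Ω.Vertex} {q' : Ω'.Vertex}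
    (φ : ColoredComplex.Iso (Ω.link q).1 (Ω'.link q').star.1) : Ω.cls q = (Ω'.cls q').star :=
  Quotient.sound (s := coloredSetoid D S) (a := Ω.link q) (b := (Ω'.link q').star) ⟨φ⟩

theorem cons_comp_val {P Q : Type*} (j : P → Q) (x : P) {n : ℕ} (f : Fin n → P) :
    (Fin.cons (j x) fun i => j (f i) : Fin (n + 1) → Q) = j ∘ (Fin.cons x f) := by
  funext i
  induction i using Fin.cases <;> rfl

/-- The isomorphism of vertex complexes induced by an embedding with upper closed image. -/
def linkIsoOfPreserves {Ω Ω' : BraneComplex (D + 1) S} {j : Ω.Cell ↪o Ω'.Cell}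
    (h : ColoredComplex.Preserves Ω.toColoredComplex Ω'.toColoredComplex j)
    (hup : ∀ x y, j x ≤ y → ∃ x', j x' = y) (q : Ω.Vertex) :
    ColoredComplex.Iso (Ω.link q).1 (Ω'.link (vertexMap h q)).1 :=
  linkIsoOf q (vertexMap h q)
    (RelIso.ofSurjective
      (OrderEmbedding.ofMapLEIff (fun x : (Ω.link q).1.Cell =>
        (⟨j x.1, j.strictMono x.2⟩ : (Ω'.link (vertexMap h q)).1.Cell))
        fun x y => j.le_iff_le (a := x.1) (b := y.1))
      (by
        rintro ⟨y, hy⟩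
        obtain ⟨x, rfl⟩ := hup _ _ (le_of_lt hy)
        exact ⟨⟨x, j.lt_iff_lt.1 hy⟩, rfl⟩))
    (fun x => h.dim x.1)
    (fun x h1 h2 => h.color ⟨x.1, h1⟩ ⟨j x.1, h2⟩ rfl)
    (fun n f hf => by
      have := h.ori (n + 1) _ hf
      rw [← cons_comp_val (fun x => j x)] at this
      exact this)

end LinkIso

/-! ### Disjoint unions -/

section Multiplicativity

variable {𝕂 : Type v} [Field 𝕂] [CharZero 𝕂] {G : Type w} [Group G] [Finite G] {D : ℕ}
  {S : Type u}

/-- The embedding of the empty poset. -/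
def emptyEmb (P : Type*) [PartialOrder P] : Fin 0 ↪o P :=
  OrderEmbedding.ofMapLEIff (fun x => x.elim0) fun x => x.elim0

variable {Ω Ω₁ Ω₂ : BraneComplex (D + 1) S} (θ : DisjointUnion Ω Ω₁ Ω₂)

namespace DisjointUnion

include θ in
theorem inl_upper (x : Ω₁.Cell) (y : Ω.Cell) (h : θ.inl x ≤ y) : ∃ x', θ.inl x' = y := by
  rcases θ.cover y with h' | ⟨z, rfl⟩
  · exact h'
  · exact absurd h (θ.not_inl_le_inr x z)

theorem inr_upper (x : Ω₂.Cell) (y : Ω.Cell) (h : θ.inr x ≤ y) : ∃ x', θ.inr x' = y := by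
  rcases θ.cover y with ⟨z, rfl⟩ | h'
  · exact absurd h (θ.not_inr_le_inl z x)
  · exact h'

theorem isAmalgam : IsAmalgam θ.inl θ.inr (emptyEmb _) (emptyEmb _) where
  comm x := x.elim0
  cover := θ.cover
  pull u v h := absurd h.le (θ.not_inl_le_inr u v)
  upperU := θ.inl_upper
  upperV := θ.inr_upper

/-- The vertices of a disjoint union. -/
def vertexEquiv : Ω₁.Vertex ⊕ Ω₂.Vertex ≃ Ω.Vertex :=
  Equiv.ofBijective (Sum.elim (vertexMap θ.preserves_inl) (vertexMap θ.preserves_inr)) (by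
    constructor
    · rintro (q | q) (r | r) h
      · exact congrArg _ (Subtype.ext (θ.inl.injective (congrArg Subtype.val h)))
      · exact absurd (congrArg Subtype.val h).le (θ.not_inl_le_inr q.1 r.1)
      · exact absurd (congrArg Subtype.val h).le (θ.not_inr_le_inl r.1 q.1)
      · exact congrArg _ (Subtype.ext (θ.inr.injective (congrArg Subtype.val h)))
    · rintro ⟨x, hx⟩
      rcases θ.cover x with ⟨y, rfl⟩ | ⟨y, rfl⟩
      · exact ⟨Sum.inl ⟨y, (θ.preserves_inl.dim y).symm.trans hx⟩, rfl⟩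
      · exact ⟨Sum.inr ⟨y, (θ.preserves_inr.dim y).symm.trans hx⟩, rfl⟩)

theorem partition_eq (X : Ω.Vertex → CoveringClass G D S → 𝕂) :
    Ω.partition X = Ω₁.partition (fun q => X (vertexMap θ.preserves_inl q)) *
      Ω₂.partition (fun q => X (vertexMap θ.preserves_inr q)) := by
  unfold BraneComplex.partition
  rw [← θ.isAmalgam.integral_eq_of_isEmpty]
  congr 1
  funext R
  rw [← Fintype.prod_equiv θ.vertexEquiv (fun s => X (θ.vertexEquiv s)
    (Ω.frameInvariant (θ.vertexEquiv s) R)) _ fun s => rfl, Fintype.prod_sum_type]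
  congr 1
  · refine Finset.prod_congr rfl fun q _ => ?_
    congr 1
    exact (frameInvariant_res q _ (linkIsoOfPreserves θ.preserves_inl θ.inl_upper q)
      (RelEmbedding.refl _) θ.inl (Ω₁.linkEmb q) (fun x => rfl) (fun x => rfl) _ R rfl).symm
  · refine Finset.prod_congr rfl fun q _ => ?_
    congr 1
    exact (frameInvariant_res q _ (linkIsoOfPreserves θ.preserves_inr θ.inr_upper q)
      (RelEmbedding.refl _) θ.inr (Ω₂.linkEmb q) (fun x => rfl) (fun x => rfl) _ R rfl).symm

end DisjointUnion

end Multiplicativity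

/-! ### Complexes with two vertices -/

section TwoVertices

variable {𝕂 : Type v} [Field 𝕂] {G : Type w} [Group G] [Finite G] {D : ℕ} {S : Type u}

/-- An embedding of the cone over a poset. -/
def coneMap {P Q : Type*} [PartialOrder P] [PartialOrder Q] (j : P ↪o Q) (q : Q)
    (h : ∀ x, q < j x) : WithBot P ↪o Q :=
  OrderEmbedding.ofMapLEIff (fun x => x.recBotCoe q j) fun x y => by
    induction x using WithBot.recBotCoe with
    | bot =>
      refine iff_of_true ?_ bot_le
      induction y using WithBot.recBotCoe with
      | bot => exact le_rfl
      | coe y => exact (h y).le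
    | coe x =>
      induction y using WithBot.recBotCoe with
      | bot => exact iff_of_false (h x).not_ge (WithBot.not_coe_le_bot x)
      | coe y => exact j.le_iff_le.trans WithBot.coe_le_coe.symm

open Classical in
/-- Sums over the frames of a complex, sorted by the classes of coverings. -/
theorem integral_classFun (c : ConnectedColoredComplex D S) (F : CoveringClass G D S → 𝕂)
    (a : Frame G c.1.Cell → 𝕂) {σ : ColorClass D S} (hσ : Quotient.mk (coloredSetoid D S) c = σ) :
    integral (fun ψ : Frame G c.1.Cell => F (covClass c ψ) * a ψ) =
      ∑ γ : Upsilon G σ, F γ.1 * integral fun ψ : Frame G c.1.Cell =>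
        if covClass c ψ = γ.1 then a ψ else 0 := by
  unfold integral
  simp only [Finset.mul_sum]
  rw [Finset.sum_comm]
  refine Finset.sum_congr rfl fun ψ _ => ?_
  rw [Finset.sum_eq_single ⟨covClass c ψ, hσ⟩]
  · rw [if_pos rfl]
    ring
  · intro γ _ hγ
    rw [if_neg fun h => hγ (Subtype.ext h.symm)]
    simp
  · simp

variable {Ω : BraneComplex (D + 1) S} {p q : Ω.Vertex}

theorem lt_of_two_vertices (hpq : p ≠ q) (h : ∀ r, r = p ∨ r = q) {x : Ω.Cell} (hx : p.1 < x) :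
    q.1 < x := by
  obtain ⟨r, hr, hrx⟩ := SimpleComplex.exists_other_vertex hx
  obtain rfl : r = q := (h r).resolve_left hr
  refine lt_of_le_of_ne hrx fun h' => ?_
  subst h'
  exact hpq (Subtype.ext (SimpleComplex.Vertex.eq_of_le hx.le))

/-- In a complex with two vertices every cell of positive dimension contains both of them, so that
their vertex complexes have the same cells. -/
def twoVertexLinkIso (hpq : p ≠ q) (h : ∀ r, r = p ∨ r = q) :
    (Ω.link p).1.Cell ≃o (Ω.link q).1.Cell where
  toFun x := ⟨x.1, lt_of_two_vertices hpq h x.2⟩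
  invFun x := ⟨x.1, lt_of_two_vertices hpq.symm (fun r => (h r).symm) x.2⟩
  left_inv _ := rfl
  right_inv _ := rfl
  map_rel_iff' := Iff.rfl

theorem isFlag_cons_of_le {d : ℕ} {c : SimpleComplex d} {n : ℕ} {f : Fin (n + 1) → c.Cell}
    {q q' : c.Vertex} (hf : c.IsFlag (n := n + 1) (Fin.cons q.1 f)) (h : q'.1 ≤ f 0) :
    c.IsFlag (n := n + 1) (Fin.cons q'.1 f) := by
  have h1 : c.dim (f 0) = 1 := by simpa using hf.2 1
  constructor
  · refine Fin.strictMono_iff_lt_succ.2 fun i => ?_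
    induction i using Fin.cases with
    | zero =>
      refine lt_of_le_of_ne h fun h' => ?_
      have := q'.2
      have h'' : q'.1 = f 0 := h'
      rw [h''] at this
      omega
    | succ j => exact hf.1 j.succ.castSucc_lt_succ
  · intro i
    induction i using Fin.cases with
    | zero => exact q'.2
    | succ j => exact hf.2 j.succ

/-- Exchanging the first vertex of a flag changes its sign. -/
theorem ori_cons_flip {d : ℕ} {c : ColoredComplex d S} {n : ℕ} {f : Fin (n + 1) → c.Cell}
    {q q' : c.Vertex} (hf : c.IsFlag (n := n + 1) (Fin.cons q.1 f)) (h : q'.1 ≤ f 0)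
    (hne : q ≠ q') : c.ori n (Fin.cons q'.1 f) = - c.ori n (Fin.cons q.1 f) :=
  c.ori_flip n _ _ hf (isFlag_cons_of_le hf h) (by rw [← Fin.succ_last]; rfl)
    ⟨0, fun h' => hne (Subtype.ext h'), fun j hj => by
      induction j using Fin.cases with
      | zero => exact absurd rfl hj
      | succ j => rfl⟩

/-- The vertex complexes of the two vertices are inverse to each other. -/
def twoVertexIso (hpq : p ≠ q) (h : ∀ r, r = p ∨ r = q) :
    ColoredComplex.Iso (Ω.link p).1 (Ω.link q).star.1 :=
  linkStarIsoOf p q (twoVertexLinkIso hpq h) (fun _ => rfl) (fun _ _ _ => rfl)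
    fun _ f hf => ori_cons_flip hf (lt_of_two_vertices hpq h (f 0).2).le hpq

theorem cls_of_two_vertices (hpq : p ≠ q) (h : ∀ r, r = p ∨ r = q) :
    Ω.cls q = (Ω.cls p).star :=
  cls_eq_star_of_iso (twoVertexIso hpq.symm fun r => (h r).symm)

/-- A complex with two vertices is the suspension of the vertex complex, that is, the union of two
cones over it. -/
theorem partition_two_vertices [CharZero 𝕂] (hpq : p ≠ q) (h : ∀ r, r = p ∨ r = q)
    (X : Ω.Vertex → CoveringClass G D S → 𝕂) :
    Ω.partition X = ∑ γ : Upsilon G (Ω.cls p), X p γ.1 * X q γ.1.star * classNorm 𝕂 γ.1 := by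
  classical
  let L := twoVertexLinkIso hpq h
  let jU : WithBot (Ω.link p).1.Cell ↪o Ω.Cell := coneMap (Ω.linkEmb p) p.1 fun x => x.2
  let jV : WithBot (Ω.link p).1.Cell ↪o Ω.Cell :=
    coneMap (Ω.linkEmb p) q.1 fun x => (L x).2
  have hup : ∀ (r : Ω.Vertex) (hr : ∀ x : (Ω.link p).1.Cell, r.1 < Ω.linkEmb p x)
      (hr' : ∀ y, r.1 < y → p.1 < y) (u : WithBot (Ω.link p).1.Cell) (x : Ω.Cell),
      coneMap (Ω.linkEmb p) r.1 hr u ≤ x → ∃ u', coneMap (Ω.linkEmb p) r.1 hr u' = x := by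
    intro r hr hr' u x hx
    have hrx : r.1 ≤ x := by
      refine le_trans ?_ hx
      exact (coneMap (Ω.linkEmb p) r.1 hr).monotone bot_le
    rcases hrx.lt_or_eq with h1 | h1
    · exact ⟨coneEmb (Ω.link p).1.Cell ⟨x, hr' x h1⟩, rfl⟩
    · exact ⟨⊥, h1⟩
  have hqp : ∀ y, q.1 < y → p.1 < y := fun y =>
    lt_of_two_vertices hpq.symm fun r => (h r).symm
  have hA : IsAmalgam jU jV (coneEmb _) (coneEmb _) :=
    { comm := fun x => rfl
      cover := fun x => by
        obtain ⟨r, hr⟩ := SimpleComplex.exists_vertex_le x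
        rcases h r with rfl | rfl
        · exact Or.inl (hup r (fun x => x.2) (fun _ hy => hy) ⊥ x hr)
        · exact Or.inr (hup r (fun x => (L x).2) hqp ⊥ x hr)
      pull := fun u v huv => by
        induction u using WithBot.recBotCoe with
        | bot =>
          exfalso
          have h1 : p.1 = jV v := huv
          have h2 : q.1 ≤ p.1 := by
            rw [h1]
            exact jV.monotone bot_le
          exact hpq (Subtype.ext (SimpleComplex.Vertex.eq_of_le h2).symm)
        | coe u =>
          induction v using WithBot.recBotCoe with
          | bot =>
            exfalso
            have h1 : u.1 = q.1 := huv
            exact (lt_of_two_vertices hpq h u.2).ne' h1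
          | coe v =>
            refine ⟨u, rfl, ?_⟩
            have h1 : u.1 = v.1 := huv
            rw [show u = v from Subtype.ext h1]
            rfl
      upperU := hup p (fun x => x.2) fun _ hy => hy
      upperV := hup q (fun x => (L x).2) hqp }
  have hinv : ∀ R : Frame G Ω.Cell, Ω.frameInvariant q R =
      (covClass (Ω.link p) ((R.res jV).res (coneEmb _))).star := by
    intro R
    exact (star_covClass_eq (twoVertexIso hpq h) _ _ fun x y => rfl).symm
  have huniv : (Finset.univ : Finset Ω.Vertex) = {p, q} := by
    ext r
    simpa using h r
  have h1 : Ω.partition X = integral fun R : Frame G Ω.Cell =>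
      X p (covClass (Ω.link p) ((R.res jU).res (coneEmb _))) *
        X q (covClass (Ω.link p) ((R.res jV).res (coneEmb _))).star := by
    unfold BraneComplex.partition
    congr 1
    funext R
    rw [huniv, Finset.prod_pair hpq, hinv]
    rfl
  rw [h1, hA.integral_eq
    (fun R => X p (covClass (Ω.link p) (R.res (coneEmb _))))
    (fun R => X q (covClass (Ω.link p) (R.res (coneEmb _))).star)]
  simp only [push_coneEmb (fun ψ => X p (covClass (Ω.link p) ψ)),
    push_coneEmb (fun ψ => X q (covClass (Ω.link p) ψ).star)]
  have h2 := integral_classFun (Ω.link p) (fun γ => X p γ * X q γ.star)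
    (fun ψ : Frame G (Ω.link p).1.Cell => coneNumber 𝕂 ψ * coneNumber 𝕂 ψ) (Ω.cls_eq p).symm
  refine Eq.trans ?_ (h2.trans (Finset.sum_congr rfl fun γ _ => ?_))
  · congr 1
    funext ψ
    ring
  · rw [classNorm_eq (Ω.link p) γ.1 γ.2]

end TwoVertices

/-! ### The two sides of a cut -/

section Cut

variable {𝕂 : Type v} [Field 𝕂] {G : Type w} [Group G] [Finite G] {D : ℕ} {S : Type u}

theorem push_trans_iso {I J U : Type*} [PartialOrder I] [PartialOrder J] [PartialOrder U]
    [Finite I] [Finite J] [Finite U] (φ : J ≃o I) (i : I ↪o U) (a : Frame G U → 𝕂)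
    (ψ : Frame G J) :
    push (φ.toOrderEmbedding.trans i) a ψ = push i a (ψ.res φ.symm.toOrderEmbedding) := by
  unfold push
  refine Finset.sum_congr rfl fun R _ => ?_
  have h : R.res (φ.toOrderEmbedding.trans i) = ψ ↔
      R.res i = ψ.res φ.symm.toOrderEmbedding := by
    rw [← Frame.res_res]
    exact (Frame.resEquiv φ).eq_symm_apply.symm
  rw [Frame.weight_res_iso]
  by_cases h1 : R.res (φ.toOrderEmbedding.trans i) = ψ
  · rw [if_pos h1, if_pos (h.1 h1)]
  · rw [if_neg h1, if_neg fun h2 => h1 (h.2 h2)]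

/-- One of the two sides of a cut complex: the cells that meet `A` and the point to which the
copy of the cut on the side of `A` is contracted. -/
structure CutSide (Ω Ω' : BraneComplex (D + 1) S) (A : Set Ω.Vertex) where
  emb : {x // Ω.Meets A x} ↪o Ω'.Cell
  point : Ω'.Vertex
  upper : ∀ x y, emb x ≤ y → y ∈ Set.range emb
  point_le : ∀ x, point.1 ≤ emb x ↔ x.1 ∈ Ω.crossing A
  point_upper : ∀ y, point.1 < y → y ∈ Set.range emb
  ne : ∀ x, emb x ≠ point.1
  dim : ∀ x, Ω'.dim (emb x) = Ω.dim x.1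
  color : ∀ x h h', Ω'.color ⟨emb x, h'⟩ = Ω.color ⟨x.1, h⟩
  ori : ∀ (n : ℕ) (f : Fin (n + 2) → {x // Ω.Meets A x}), Ω.IsFlag (fun i => (f i).1) →
    Ω'.ori n (emb ∘ f) = Ω.ori n fun i => (f i).1

theorem CyclicComplex.crossing_compl {d : ℕ} (Ω : CyclicComplex d S) (A : Set Ω.Vertex) :
    Ω.crossing Aᶜ = Ω.crossing A := by
  unfold CyclicComplex.crossing
  rw [compl_compl]
  ext x
  exact and_comm

namespace CutCells

variable {Ω Ω' : BraneComplex (D + 1) S} (η : CutCells Ω Ω')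

theorem left_upper (x : {x // Ω.Meets η.A x}) (y : Ω'.Cell) (h : η.left x ≤ y) :
    y ∈ Set.range η.left := by
  rcases η.cover y with h' | ⟨z, rfl⟩ | rfl | rfl
  · exact h'
  · exact absurd h (η.not_left_le_right x z)
  · exact absurd (SimpleComplex.Vertex.eq_of_le h) (η.left_ne x).1
  · exact absurd (SimpleComplex.Vertex.eq_of_le h) (η.left_ne x).2

theorem right_upper (x : {x // Ω.Meets η.Aᶜ x}) (y : Ω'.Cell) (h : η.right x ≤ y) :
    y ∈ Set.range η.right := by
  rcases η.cover y with ⟨z, rfl⟩ | h' | rfl | rfl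
  · exact absurd h (η.not_right_le_left z x)
  · exact h'
  · exact absurd (SimpleComplex.Vertex.eq_of_le h) (η.right_ne x).1
  · exact absurd (SimpleComplex.Vertex.eq_of_le h) (η.right_ne x).2

/-- The side of the point `plus`. -/
def leftSide : CutSide Ω Ω' η.A where
  emb := η.left
  point := η.plus
  upper := η.left_upper
  point_le := η.plus_le_left
  point_upper y h := by
    rcases η.cover y with h' | ⟨z, rfl⟩ | rfl | rfl
    · exact h'
    · exact absurd h.le (η.not_plus_le_right z)
    · exact absurd rfl h.ne
    · exact absurd (SimpleComplex.Vertex.eq_of_le h.le) h.ne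
  ne x := (η.left_ne x).1
  dim := η.dim_left
  color := η.color_left
  ori := η.ori_left

/-- The side of the point `minus`. -/
def rightSide : CutSide Ω Ω' η.Aᶜ where
  emb := η.right
  point := η.minus
  upper := η.right_upper
  point_le x := by
    rw [Ω.crossing_compl]
    exact η.minus_le_right x
  point_upper y h := by
    rcases η.cover y with ⟨z, rfl⟩ | h' | rfl | rfl
    · exact absurd h.le (η.not_minus_le_left z)
    · exact h'
    · exact absurd (SimpleComplex.Vertex.eq_of_le h.le) h.ne
    · exact absurd rfl h.ne
  ne x := (η.right_ne x).2
  dim := η.dim_right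
  color := η.color_right
  ori := η.ori_right

theorem vert_of_mem {q : Ω.Vertex} (h : q ∈ η.A) :
    (η.vert q).1 = η.left ⟨q.1, q, h, le_rfl⟩ := by
  unfold vert
  rw [dif_pos h]

theorem vert_of_notMem {q : Ω.Vertex} (h : q ∉ η.A) :
    (η.vert q).1 = η.right ⟨q.1, q, h, le_rfl⟩ := by
  unfold vert
  rw [dif_neg h]

theorem vert_injective : Function.Injective η.vert := by
  intro q r h
  have h' := congrArg Subtype.val h
  by_cases hq : q ∈ η.A <;> by_cases hr : r ∈ η.A
  · rw [η.vert_of_mem hq, η.vert_of_mem hr] at h'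
    have h2 := congrArg Subtype.val (η.left.injective h')
    exact Subtype.ext h2
  · rw [η.vert_of_mem hq, η.vert_of_notMem hr] at h'
    exact absurd h'.le (η.not_left_le_right _ _)
  · rw [η.vert_of_notMem hq, η.vert_of_mem hr] at h'
    exact absurd h'.le (η.not_right_le_left _ _)
  · rw [η.vert_of_notMem hq, η.vert_of_notMem hr] at h'
    have h2 := congrArg Subtype.val (η.right.injective h')
    exact Subtype.ext h2

theorem vert_ne_plus (q : Ω.Vertex) : η.vert q ≠ η.plus := by
  intro h
  have h' := congrArg Subtype.val h
  by_cases hq : q ∈ η.A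
  · rw [η.vert_of_mem hq] at h'
    exact (η.left_ne _).1 h'
  · rw [η.vert_of_notMem hq] at h'
    exact (η.right_ne _).1 h'

theorem vert_ne_minus (q : Ω.Vertex) : η.vert q ≠ η.minus := by
  intro h
  have h' := congrArg Subtype.val h
  by_cases hq : q ∈ η.A
  · rw [η.vert_of_mem hq] at h'
    exact (η.left_ne _).2 h'
  · rw [η.vert_of_notMem hq] at h'
    exact (η.right_ne _).2 h'

theorem meets_vertex {A : Set Ω.Vertex} {x : Ω.Cell} (hx : Ω.dim x = 0) (h : Ω.Meets A x) :
    (⟨x, hx⟩ : Ω.Vertex) ∈ A := by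
  obtain ⟨a, ha, hax⟩ := h
  have : a = ⟨x, hx⟩ :=
    Subtype.ext (SimpleComplex.Vertex.eq_of_le (p := (⟨x, hx⟩ : Ω.Vertex)) hax)
  exact this ▸ ha

theorem vertex_cases (q' : Ω'.Vertex) : q' = η.plus ∨ q' = η.minus ∨ ∃ q, η.vert q = q' := by
  obtain ⟨y, hy⟩ := q'
  rcases η.cover y with ⟨x, rfl⟩ | ⟨x, rfl⟩ | h | h
  · have hx := (η.dim_left x).symm.trans hy
    refine Or.inr (Or.inr ⟨⟨x.1, hx⟩, Subtype.ext ?_⟩)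
    rw [η.vert_of_mem (meets_vertex hx x.2)]
  · have hx := (η.dim_right x).symm.trans hy
    refine Or.inr (Or.inr ⟨⟨x.1, hx⟩, Subtype.ext ?_⟩)
    rw [η.vert_of_notMem (meets_vertex hx x.2)]
  · exact Or.inl (Subtype.ext h)
  · exact Or.inr (Or.inl (Subtype.ext h))

theorem prod_vertex (g : Ω'.Vertex → 𝕂) :
    ∏ q', g q' = g η.plus * (g η.minus * ∏ q, g (η.vert q)) := by
  classical
  have h : (Finset.univ : Finset Ω'.Vertex) =
      insert η.plus (insert η.minus (Finset.univ.image η.vert)) := by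
    ext q'
    simpa using η.vertex_cases q'
  rw [h, Finset.prod_insert, Finset.prod_insert, Finset.prod_image]
  · exact fun q _ r _ h => η.vert_injective h
  · simpa using η.vert_ne_minus
  · simpa [η.plus_ne_minus] using η.vert_ne_plus

end CutCells

namespace CutSide

variable {Ω Ω' : BraneComplex (D + 1) S} {A B : Set Ω.Vertex} (s : CutSide Ω Ω' A)
  (t : CutSide Ω Ω' B)

/-- The cells of the vertex complex of the new point correspond to the cells that cross the
cut. -/
def crossEmb : (Ω'.link s.point).1.Cell ↪o {x // Ω.Meets A x} :=
  have h := fun x : (Ω'.link s.point).1.Cell => (s.point_upper x.1 x.2).choose_spec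
  OrderEmbedding.ofMapLEIff (fun x => (s.point_upper x.1 x.2).choose) fun x y => by
    rw [← s.emb.le_iff_le, h x, h y]
    rfl

theorem emb_crossEmb (x : (Ω'.link s.point).1.Cell) : s.emb (s.crossEmb x) = x.1 :=
  (s.point_upper x.1 x.2).choose_spec

theorem crossEmb_mem (x : (Ω'.link s.point).1.Cell) : (s.crossEmb x).1 ∈ Ω.crossing A := by
  rw [← s.point_le, s.emb_crossEmb]
  exact le_of_lt x.2

theorem exists_crossEmb (u : {x // Ω.Meets A x}) (h : u.1 ∈ Ω.crossing A) :
    ∃ x, s.crossEmb x = u := by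
  have h' : s.point.1 < s.emb u := lt_of_le_of_ne ((s.point_le u).2 h) (Ne.symm (s.ne u))
  exact ⟨⟨s.emb u, h'⟩, s.emb.injective (s.emb_crossEmb _)⟩

/-- The cells of one side of the cut complex. -/
abbrev Part : Type := {y : Ω'.Cell // y = s.point.1 ∨ y ∈ Set.range s.emb}

/-- The cells that meet `A`, as cells of the side of `A`. -/
def embPart : {x // Ω.Meets A x} ↪o s.Part :=
  OrderEmbedding.ofMapLEIff (fun x => ⟨s.emb x, Or.inr ⟨x, rfl⟩⟩) fun _ _ => s.emb.le_iff_le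

/-- The cells of the vertex complex of the new point, as cells of the side of this point. -/
def linkPart : (Ω'.link s.point).1.Cell ↪o s.Part :=
  OrderEmbedding.ofMapLEIff (fun x => ⟨x.1, Or.inr ⟨_, s.emb_crossEmb x⟩⟩) fun _ _ => Iff.rfl

theorem isAmalgam : IsAmalgam s.embPart
    (coneMap s.linkPart ⟨s.point.1, Or.inl rfl⟩ fun x => x.2) s.crossEmb (coneEmb _) := by
  have hup : ∀ y : s.Part, s.point.1 ≤ y.1 →
      ∃ v, coneMap s.linkPart ⟨s.point.1, Or.inl rfl⟩ (fun x => x.2) v = y := by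
    intro y hy
    rcases hy.lt_or_eq with h | h
    · exact ⟨coneEmb (Ω'.link s.point).1.Cell ⟨y.1, h⟩, rfl⟩
    · exact ⟨⊥, Subtype.ext h⟩
  refine
    { comm := fun x => Subtype.ext (s.emb_crossEmb x)
      cover := fun y => ?_
      pull := fun u v huv => ?_
      upperU := fun u y h => ?_
      upperV := fun v y h => hup y ?_ }
  · rcases y.2 with h | ⟨u, hu⟩
    · exact Or.inr (hup y h.ge)
    · exact Or.inl ⟨u, Subtype.ext hu⟩
  · induction v using WithBot.recBotCoe with
    | bot => exact absurd (congrArg Subtype.val huv) (s.ne u)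
    | coe x =>
      refine ⟨x, s.emb.injective ?_, rfl⟩
      rw [s.emb_crossEmb]
      exact (congrArg Subtype.val huv).symm
  · obtain ⟨u', hu'⟩ := s.upper u y.1 h
    exact ⟨u', Subtype.ext hu'⟩
  · refine le_trans ?_ h
    exact (coneMap s.linkPart ⟨s.point.1, Or.inl rfl⟩ fun x => x.2).monotone bot_le

theorem integral_part [CharZero 𝕂] (a : Frame G {x // Ω.Meets A x} → 𝕂)
    (c : Frame G (Ω'.link s.point).1.Cell → 𝕂) :
    integral (fun R : Frame G s.Part => a (R.res s.embPart) * c (R.res s.linkPart)) =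
      integral fun ψ : Frame G (Ω'.link s.point).1.Cell =>
        push s.crossEmb a ψ * (coneNumber 𝕂 ψ * c ψ) := by
  have := s.isAmalgam.integral_eq a (fun R => c (R.res (coneEmb _)))
  simp only [push_coneEmb] at this
  exact this

/-- The cells of the vertex complex of a vertex in `A`, as cells that meet `A`. -/
def linkU (q : Ω.Vertex) (h : q ∈ A) : (Ω.link q).1.Cell ↪o {x // Ω.Meets A x} :=
  OrderEmbedding.ofMapLEIff (fun x => ⟨x.1, q, h, le_of_lt x.2⟩) fun _ _ => Iff.rfl

/-- The vertex complexes of the old vertices are unchanged by the cut. -/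
def linkIso (q : Ω.Vertex) (h : q ∈ A) (q' : Ω'.Vertex)
    (hq' : q'.1 = s.emb ⟨q.1, q, h, le_rfl⟩) :
    ColoredComplex.Iso (Ω.link q).1 (Ω'.link q').1 :=
  linkIsoOf q q'
    (RelIso.ofSurjective
      (OrderEmbedding.ofMapLEIff (fun x : (Ω.link q).1.Cell =>
        (⟨s.emb (linkU q h x), by
          rw [hq']
          exact s.emb.strictMono x.2⟩ : (Ω'.link q').1.Cell))
        fun x y => s.emb.le_iff_le)
      (by
        rintro ⟨y, hy⟩
        have hy' := hy
        rw [hq'] at hy'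
        obtain ⟨x, rfl⟩ := s.upper _ _ hy'.le
        exact ⟨⟨x.1, s.emb.lt_iff_lt.1 hy'⟩, rfl⟩))
    (fun x => s.dim _)
    (fun x h1 h2 => s.color _ _ _)
    (fun n f hf => by
      have h1 := s.ori (n + 1) (Fin.cons ⟨q.1, q, h, le_rfl⟩ fun i => linkU q h (f i)) (by
        convert hf using 1
        exact (cons_comp_val Subtype.val _ _).symm)
      rw [← cons_comp_val s.emb, ← hq'] at h1
      refine h1.trans ?_
      congr 1
      exact (cons_comp_val Subtype.val _ _).symm)

open Classical in
/-- The product of functions of the local invariants at the vertices in `A`, as a function of the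
restriction of a covering to the cells that meet `A`. -/
def sideFun (X : Ω.Vertex → CoveringClass G D S → 𝕂) (R : Frame G {x // Ω.Meets A x}) : 𝕂 :=
  ∏ q, if h : q ∈ A then X q (covClass (Ω.link q) (R.res (linkU q h))) else 1

theorem sideFun_gaugeInvariant (X : Ω.Vertex → CoveringClass G D S → 𝕂) :
    GaugeInvariant (sideFun (A := A) X) := by
  refine GaugeInvariant.prod fun q _ t R => ?_
  split_ifs with h
  · rw [Frame.res_smul, covClass_smul]
  · rfl

/-- The orientations of the vertex complex of the new point, in terms of a vertex `a` on the same
side: the flags that start at the new point and at `a` have opposite signs. -/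
theorem ori_cons {n : ℕ} (f : Fin (n + 2) → (Ω'.link s.point).1.Cell)
    (hf : Ω'.IsFlag (n := n + 2) (Fin.cons s.point.1 fun i => (f i).1)) (a : Ω.Vertex)
    (ha : a ∈ A) (hle : a.1 ≤ (s.crossEmb (f 0)).1) :
    Ω'.ori (n + 1) (Fin.cons s.point.1 fun i => (f i).1) =
      - Ω.ori (n + 1) (Fin.cons a.1 fun i => (s.crossEmb (f i)).1) ∧
    Ω.IsFlag (n := n + 2) (Fin.cons a.1 fun i => (s.crossEmb (f i)).1) := by
  let u : {x // Ω.Meets A x} := ⟨a.1, a, ha, le_rfl⟩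
  let a' : Ω'.Vertex := ⟨s.emb u, (s.dim u).trans a.2⟩
  have hle' : a'.1 ≤ (f 0).1 := by
    rw [← s.emb_crossEmb]
    exact s.emb.monotone hle
  have hf' := isFlag_cons_of_le (q' := a') hf hle'
  have hg : (Fin.cons a'.1 fun i => (f i).1 : Fin (n + 3) → Ω'.Cell) =
      s.emb ∘ Fin.cons u fun i => s.crossEmb (f i) := by
    rw [← cons_comp_val]
    congr 1
    funext i
    exact (s.emb_crossEmb (f i)).symm
  have hv : (Fin.cons a.1 fun i => (s.crossEmb (f i)).1 : Fin (n + 3) → Ω.Cell) =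
      fun i => ((Fin.cons u fun i => s.crossEmb (f i) : Fin (n + 3) → _) i).1 :=
    cons_comp_val Subtype.val u _
  have hflag : Ω.IsFlag (n := n + 2)
      fun i => ((Fin.cons u fun i => s.crossEmb (f i) : Fin (n + 3) → _) i).1 := by
    rw [hg] at hf'
    refine ⟨fun i j hij => s.emb.lt_iff_lt.1 (hf'.1 hij), fun i => ?_⟩
    rw [← s.dim]
    exact hf'.2 i
  rw [hv]
  refine ⟨?_, hflag⟩
  rw [← s.ori (n + 1) _ hflag, ← hg,
    ori_cons_flip (q' := a') hf hle' fun h => s.ne u (congrArg Subtype.val h).symm, neg_neg]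

/-- The vertex complexes of the two new points have the same cells. -/
def crossIso (h : Ω.crossing A = Ω.crossing B) :
    (Ω'.link s.point).1.Cell ≃o (Ω'.link t.point).1.Cell :=
  have hB : ∀ x, Ω.Meets B (s.crossEmb x).1 := fun x => by
    have := s.crossEmb_mem x
    rw [h] at this
    exact this.1
  have hex := fun x => t.exists_crossEmb ⟨_, hB x⟩ (h ▸ s.crossEmb_mem x)
  have hc := fun x => (hex x).choose_spec
  RelIso.ofSurjective
    (OrderEmbedding.ofMapLEIff (fun x => (hex x).choose) fun x y => by
      rw [← t.crossEmb.le_iff_le, hc x, hc y]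
      exact s.crossEmb.le_iff_le)
    (fun y => by
      have hA : Ω.Meets A (t.crossEmb y).1 := by
        have := t.crossEmb_mem y
        rw [← h] at this
        exact this.1
      obtain ⟨x, hx⟩ := s.exists_crossEmb ⟨_, hA⟩ (by rw [h]; exact t.crossEmb_mem y)
      refine ⟨x, t.crossEmb.injective ((hc x).trans (Subtype.ext ?_))⟩
      change (s.crossEmb x).1 = _
      rw [hx])

theorem crossEmb_crossIso (h : Ω.crossing A = Ω.crossing B) (x : (Ω'.link s.point).1.Cell) :
    (t.crossEmb (s.crossIso t h x)).1 = (s.crossEmb x).1 := by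
  have hB : Ω.Meets B (s.crossEmb x).1 := by
    have := s.crossEmb_mem x
    rw [h] at this
    exact this.1
  exact congrArg Subtype.val
    (t.exists_crossEmb ⟨_, hB⟩ (h ▸ s.crossEmb_mem x)).choose_spec

/-- The vertex complexes of the two new points are inverse to each other. -/
def starIso (h : Ω.crossing A = Ω.crossing B) (hAB : Disjoint A B) :
    ColoredComplex.Iso (Ω'.link s.point).1 (Ω'.link t.point).star.1 :=
  linkStarIsoOf s.point t.point (s.crossIso t h)
    (fun x => by
      rw [← t.emb_crossEmb, t.dim, s.crossEmb_crossIso, ← s.dim, s.emb_crossEmb])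
    (fun x h1 h2 => by
      have key : ∀ (y : Ω'.Cell) (hy : 0 < Ω'.dim y) (z : Ω'.Cell) (hz : 0 < Ω'.dim z)
          (u : {x // Ω.Meets A x}) (v : {x // Ω.Meets B x}), s.emb u = y → t.emb v = z →
          v.1 = u.1 → Ω'.color ⟨z, hz⟩ = Ω'.color ⟨y, hy⟩ := by
        rintro _ hy _ hz ⟨u, hu⟩ ⟨v, hv⟩ rfl rfl rfl
        rw [s.color _ ((s.dim _).symm ▸ hy), t.color _ ((t.dim _).symm ▸ hz)]
      exact key _ _ _ _ _ _ (s.emb_crossEmb x) (t.emb_crossEmb _) (s.crossEmb_crossIso t h x))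
    (fun n f hf => by
      obtain ⟨a, ha, hax⟩ := (s.crossEmb (f 0)).2
      obtain ⟨b, hb, hbx⟩ := (t.crossEmb (s.crossIso t h (f 0))).2
      have hne : a ≠ b := fun hab => Set.disjoint_left.1 hAB ha (hab ▸ hb)
      obtain ⟨h1, hflag⟩ := s.ori_cons f hf a ha hax
      have hf2 : Ω'.IsFlag (n := n + 2)
          (Fin.cons t.point.1 fun i => (s.crossIso t h (f i)).1) := by
        refine Ω'.isFlag_cons (fun i j hij => ?_) fun i => ?_
        · refine (s.crossIso t h).strictMono ?_
          have := hf.1 (Fin.succ_lt_succ_iff.2 hij)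
          exact this
        · have h3 := hf.2 i.succ
          rw [Fin.cons_succ, ← s.emb_crossEmb, s.dim] at h3
          rw [← t.emb_crossEmb, t.dim, s.crossEmb_crossIso, h3]
          simp
      obtain ⟨h2, -⟩ := t.ori_cons (fun i => s.crossIso t h (f i)) hf2 b hb hbx
      simp only [s.crossEmb_crossIso t h] at h2 hbx
      rw [h2, h1, neg_neg, ori_cons_flip hflag hbx hne, neg_neg])

end CutSide

namespace CutCells

variable {Ω Ω' : BraneComplex (D + 1) S} (η : CutCells Ω Ω')

/-- The cells of the vertex complexes of `plus` and `minus`. -/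
def crossIso : (Ω'.link η.plus).1.Cell ≃o (Ω'.link η.minus).1.Cell :=
  η.leftSide.crossIso η.rightSide (Ω.crossing_compl η.A).symm

/-- The vertex complexes of `plus` and `minus` are inverse to each other. -/
def starIso : ColoredComplex.Iso (Ω'.link η.plus).1 (Ω'.link η.minus).star.1 :=
  η.leftSide.starIso η.rightSide (Ω.crossing_compl η.A).symm disjoint_compl_right

theorem cls_minus : Ω'.cls η.minus = (Ω'.cls η.plus).star := by
  rw [cls_eq_star_of_iso η.starIso, ColorClass.star_star]

theorem nonempty_linkIso (q : Ω.Vertex) :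
    Nonempty (ColoredComplex.Iso (Ω.link q).1 (Ω'.link (η.vert q)).1) := by
  by_cases h : q ∈ η.A
  · exact ⟨η.leftSide.linkIso q h _ (η.vert_of_mem h)⟩
  · exact ⟨η.rightSide.linkIso q h _ (η.vert_of_notMem h)⟩

theorem cls_vert (q : Ω.Vertex) : Ω.cls q = Ω'.cls (η.vert q) := by
  obtain ⟨φ⟩ := η.nonempty_linkIso q
  exact cls_eq_of_iso φ

/-- The cells of the vertex complex of `plus`, as cells that meet `A`. -/
def leftEmb : (Ω'.link η.plus).1.Cell ↪o {x // Ω.Meets η.A x} := η.leftSide.crossEmb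

/-- The cells of the vertex complex of `minus`, as cells that meet the complement of `A`. -/
def rightEmb : (Ω'.link η.minus).1.Cell ↪o {x // Ω.Meets η.Aᶜ x} := η.rightSide.crossEmb

/-- The cells of `Ω` that meet `A` and those that meet the complement are upper sets that
intersect in the cut. -/
theorem isAmalgam : IsAmalgam (OrderEmbedding.subtype (Ω.Meets η.A))
    (OrderEmbedding.subtype (Ω.Meets η.Aᶜ)) η.leftEmb
    (η.crossIso.toOrderEmbedding.trans η.rightEmb) where
  comm x := (η.leftSide.crossEmb_crossIso η.rightSide _ x).symm
  cover x := by
    obtain ⟨p, hp⟩ := SimpleComplex.exists_vertex_le x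
    by_cases h : p ∈ η.A
    · exact Or.inl ⟨⟨x, p, h, hp⟩, rfl⟩
    · exact Or.inr ⟨⟨x, p, h, hp⟩, rfl⟩
  pull u v huv := by
    have huv' : u.1 = v.1 := huv
    obtain ⟨x, rfl⟩ := η.leftSide.exists_crossEmb u ⟨u.2, huv' ▸ v.2⟩
    refine ⟨x, rfl, Subtype.ext ?_⟩
    rw [← huv']
    exact η.leftSide.crossEmb_crossIso η.rightSide _ x
  upperU u x h := by
    obtain ⟨a, ha, hau⟩ := u.2
    exact ⟨⟨x, a, ha, hau.trans h⟩, rfl⟩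
  upperV u x h := by
    obtain ⟨a, ha, hau⟩ := u.2
    exact ⟨⟨x, a, ha, hau.trans h⟩, rfl⟩

theorem isAmalgam_sides : IsAmalgam
    (OrderEmbedding.subtype fun y => y = η.plus.1 ∨ y ∈ Set.range η.left)
    (OrderEmbedding.subtype fun y => y = η.minus.1 ∨ y ∈ Set.range η.right)
    (emptyEmb _) (emptyEmb _) where
  comm x := x.elim0
  cover y := by
    rcases η.cover y with h | h | h | h
    · exact Or.inl ⟨⟨y, Or.inr h⟩, rfl⟩
    · exact Or.inr ⟨⟨y, Or.inr h⟩, rfl⟩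
    · exact Or.inl ⟨⟨y, Or.inl h⟩, rfl⟩
    · exact Or.inr ⟨⟨y, Or.inl h⟩, rfl⟩
  pull := by
    rintro ⟨u, hu⟩ ⟨v, hv⟩ huv
    have huv' : u = v := huv
    subst huv'
    exfalso
    rcases hu with hu | ⟨x, rfl⟩ <;> rcases hv with hv | ⟨y, hy⟩
    · exact η.plus_ne_minus (Subtype.ext (hu.symm.trans hv))
    · exact (η.right_ne y).1 (hy.trans hu)
    · exact (η.left_ne x).2 hv
    · exact η.not_right_le_left x y hy.le
  upperU := by
    rintro ⟨u, hu⟩ x h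
    have h' : u ≤ x := h
    refine ⟨⟨x, ?_⟩, rfl⟩
    rcases hu with rfl | ⟨y, rfl⟩
    · rcases h'.lt_or_eq with h1 | h1
      · exact Or.inr (η.leftSide.point_upper x h1)
      · exact Or.inl h1.symm
    · exact Or.inr (η.left_upper y x h')
  upperV := by
    rintro ⟨u, hu⟩ x h
    have h' : u ≤ x := h
    refine ⟨⟨x, ?_⟩, rfl⟩
    rcases hu with rfl | ⟨y, rfl⟩
    · rcases h'.lt_or_eq with h1 | h1
      · exact Or.inr (η.rightSide.point_upper x h1)
      · exact Or.inl h1.symm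
    · exact Or.inr (η.right_upper y x h')

/-- The contribution of the side of `plus` to the sums over coverings. -/
def leftFun (X : Ω.Vertex → CoveringClass G D S → 𝕂) :
    Frame G (Ω'.link η.plus).1.Cell → 𝕂 :=
  push η.leftEmb (CutSide.sideFun X)

/-- The contribution of the side of `minus` to the sums over coverings, as a function on the
frames on the vertex complex of `plus`. -/
def rightFun (X : Ω.Vertex → CoveringClass G D S → 𝕂) :
    Frame G (Ω'.link η.plus).1.Cell → 𝕂 :=
  push (η.crossIso.toOrderEmbedding.trans η.rightEmb) (CutSide.sideFun X)

theorem partition_eq_integral [CharZero 𝕂] (X : Ω.Vertex → CoveringClass G D S → 𝕂) :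
    Ω.partition X = integral fun ψ => η.leftFun X ψ * η.rightFun X ψ := by
  unfold leftFun rightFun
  rw [← η.isAmalgam.integral_eq]
  unfold BraneComplex.partition
  congr 1
  funext R
  unfold CutSide.sideFun
  rw [← Finset.prod_mul_distrib]
  refine Finset.prod_congr rfl fun q _ => ?_
  by_cases h : q ∈ η.A
  · have h' : q ∉ η.Aᶜ := fun h' => h' h
    rw [dif_pos h, dif_neg h', mul_one]
    rfl
  · have h' : q ∈ η.Aᶜ := h
    rw [dif_neg h, dif_pos h', one_mul]
    rfl

theorem frameInvariant_vert_left (q : Ω.Vertex) (h : q ∈ η.A) (R : Frame G Ω'.Cell) :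
    Ω'.frameInvariant (η.vert q) R =
      covClass (Ω.link q) ((R.res η.left).res (CutSide.linkU q h)) := by
  unfold BraneComplex.frameInvariant
  rw [← covClass_res (η.leftSide.linkIso q h _ (η.vert_of_mem h))]
  rfl

theorem frameInvariant_vert_right (q : Ω.Vertex) (h : q ∈ η.Aᶜ) (R : Frame G Ω'.Cell) :
    Ω'.frameInvariant (η.vert q) R =
      covClass (Ω.link q) ((R.res η.right).res (CutSide.linkU q h)) := by
  unfold BraneComplex.frameInvariant
  rw [← covClass_res (η.rightSide.linkIso q h _ (η.vert_of_notMem h))]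
  rfl

/-- The cut complex is the disjoint union of its two sides, each of which is glued from cells of
`Ω` and a cone over the cut. -/
theorem partition_cut_eq_integral [CharZero 𝕂] (X : Ω.Vertex → CoveringClass G D S → 𝕂)
    (X' : Ω'.Vertex → CoveringClass G D S → 𝕂) (hX : ∀ q, X' (η.vert q) = X q) :
    Ω'.partition X' =
      (integral fun ψ => η.leftFun X ψ *
        (coneNumber 𝕂 ψ * X' η.plus (covClass (Ω'.link η.plus) ψ))) *
      integral fun ψ => η.rightFun X ψ *
        (coneNumber 𝕂 ψ * X' η.minus (covClass (Ω'.link η.plus) ψ).star) := by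
  have h1 := η.leftSide.integral_part (CutSide.sideFun X)
    (fun ψ => X' η.plus (covClass (Ω'.link η.plus) ψ))
  have h2 := η.rightSide.integral_part (CutSide.sideFun X)
    (fun ψ => X' η.minus (covClass (Ω'.link η.minus) ψ))
  have h3 : integral (fun ψ => η.rightFun X ψ *
        (coneNumber 𝕂 ψ * X' η.minus (covClass (Ω'.link η.plus) ψ).star)) =
      integral fun ψ : Frame G (Ω'.link η.minus).1.Cell =>
        push η.rightEmb (CutSide.sideFun X) ψ *
          (coneNumber 𝕂 ψ * X' η.minus (covClass (Ω'.link η.minus) ψ)) := by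
    rw [← integral_res_iso η.crossIso.symm]
    congr 1
    funext ψ
    unfold rightFun
    rw [push_trans_iso, coneNumber_res_iso, star_covClass_eq η.starIso ψ
      (ψ.res η.crossIso.symm.toOrderEmbedding)]
    intro x y
    change ψ.arr x y = ψ.arr (η.crossIso.symm (η.crossIso x)) (η.crossIso.symm (η.crossIso y))
    simp
  rw [h3]
  refine Eq.trans ?_ (congrArg₂ (· * ·) h1 h2)
  refine Eq.trans ?_ (η.isAmalgam_sides.integral_eq_of_isEmpty _ _)
  unfold BraneComplex.partition
  congr 1
  funext R
  rw [η.prod_vertex]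
  have h4 : ∏ q, X' (η.vert q) (Ω'.frameInvariant (η.vert q) R) =
      CutSide.sideFun X (R.res η.left) * CutSide.sideFun X (R.res η.right) := by
    unfold CutSide.sideFun
    rw [← Finset.prod_mul_distrib]
    refine Finset.prod_congr rfl fun q _ => ?_
    rw [hX]
    by_cases h : q ∈ η.A
    · have h' : q ∉ η.Aᶜ := fun h' => h' h
      rw [dif_pos h, dif_neg h', mul_one, η.frameInvariant_vert_left q h]
    · have h' : q ∈ η.Aᶜ := h
      rw [dif_neg h, dif_pos h', one_mul, η.frameInvariant_vert_right q h']
  rw [h4]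
  have h5 : ∀ a b c d : 𝕂, a * (b * (c * d)) = c * a * (d * b) := fun a b c d => by ring
  exact h5 _ _ _ _

open Classical in
/-- The sum over the coverings of a complex in terms of the coverings of the cut complex. Over the
class `γ` the cut complex gives the product of the integrals of the contributions of the two sides,
each with a factor `coneNumber`, and by `integral_mul_integral` this is the integral of the product
of the contributions times `classNorm γ`. -/
theorem partition_eq_sum [CharZero 𝕂] (X : Ω.Vertex → CoveringClass G D S → 𝕂)
    (X' : Ω'.Vertex → CoveringClass G D S → 𝕂) (hX : ∀ q, X' (η.vert q) = X q) :
    Ω.partition X = ∑ γ : Upsilon G (Ω'.cls η.plus), (classNorm 𝕂 γ.1)⁻¹ *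
      Ω'.partition (Function.update (Function.update X' η.plus (classFun (Finsupp.single γ 1)))
        η.minus (classFun (Finsupp.single γ.star 1))) := by
  have h1 := integral_classFun (Ω'.link η.plus) (fun _ => (1 : 𝕂))
    (fun ψ => η.leftFun X ψ * η.rightFun X ψ) (Ω'.cls_eq η.plus).symm
  simp only [one_mul] at h1
  rw [η.partition_eq_integral, h1]
  refine Finset.sum_congr rfl fun γ _ => ?_
  rw [η.partition_cut_eq_integral X]
  · have hstar : ∀ ψ : Frame G (Ω'.link η.plus).1.Cell,
        (covClass (Ω'.link η.plus) ψ).star = γ.1.star ↔ covClass (Ω'.link η.plus) ψ = γ.1 :=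
      fun ψ => ⟨fun h => by
        rw [← CoveringClass.star_star (covClass (Ω'.link η.plus) ψ), h,
          CoveringClass.star_star], fun h => by rw [h]⟩
    simp only [Function.update_self, Function.update_of_ne η.plus_ne_minus, classFun_single,
      Upsilon.star, hstar, mul_ite, mul_one, mul_zero]
    rw [integral_mul_integral, ← classNorm_eq (Ω'.link η.plus) γ.1 γ.2, mul_comm, mul_assoc,
      mul_inv_cancel₀ (classNorm_ne_zero _), mul_one]
    · exact GaugeInvariant.push _ (CutSide.sideFun_gaugeInvariant X)
    · exact fun t ψ => coneNumber_smul t ψ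
  · intro q
    rw [Function.update_of_ne (η.vert_ne_minus q), Function.update_of_ne (η.vert_ne_plus q), hX]

end CutCells

end Cut

/-! ### Hurwitz numbers form a brane topological field theory -/

section Theory

variable {𝕂 : Type v} [Field 𝕂] [CharZero 𝕂] {G : Type w} [Group G] [Finite G] {D : ℕ}
  {S : Type u}

/-- The map of vertices of an isomorphism of brane complexes. -/
def BraneIso.vertexEquiv {Ω Ω' : BraneComplex (D + 1) S} (φ : BraneIso Ω Ω') :
    Ω.Vertex ≃ Ω'.Vertex :=
  Equiv.ofBijective (vertexMap φ.preserves) (by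
    constructor
    · intro q r h
      exact Subtype.ext (φ.cell.injective (congrArg Subtype.val h))
    · rintro ⟨y, hy⟩
      obtain ⟨x, rfl⟩ := φ.cell.surjective y
      exact ⟨⟨x, (φ.preserves.dim x).symm.trans hy⟩, rfl⟩)

/-- The isomorphisms of vertex complexes given by an isomorphism of brane complexes. -/
def BraneIso.linkIso {Ω Ω' : BraneComplex (D + 1) S} (φ : BraneIso Ω Ω') (q : Ω.Vertex) :
    ColoredComplex.Iso (Ω.link q).1 (Ω'.link (φ.vertexEquiv q)).1 :=
  linkIsoOfPreserves (j := φ.cell.toOrderEmbedding) φ.preserves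
    (fun _ y _ => φ.cell.surjective y) q

omit [CharZero 𝕂] in
open Classical in
theorem insertPair_tmul {ι : Type*} {M : ι → Type w} [∀ i, AddCommGroup (M i)]
    [∀ i, Module 𝕂 (M i)] (x : ∀ i, M i) (p q : ι) (hpq : p ≠ q) (y : M p) (z : M q) :
    insertPair (𝕂 := 𝕂) x p q hpq (y ⊗ₜ z) =
      PiTensorProduct.tprod 𝕂 (Function.update (Function.update x p y) q z) := rfl

omit [CharZero 𝕂] [Finite G] in
theorem classFun_update {Ω : BraneComplex (D + 1) S} [DecidableEq Ω.Vertex]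
    (x : ∀ q, hurwitzSpace 𝕂 G (Ω.cls q)) (p : Ω.Vertex) (y : hurwitzSpace 𝕂 G (Ω.cls p)) :
    (fun q => classFun (Function.update x p y q)) =
      Function.update (fun q => classFun (x q)) p (classFun y) :=
  funext fun q => Function.apply_update (fun _ z => classFun z) x p y q

open Classical in
theorem hurwitzForm_insertPair (Ω : BraneComplex (D + 1) S)
    (x : ∀ q, hurwitzSpace 𝕂 G (Ω.cls q)) (p q : Ω.Vertex) (hpq : p ≠ q)
    (y : hurwitzSpace 𝕂 G (Ω.cls p)) (z : hurwitzSpace 𝕂 G (Ω.cls q)) :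
    hurwitzForm 𝕂 G Ω (insertPair (M := fun r => hurwitzSpace 𝕂 G (Ω.cls r)) x p q hpq (y ⊗ₜ z)) =
      Ω.partition (Function.update (Function.update (fun r => classFun (x r)) p (classFun y)) q
        (classFun z)) := by
  rw [insertPair_tmul, hurwitzForm_tprod, ← classFun_update, ← classFun_update]
  congr!

/-- The form of a complex with two vertices. -/
theorem twoVertexForm_hurwitzForm {Ω : BraneComplex (D + 1) S} {p q : Ω.Vertex} (hpq : p ≠ q)
    (h : ∀ r, r = p ∨ r = q) (x : hurwitzSpace 𝕂 G (Ω.cls p))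
    (y : hurwitzSpace 𝕂 G (Ω.cls q)) :
    twoVertexForm (hurwitzForm 𝕂 G Ω) p q hpq x y =
      ∑ γ : Upsilon G (Ω.cls p), x γ * classFun y γ.1.star * classNorm 𝕂 γ.1 := by
  classical
  have h1 : twoVertexForm (hurwitzForm 𝕂 G Ω) p q hpq x y = hurwitzForm 𝕂 G Ω
      (insertPair (M := fun r => hurwitzSpace 𝕂 G (Ω.cls r)) 0 p q hpq (x ⊗ₜ y)) := rfl
  rw [h1, hurwitzForm_insertPair, partition_two_vertices hpq h]
  refine Finset.sum_congr rfl fun γ _ => ?_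
  rw [Function.update_self, Function.update_of_ne hpq, Function.update_self,
    classFun_of_base x γ.2]

theorem twoVertexForm_nondegenerate {Ω : BraneComplex (D + 1) S} {p q : Ω.Vertex} (hpq : p ≠ q)
    (h : ∀ r, r = p ∨ r = q) :
    (twoVertexForm (hurwitzForm 𝕂 G Ω) p q hpq).Nondegenerate := by
  classical
  have hcls := cls_of_two_vertices hpq h
  constructor
  · intro x hx
    ext γ
    have h1 := hx (Finsupp.single ⟨γ.1.star, by rw [γ.1.base_star, γ.2, hcls]⟩ 1)
    rw [twoVertexForm_hurwitzForm hpq h, Finset.sum_eq_single γ] at h1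
    · simp only [classFun_single, if_true, mul_one] at h1
      exact (mul_eq_zero.1 h1).resolve_right (classNorm_ne_zero _)
    · intro γ' _ hne
      rw [classFun_single, if_neg, mul_zero, zero_mul]
      intro h2
      refine hne (Subtype.ext ?_)
      rw [← γ'.1.star_star, h2, CoveringClass.star_star]
    · simp
  · intro y hy
    ext γ
    have hγ : γ.1.star.base = Ω.cls p := by
      rw [γ.1.base_star, γ.2, hcls, ColorClass.star_star]
    have h1 := hy (Finsupp.single ⟨γ.1.star, hγ⟩ 1)
    rw [twoVertexForm_hurwitzForm hpq h, Finset.sum_eq_single ⟨γ.1.star, hγ⟩] at h1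
    · rw [Finsupp.single_eq_same, one_mul, CoveringClass.star_star, classFun_of_base y γ.2] at h1
      exact (mul_eq_zero.1 h1).resolve_right (classNorm_ne_zero _)
    · intro γ' _ hne
      rw [Finsupp.single_eq_of_ne hne, zero_mul, zero_mul]
    · simp

variable (𝕂 G) in
/-- The tensor inverse to the form of the complexes with two vertices. -/
def hurwitzTensor (σ : ColorClass D S) : hurwitzSpace 𝕂 G σ ⊗[𝕂] hurwitzSpace 𝕂 G σ.star :=
  ∑ γ : Upsilon G σ, (classNorm 𝕂 γ.1)⁻¹ • (Finsupp.single γ 1 ⊗ₜ Finsupp.single γ.star 1)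

theorem hurwitzForm_cutTensor {Ω Ω' : BraneComplex (D + 1) S} (η : CutMorphism Ω Ω')
    (h' : Ω'.cls η.minus = (Ω'.cls η.plus).star) (x : ∀ q, hurwitzSpace 𝕂 G (Ω.cls q))
    (x' : ∀ q, hurwitzSpace 𝕂 G (Ω'.cls q))
    (hx : ∀ q, classFun (x' (η.vert q)) = classFun (x q)) :
    hurwitzForm 𝕂 G Ω' (cutTensor η h' (hurwitzTensor 𝕂 G _) x') =
      hurwitzForm 𝕂 G Ω (PiTensorProduct.tprod 𝕂 x) := by
  classical
  rw [hurwitzForm_tprod, η.partition_eq_sum _ (fun q => classFun (x' q)) hx]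
  unfold cutTensor hurwitzTensor
  simp only [map_sum, map_smul, TensorProduct.map_tmul, smul_eq_mul]
  refine Finset.sum_congr rfl fun γ _ => ?_
  congr 1
  rw [hurwitzForm_insertPair, LinearMap.id_apply, LinearEquiv.coe_coe, classFun_transport]

theorem isBraneTFT_hurwitzForm :
    IsBraneTFT (B := hurwitzSpace (D := D) (S := S) 𝕂 G) (hurwitzForm 𝕂 G) where
  finite σ := inferInstance
  invariance Ω Ω' φ := by
    refine ⟨fun q => cls_eq_of_iso (φ.linkIso q), fun x x' hx => ?_⟩
    rw [hurwitzForm_tprod, hurwitzForm_tprod,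
      ← partition_congr φ.cell φ.vertexEquiv φ.linkIso (fun q x => rfl)]
    congr 1
    funext q
    exact (congrArg classFun (hx q)).trans (classFun_transport _ _)
  nondegeneracy Ω p q hpq h :=
    ⟨cls_of_two_vertices hpq h, twoVertexForm_nondegenerate hpq h⟩
  cut := by
    refine ⟨hurwitzTensor 𝕂 G, fun Ω Ω' η => ⟨η.cls_vert, η.cls_minus, fun x x' hx => ?_⟩⟩
    refine hurwitzForm_cutTensor η _ x x' fun q => ?_
    exact (congrArg classFun (hx q)).trans (classFun_transport _ _)
  multiplicativity Ω Ω₁ Ω₂ θ := by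
    refine ⟨fun q => cls_eq_of_iso (linkIsoOfPreserves θ.preserves_inl θ.inl_upper q),
      fun q => cls_eq_of_iso (linkIsoOfPreserves θ.preserves_inr θ.inr_upper q),
      fun x₁ x₂ x h₁ h₂ => ?_⟩
    rw [hurwitzForm_tprod, hurwitzForm_tprod, hurwitzForm_tprod, θ.partition_eq]
    congr 2
    · funext q
      exact (congrArg classFun (h₁ q)).trans (classFun_transport _ _)
    · funext q
      exact (congrArg classFun (h₂ q)).trans (classFun_transport _ _)

end Theory

/-! ### Unions of connected components -/

section Sub

variable {d : ℕ} {S : Type u}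

/-- The subcomplex of the cells in `C`, a union of connected components. -/
def SimpleComplex.sub (c : SimpleComplex d) (C : Set c.Cell)
    (hC : ∀ x y, x ≤ y → (x ∈ C ↔ y ∈ C)) : SimpleComplex d where
  Cell := {x : c.Cell // x ∈ C}
  fintypeCell := @Subtype.fintype _ _ (Classical.decPred _) _
  dim x := c.dim x.1
  dim_lt h := c.dim_lt h
  sphere x := by
    refine @IsSphere.congr _ _ _ _ (_) _ _ _ _ (c.sphere x.1) ?_
    exact
      { toFun := fun y => ⟨⟨y.1, (hC _ _ (le_of_lt y.2)).2 x.2⟩, y.2⟩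
        invFun := fun y => ⟨y.1.1, y.2⟩
        left_inv := fun _ => rfl
        right_inv := fun _ => rfl
        map_rel_iff' := Iff.rfl }
  pure x := by
    obtain ⟨y, hxy, hy⟩ := c.pure x.1
    exact ⟨⟨y, (hC _ _ hxy).1 x.2⟩, hxy, hy⟩

theorem SameComponent.mem_iff {P : Type*} [PartialOrder P] {C : Set P}
    (hC : ∀ x y, x ≤ y → (x ∈ C ↔ y ∈ C)) {x y : P} (h : SameComponent x y) :
    x ∈ C ↔ y ∈ C := by
  induction h with
  | refl => rfl
  | tail _ hbc ih =>
    rcases hbc with hbc | hbc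
    · exact ih.trans (hC _ _ hbc)
    · exact ih.trans (hC _ _ hbc).symm

theorem sameComponent_sub_iff {P : Type*} [PartialOrder P] {C : Set P}
    (hC : ∀ x y, x ≤ y → (x ∈ C ↔ y ∈ C)) (x y : {x // x ∈ C}) :
    SameComponent x y ↔ SameComponent x.1 y.1 := by
  constructor
  · intro h
    exact Relation.ReflTransGen.lift Subtype.val (fun a b hab => hab) _ _ h
  · intro h
    have key : ∀ z, SameComponent x.1 z → ∀ hz : z ∈ C, SameComponent x ⟨z, hz⟩ := by
      intro z hz
      induction hz with
      | refl => exact fun _ => Relation.ReflTransGen.refl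
      | @tail b z hb hbz ih =>
        intro hz
        have hb' : b ∈ C := by
          rcases hbz with h | h
          · exact (hC _ _ h).2 hz
          · exact (hC _ _ h).1 hz
        exact (ih hb').tail hbz
    exact key y.1 h y.2

theorem ConnectedOn.preimage {P : Type*} [PartialOrder P] {C T : Set P} (hT : T ⊆ C)
    (h : ConnectedOn T) : ConnectedOn (Subtype.val ⁻¹' T : Set {x // x ∈ C}) := by
  obtain ⟨⟨x, hx⟩, h⟩ := h
  refine ⟨⟨⟨x, hT hx⟩, hx⟩, fun a ha b hb => ?_⟩
  have key : ∀ z, Relation.ReflTransGen (fun a b => a ∈ T ∧ b ∈ T ∧ (a ≤ b ∨ b ≤ a)) a.1 z →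
      ∀ hz : z ∈ C, Relation.ReflTransGen (fun a b : {x // x ∈ C} =>
        a ∈ (Subtype.val ⁻¹' T : Set {x // x ∈ C}) ∧ b ∈ (Subtype.val ⁻¹' T : Set {x // x ∈ C}) ∧
          (a ≤ b ∨ b ≤ a)) a ⟨z, hz⟩ := by
    intro z hz
    induction hz with
    | refl => exact fun _ => Relation.ReflTransGen.refl
    | tail _ hbc ih => exact fun _ => (ih (hT hbc.1)).tail ⟨hbc.1, hbc.2.1, hbc.2.2⟩
  exact key b.1 (h a.1 ha b.1 hb) b.2

/-- The restriction of colors and orientations to a union of components. -/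
def ColoredComplex.sub (c : ColoredComplex d S) (C : Set c.Cell)
    (hC : ∀ x y, x ≤ y → (x ∈ C ↔ y ∈ C)) : ColoredComplex d S where
  toSimpleComplex := c.toSimpleComplex.sub C hC
  color x := c.color ⟨x.1.1, x.2⟩
  color_inj x y h hd hcol := by
    have := c.color_inj ⟨x.1.1, x.2⟩ ⟨y.1.1, y.2⟩ ((sameComponent_sub_iff hC _ _).1 h) hd hcol
    have h1 : x.1.1 = y.1.1 := Subtype.mk.inj this
    have h2 : x.1 = y.1 := Subtype.ext h1
    exact Subtype.ext h2
  ori n f := c.ori n fun i => (f i).1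
  ori_flip n f f' hf hf' hl hd := by
    obtain ⟨i, hi, hj⟩ := hd
    exact c.ori_flip n _ _ ⟨fun a b hab => hf.1 hab, hf.2⟩ ⟨fun a b hab => hf'.1 hab, hf'.2⟩
      (congrArg Subtype.val hl) ⟨i, fun h => hi (Subtype.ext h),
        fun j hij => congrArg Subtype.val (hj j hij)⟩

variable (Ω : CyclicComplex d S) (C : Set Ω.Cell) (hC : ∀ x y, x ≤ y → (x ∈ C ↔ y ∈ C))

/-- The vertices of a union of components as vertices of the complex. -/
def subVertex (q : (Ω.toColoredComplex.sub C hC).Vertex) : Ω.Vertex := ⟨q.1.1, q.2⟩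

theorem subVertex_injective : Function.Injective (subVertex Ω C hC) := by
  intro q r h
  have h0 := congrArg Subtype.val h
  have h1 : q.1.1 = r.1.1 := h0
  have h2 : q.1 = r.1 := Subtype.ext h1
  exact Subtype.ext h2

theorem exists_subVertex (q : Ω.Vertex) (h : q.1 ∈ C) : ∃ r, subVertex Ω C hC r = q :=
  ⟨⟨⟨q.1, h⟩, q.2⟩, rfl⟩

include hC in
theorem next_mem_iff (q : Ω.Vertex) : (Ω.next q).1 ∈ C ↔ q.1 ∈ C :=
  (SameComponent.mem_iff hC ((Ω.next_sameCycle q (Ω.next q)).1 ⟨1, rfl⟩)).symm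

/-- The cyclic order on the vertices of a union of components. -/
def subNext : Equiv.Perm (Ω.toColoredComplex.sub C hC).Vertex where
  toFun q := ⟨⟨(Ω.next (subVertex Ω C hC q)).1, (next_mem_iff Ω C hC _).2 q.1.2⟩, (Ω.next _).2⟩
  invFun q := ⟨⟨(Ω.next.symm (subVertex Ω C hC q)).1, (next_mem_iff Ω C hC _).1 (by
    rw [Equiv.apply_symm_apply]
    exact q.1.2)⟩, (Ω.next.symm _).2⟩
  left_inv q := subVertex_injective Ω C hC (Ω.next.symm_apply_apply _)
  right_inv q := subVertex_injective Ω C hC (Ω.next.apply_symm_apply _)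

theorem subVertex_next (q) :
    subVertex Ω C hC (subNext Ω C hC q) = Ω.next (subVertex Ω C hC q) := rfl

theorem subVertex_pow (n : ℕ) (q) :
    subVertex Ω C hC ((subNext Ω C hC ^ n) q) = (Ω.next ^ n) (subVertex Ω C hC q) := by
  induction n with
  | zero => rfl
  | succ n ih => rw [pow_succ', pow_succ', Equiv.Perm.mul_apply, Equiv.Perm.mul_apply,
      subVertex_next, ih]

/-- The cyclic complex on a union of components. -/
def CyclicComplex.sub : CyclicComplex d S where
  toColoredComplex := Ω.toColoredComplex.sub C hC
  next := subNext Ω C hC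
  next_sameCycle p q := by
    refine Iff.trans ?_ ((Ω.next_sameCycle (subVertex Ω C hC p) (subVertex Ω C hC q)).trans
      (sameComponent_sub_iff hC p.1 q.1).symm)
    constructor
    · intro h
      obtain ⟨i, -, hi⟩ := h.exists_pow_eq'
      exact ⟨i, by rw [zpow_natCast, ← subVertex_pow, hi]⟩
    · intro h
      obtain ⟨i, -, hi⟩ := h.exists_pow_eq'
      exact ⟨i, subVertex_injective Ω C hC (by rw [zpow_natCast, subVertex_pow, hi])⟩

variable (A : Set (Ω.sub C hC).Vertex)

theorem meets_sub_iff (x : (Ω.sub C hC).Cell) :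
    (Ω.sub C hC).Meets A x ↔ Ω.Meets (subVertex Ω C hC '' A) x.1 := by
  constructor
  · rintro ⟨a, ha, hax⟩
    exact ⟨_, ⟨a, ha, rfl⟩, hax⟩
  · rintro ⟨_, ⟨a, ha, rfl⟩, hax⟩
    exact ⟨a, ha, hax⟩

theorem meets_compl_sub_iff (x : (Ω.sub C hC).Cell) :
    (Ω.sub C hC).Meets Aᶜ x ↔ Ω.Meets (subVertex Ω C hC '' A)ᶜ x.1 := by
  constructor
  · rintro ⟨a, ha, hax⟩
    refine ⟨subVertex Ω C hC a, ?_, hax⟩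
    rintro ⟨b, hb, hab⟩
    exact ha (subVertex_injective Ω C hC hab ▸ hb)
  · rintro ⟨a, ha, hax⟩
    obtain ⟨b, rfl⟩ := exists_subVertex Ω C hC a ((hC _ _ hax).2 x.2)
    exact ⟨b, fun hb => ha ⟨b, hb, rfl⟩, hax⟩

theorem crossing_sub :
    (Ω.sub C hC).crossing A = Subtype.val ⁻¹' Ω.crossing (subVertex Ω C hC '' A) := by
  ext x
  exact and_congr (meets_sub_iff Ω C hC A x) (meets_compl_sub_iff Ω C hC A x)

theorem mem_of_meets_sub {x : Ω.Cell} (h : Ω.Meets (subVertex Ω C hC '' A) x) : x ∈ C := by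
  obtain ⟨_, ⟨a, -, rfl⟩, hax⟩ := h
  exact (hC _ _ hax).1 a.1.2

theorem isArc_sub (h : (Ω.sub C hC).IsArc A) : Ω.IsArc (subVertex Ω C hC '' A) := by
  obtain ⟨h1, a, ⟨ha, hna⟩, huniq⟩ := h
  have hnext : ∀ q, Ω.next (subVertex Ω C hC q) ∈ subVertex Ω C hC '' A ↔
      (Ω.sub C hC).next q ∈ A := by
    intro q
    constructor
    · rintro ⟨b, hb, hbq⟩
      rw [← subVertex_next] at hbq
      exact subVertex_injective Ω C hC hbq ▸ hb
    · intro hq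
      exact ⟨_, hq, rfl⟩
  refine ⟨?_, subVertex Ω C hC a, ⟨⟨a, ha, rfl⟩, fun h => hna ((hnext a).1 h)⟩, ?_⟩
  · rintro _ ⟨b, hb, rfl⟩ _ ⟨b', hb', rfl⟩
    exact (sameComponent_sub_iff hC b.1 b'.1).1 (h1 b hb b' hb')
  · rintro _ ⟨⟨b, hb, rfl⟩, hnb⟩
    rw [huniq b ⟨hb, fun h => hnb ((hnext b).2 h)⟩]

theorem hasCut_sub (h : Ω.HasCut (subVertex Ω C hC '' A)) : (Ω.sub C hC).HasCut A where
  connected := by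
    rw [crossing_sub]
    exact h.connected.preimage fun x hx => mem_of_meets_sub Ω C hC A hx.1
  sphere x hx := by
    rw [crossing_sub] at hx ⊢
    refine @IsSphere.congr _ _ _ _ (_) _ _ _ _ (h.sphere x.1 hx) ?_
    exact
      { toFun := fun y => ⟨⟨y.1, mem_of_meets_sub Ω C hC A y.2.1.1⟩, y.2⟩
        invFun := fun y => ⟨y.1.1, y.2⟩
        left_inv := fun _ => rfl
        right_inv := fun _ => rfl
        map_rel_iff' := Iff.rfl }
  connected_left := by
    have e : {x | (Ω.sub C hC).Meets A x} = (Subtype.val ⁻¹' {x | Ω.Meets (subVertex Ω C hC '' A) x} :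
        Set (Ω.sub C hC).Cell) := Set.ext (meets_sub_iff Ω C hC A)
    rw [e]
    exact h.connected_left.preimage fun x hx => mem_of_meets_sub Ω C hC A hx
  connected_right := by
    have e : {x | (Ω.sub C hC).Meets Aᶜ x ∧ ∃ a ∈ A, SameComponent a.1 x} =
        (Subtype.val ⁻¹' {x | Ω.Meets (subVertex Ω C hC '' A)ᶜ x ∧
          ∃ a ∈ subVertex Ω C hC '' A, SameComponent a.1 x} : Set (Ω.sub C hC).Cell) := by
      refine Set.ext fun x => and_congr (meets_compl_sub_iff Ω C hC A x) ?_
      constructor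
      · rintro ⟨a, ha, hax⟩
        exact ⟨_, ⟨a, ha, rfl⟩, (sameComponent_sub_iff hC a.1 x).1 hax⟩
      · rintro ⟨_, ⟨a, ha, rfl⟩, hax⟩
        exact ⟨a, ha, (sameComponent_sub_iff hC a.1 x).2 hax⟩
    rw [e]
    refine h.connected_right.preimage fun x hx => ?_
    obtain ⟨-, _, ⟨a, -, rfl⟩, hax⟩ := hx
    exact (SameComponent.mem_iff hC hax).1 a.1.2

end Sub

section SubBrane

variable {D : ℕ} {S : Type u} (Ω : BraneComplex (D + 1) S) (C : Set Ω.Cell)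
  (hC : ∀ x y, x ≤ y → (x ∈ C ↔ y ∈ C))

/-- The brane complex on a union of components. -/
def BraneComplex.sub : BraneComplex (D + 1) S where
  toCyclicComplex := Ω.toCyclicComplex.sub C hC
  hasCut A hA := hasCut_sub _ C hC A (Ω.hasCut _ (isArc_sub _ C hC A hA))

/-- The cells of a union of components as cells of the complex. -/
def subEmb : (Ω.sub C hC).Cell ↪o Ω.Cell := OrderEmbedding.subtype _

theorem subEmb_preserves :
    ColoredComplex.Preserves (Ω.sub C hC).toColoredComplex Ω.toColoredComplex
      (subEmb Ω C hC) where
  dim _ := rfl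
  color := by
    rintro x ⟨x', hx'⟩ h
    subst h
    rfl
  ori _ _ _ := rfl

theorem subEmb_upper (x : (Ω.sub C hC).Cell) (y : Ω.Cell) (h : subEmb Ω C hC x ≤ y) :
    ∃ x', subEmb Ω C hC x' = y :=
  ⟨⟨y, (hC _ _ h).1 x.2⟩, rfl⟩

theorem cls_sub (q : (Ω.sub C hC).Vertex) :
    (Ω.sub C hC).cls q = Ω.cls (subVertex _ C hC q) :=
  cls_eq_of_iso (linkIsoOfPreserves (subEmb_preserves Ω C hC) (subEmb_upper Ω C hC) q)

/-- A brane complex divided into two unions of components. -/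
def disjointUnionSub (C' : Set Ω.Cell) (hC' : ∀ x y, x ≤ y → (x ∈ C' ↔ y ∈ C'))
    (h : ∀ x, x ∈ C' ↔ x ∉ C) : DisjointUnion Ω (Ω.sub C hC) (Ω.sub C' hC') where
  inl := subEmb Ω C hC
  inr := subEmb Ω C' hC'
  cover x := by
    by_cases hx : x ∈ C
    · exact Or.inl ⟨⟨x, hx⟩, rfl⟩
    · exact Or.inr ⟨⟨x, (h x).2 hx⟩, rfl⟩
  not_inl_le_inr x y hxy := (h y.1).1 y.2 ((hC _ _ hxy).1 x.2)
  not_inr_le_inl x y hxy := (h y.1).1 y.2 ((hC _ _ hxy).2 x.2)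
  preserves_inl := subEmb_preserves Ω C hC
  preserves_inr := subEmb_preserves Ω C' hC'
  next_inl _ := rfl
  next_inr _ := rfl

end SubBrane

/-! ### Gluing isomorphisms of vertex complexes -/

section Glue

variable {𝕂 : Type v} [Field 𝕂] {G : Type w} [Group G] [Finite G] {D : ℕ}
  {S : Type u} {Ω Ω' : BraneComplex (D + 1) S} {ι : Type*}

open Classical in
/-- The map of cells glued from maps of vertices and of vertex complexes. A cell that contains no
vertex properly is itself a vertex, and the vertex below it that is chosen in the second case is
this cell. -/
def glue (v : ι ≃ Ω.Vertex) (v' : ι ≃ Ω'.Vertex)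
    (φ : ∀ i, ColoredComplex.Iso (Ω.link (v i)).1 (Ω'.link (v' i)).1) (x : Ω.Cell) : Ω'.Cell :=
  if h : ∃ i, (v i).1 < x then ((φ h.choose).cell ⟨x, h.choose_spec⟩).1
  else (v' (v.symm (SimpleComplex.exists_vertex_le x).choose)).1

/-- The maps `φ` agree on the cells in which two vertex complexes meet. -/
def Agree (v : ι ≃ Ω.Vertex) (v' : ι ≃ Ω'.Vertex)
    (φ : ∀ i, ColoredComplex.Iso (Ω.link (v i)).1 (Ω'.link (v' i)).1) : Prop :=
  ∀ i j x (hi : (v i).1 < x) (hj : (v j).1 < x),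
    ((φ i).cell ⟨x, hi⟩).1 = ((φ j).cell ⟨x, hj⟩).1

variable {v : ι ≃ Ω.Vertex} {v' : ι ≃ Ω'.Vertex}
  {φ : ∀ i, ColoredComplex.Iso (Ω.link (v i)).1 (Ω'.link (v' i)).1}

theorem glue_vertex (i : ι) : glue v v' φ (v i).1 = (v' i).1 := by
  unfold glue
  rw [dif_neg]
  · have h := (SimpleComplex.exists_vertex_le (v i).1).choose_spec
    rw [show (SimpleComplex.exists_vertex_le (v i).1).choose = v i from
      Subtype.ext (SimpleComplex.Vertex.eq_of_le h), v.symm_apply_apply]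
  · rintro ⟨j, hj⟩
    exact hj.ne (SimpleComplex.Vertex.eq_of_le hj.le)

theorem Agree.glue_eq (h : Agree v v' φ) {i : ι} {x : Ω.Cell} (hx : (v i).1 < x) :
    glue v v' φ x = ((φ i).cell ⟨x, hx⟩).1 := by
  unfold glue
  rw [dif_pos ⟨i, hx⟩]
  exact h _ _ _ _ _

theorem Agree.glue_mono (h : Agree v v' φ) {x y : Ω.Cell} (hxy : x ≤ y) :
    glue v v' φ x ≤ glue v v' φ y := by
  obtain ⟨q, hq⟩ := SimpleComplex.exists_vertex_le x
  obtain ⟨i, rfl⟩ := v.surjective q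
  rcases hq.lt_or_eq with hq | rfl
  · rw [h.glue_eq hq, h.glue_eq (hq.trans_le hxy)]
    exact (φ i).cell.monotone hxy
  · rcases hxy.lt_or_eq with hxy | rfl
    · rw [glue_vertex, h.glue_eq hxy]
      exact le_of_lt ((φ i).cell _).2
    · exact le_rfl

theorem Agree.glue_glue (h : Agree v v' φ) (h' : Agree v' v fun i => (φ i).symm) (x : Ω.Cell) :
    glue v' v (fun i => (φ i).symm) (glue v v' φ x) = x := by
  obtain ⟨q, hq⟩ := SimpleComplex.exists_vertex_le x
  obtain ⟨i, rfl⟩ := v.surjective q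
  rcases hq.lt_or_eq with hq | rfl
  · rw [h.glue_eq hq, h'.glue_eq ((φ i).cell ⟨x, hq⟩).2]
    exact congrArg Subtype.val ((φ i).cell.symm_apply_apply ⟨x, hq⟩)
  · rw [glue_vertex, glue_vertex]

/-- Brane complexes whose vertex complexes are identified by compatible isomorphisms have the
same weighted numbers of coverings. -/
theorem Agree.partition_eq (h : Agree v v' φ) (h' : Agree v' v fun i => (φ i).symm)
    (X : ι → CoveringClass G D S → 𝕂) :
    Ω.partition (fun q => X (v.symm q)) = Ω'.partition (fun q => X (v'.symm q)) := by
  let Ψ : Ω.Cell ≃o Ω'.Cell :=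
    { toFun := glue v v' φ
      invFun := glue v' v fun i => (φ i).symm
      left_inv := h.glue_glue h'
      right_inv := h'.glue_glue (φ := fun i => (φ i).symm) h
      map_rel_iff' := fun {x y} => by
        refine ⟨fun hxy => ?_, h.glue_mono⟩
        have := h'.glue_mono (show glue v v' φ x ≤ glue v v' φ y from hxy)
        rwa [h.glue_glue h', h.glue_glue h'] at this }
  have hφ : ∀ q, ∃ ψ : ColoredComplex.Iso (Ω.link q).1 (Ω'.link ((v.symm.trans v') q)).1,
      ∀ x, (ψ.cell x).1 = Ψ x.1 := by
    intro q
    obtain ⟨i, rfl⟩ := v.surjective q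
    rw [Equiv.trans_apply, Equiv.symm_apply_apply]
    exact ⟨φ i, fun x => (h.glue_eq x.2).symm⟩
  choose ψ hψ using hφ
  rw [← partition_congr Ψ (v.symm.trans v') ψ hψ]
  simp

end Glue

/-! ### Numbered vertices in cyclic order -/

section Numbered

variable {D : ℕ} {S : Type u} {Ω Ω' : BraneComplex (D + 1) S}

theorem isFlag_triple {d : ℕ} {c : SimpleComplex d} {a x y : c.Cell} (hax : a < x) (hxy : x < y)
    (ha : c.dim a = 0) (hx : c.dim x = 1) (hy : c.dim y = 2) : c.IsFlag (n := 2) ![a, x, y] := by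
  constructor
  · refine Fin.strictMono_iff_lt_succ.2 fun i => ?_
    fin_cases i
    · exact hax
    · exact hxy
  · intro i
    fin_cases i
    · exact ha
    · exact hx
    · exact hy

theorem next_pow_of_next {d n : ℕ} {Ω : CyclicComplex d S} {V : Fin n → Ω.Vertex}
    (h : ∀ i, Ω.next (V i) = V (finRotate n i)) (m : ℕ) (i : Fin n) :
    (Ω.next ^ m) (V i) = V ((finRotate n ^ m) i) := by
  induction m with
  | zero => rfl
  | succ m ih =>
    rw [pow_succ', pow_succ', Equiv.Perm.mul_apply, Equiv.Perm.mul_apply, ih, h]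

theorem Compatible.cyclicallyOrdered {n : ℕ} {σ : Fin n → ColorClass D S} (e : Compatible Ω σ)
    {i j k : Fin n} (s t : ℕ) (hs : 0 < s) (hst : s < t) (hj : (finRotate n ^ s) i = j)
    (hk : (finRotate n ^ t) i = k)
    (h : ∀ m < t + 1, 0 < m → (finRotate n ^ m) i ≠ i) :
    Ω.CyclicallyOrdered (e.vert i) (e.vert j) (e.vert k) := by
  refine ⟨s, t, hs, hst, ?_, ?_, fun m hm hmt => ?_⟩
  · rw [next_pow_of_next e.next, hj]
  · rw [next_pow_of_next e.next, hk]
  · rw [next_pow_of_next e.next]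
    exact fun h' => h m (Nat.lt_succ_of_le hmt) hm (e.vert.injective h')

theorem finRotate_three_pow (i : Fin 3) : (finRotate 3 ^ 1) i = i + 1 ∧
    (finRotate 3 ^ 2) i = i + 2 ∧ (finRotate 3 ^ 3) i = i := by
  decide +revert

theorem Compatible.cyclicallyOrdered_three {σ : Fin 3 → ColorClass D S} (e : Compatible Ω σ)
    (i : Fin 3) : Ω.CyclicallyOrdered (e.vert i) (e.vert (i + 1)) (e.vert (i + 2)) := by
  obtain ⟨h1, h2, -⟩ := finRotate_three_pow i
  refine e.cyclicallyOrdered 1 2 one_pos one_lt_two h1 h2 fun m hm hm0 => ?_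
  interval_cases m
  · rw [h1]
    simp
  · rw [h2]
    simp

theorem fin_three_eq {i j k : Fin 3} (hij : i ≠ j) (hik : i ≠ k) (hjk : j ≠ k) (h : j = i + 1) :
    k = i + 2 := by
  decide +revert

theorem fin_three_eq_of_ne {i j k : Fin 3} (hij : i ≠ j) (hik : i ≠ k) (hjk : j ≠ k)
    (h : ¬ j = i + 1) : i = j + 1 ∧ k = j + 2 := by
  decide +revert

/-- In a complex with three vertices the sign of a flag of dimension two whose 2-cell contains
all vertices is determined by the order of the vertices. -/
theorem Compatible.ori_eq {σ : Fin 3 → ColorClass D S} (e : Compatible Ω σ) {i j k : Fin 3}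
    (hij : i ≠ j) (hik : i ≠ k) (hjk : j ≠ k) {x y : Ω.Cell}
    (hf : Ω.IsFlag (n := 2) ![(e.vert i).1, x, y]) (hj : (e.vert j).1 ≤ x)
    (hk : (e.vert k).1 ≤ y) :
    Ω.ori 1 ![(e.vert i).1, x, y] = if j = i + 1 then 1 else -1 := by
  have hxy : x < y := hf.1 (show (1 : Fin 3) < 2 by decide)
  have hix : (e.vert i).1 < x := hf.1 (show (0 : Fin 3) < 1 by decide)
  split_ifs with h
  · obtain rfl : k = i + 2 := fin_three_eq hij hik hjk h
    subst h
    exact e.coherent _ _ _ _ hf rfl hj hk (e.cyclicallyOrdered_three i)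
  · obtain ⟨rfl, rfl⟩ : i = j + 1 ∧ k = j + 2 := fin_three_eq_of_ne hij hik hjk h
    have hf' : Ω.IsFlag (n := 2) ![(e.vert j).1, x, y] :=
      isFlag_cons_of_le (f := ![x, y]) hf hj
    have h1 := e.coherent _ _ _ _ hf' rfl hix.le hk (e.cyclicallyOrdered_three j)
    have h2 := ori_cons_flip (c := Ω.toColoredComplex) (f := ![x, y]) hf hj
      fun h => hij (e.vert.injective h)
    have h3 : Ω.ori 1 ![(e.vert j).1, x, y] = - Ω.ori 1 ![(e.vert (j + 1)).1, x, y] := h2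
    rw [h1] at h3
    rw [← neg_eq_iff_eq_neg, ← h3]

end Numbered

/-! ### Complexes with three vertices -/

section Three

variable {𝕂 : Type v} [Field 𝕂] {G : Type w} [Group G] [Finite G] {D : ℕ}
  {S : Type u} {Ω Ω' : BraneComplex (D + 1) S}

theorem link_dim {q : Ω.Vertex} {q' : Ω'.Vertex}
    (φ : ColoredComplex.Iso (Ω.link q).1 (Ω'.link q').1) {x : Ω.Cell} (hx : q.1 < x) :
    Ω'.dim (φ.cell ⟨x, hx⟩).1 = Ω.dim x := by
  have h1 : Ω'.dim (φ.cell ⟨x, hx⟩).1 - 1 = Ω.dim x - 1 := φ.preserves.dim ⟨x, hx⟩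
  have h2 := Ω'.dim_pos_of_link (φ.cell ⟨x, hx⟩)
  have h3 := Ω.dim_lt hx
  omega

theorem link_color {q : Ω.Vertex} {q' : Ω'.Vertex}
    (φ : ColoredComplex.Iso (Ω.link q).1 (Ω'.link q').1) {x : Ω.Cell} (hx : q.1 < x)
    (hd : 2 ≤ Ω.dim x) :
    Ω'.color ⟨(φ.cell ⟨x, hx⟩).1, Ω'.dim_pos_of_link _⟩ = Ω.color ⟨x, by omega⟩ :=
  φ.preserves.color ⟨⟨x, hx⟩, show 0 < Ω.dim x - 1 by omega⟩
    ⟨φ.cell ⟨x, hx⟩, (show 0 < Ω.dim x - 1 by omega).trans_eq (φ.preserves.dim ⟨x, hx⟩).symm⟩ rfl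

theorem link_ori {q : Ω.Vertex} {q' : Ω'.Vertex}
    (φ : ColoredComplex.Iso (Ω.link q).1 (Ω'.link q').1) {x y : Ω.Cell} (hx : q.1 < x)
    (hxy : x < y) (hdx : Ω.dim x = 1) (hdy : Ω.dim y = 2) :
    Ω'.ori 1 ![q'.1, (φ.cell ⟨x, hx⟩).1, (φ.cell ⟨y, hx.trans hxy⟩).1] =
      Ω.ori 1 ![q.1, x, y] := by
  have hf : (Ω.link q).1.IsFlag (n := 1)
      ![(⟨x, hx⟩ : {x // q.1 < x}), (⟨y, hx.trans hxy⟩ : {x // q.1 < x})] :=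
    SimpleComplex.isFlag_pair (show (⟨x, hx⟩ : {x // q.1 < x}) < ⟨y, _⟩ from hxy)
      (show Ω.dim x - 1 = 0 by omega) (show Ω.dim y - 1 = 1 by omega)
  have h := neg_injective (φ.preserves.ori 0 _ hf)
  convert h using 2 <;>
  · funext i
    fin_cases i <;> rfl

theorem color_inj_of_connected (h : ConnectedOn (Set.univ : Set Ω.Cell)) {x y : Ω.Cell}
    (hx : 0 < Ω.dim x) (hy : 0 < Ω.dim y) (hd : Ω.dim x = Ω.dim y)
    (hc : Ω.color ⟨x, hx⟩ = Ω.color ⟨y, hy⟩) : x = y :=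
  congrArg Subtype.val (Ω.color_inj ⟨x, hx⟩ ⟨y, hy⟩ (h.sameComponent x y) hd hc)

/-- Isomorphisms of vertex complexes agree on the cells of dimension at least two, which are
determined by their colors. -/
theorem link_agree_of_two_le (h : ConnectedOn (Set.univ : Set Ω'.Cell)) {p q : Ω.Vertex}
    {p' q' : Ω'.Vertex} (φ : ColoredComplex.Iso (Ω.link p).1 (Ω'.link p').1)
    (ψ : ColoredComplex.Iso (Ω.link q).1 (Ω'.link q').1) {x : Ω.Cell} (hp : p.1 < x)
    (hq : q.1 < x) (hd : 2 ≤ Ω.dim x) : (φ.cell ⟨x, hp⟩).1 = (ψ.cell ⟨x, hq⟩).1 :=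
  color_inj_of_connected h _ _ ((link_dim φ hp).trans (link_dim ψ hq).symm)
    ((link_color φ hp hd).trans (link_color ψ hq hd).symm)

theorem link_lt_of_lt (h : ConnectedOn (Set.univ : Set Ω.Cell)) {p q : Ω.Vertex}
    {p' q' : Ω'.Vertex} (φ : ColoredComplex.Iso (Ω.link p).1 (Ω'.link p').1)
    (ψ : ColoredComplex.Iso (Ω.link q).1 (Ω'.link q').1) {x : Ω.Cell} (hp : p.1 < x)
    (hd : 2 ≤ Ω.dim x) (hq : q'.1 < (φ.cell ⟨x, hp⟩).1) : q.1 < x := by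
  have hd' : 2 ≤ Ω'.dim (φ.cell ⟨x, hp⟩).1 := by rwa [link_dim]
  have h1 := link_agree_of_two_le h φ.symm ψ.symm (φ.cell ⟨x, hp⟩).2 hq hd'
  have h2 : (φ.symm.cell ⟨(φ.cell ⟨x, hp⟩).1, (φ.cell ⟨x, hp⟩).2⟩).1 = x :=
    congrArg Subtype.val (φ.cell.symm_apply_apply ⟨x, hp⟩)
  rw [← h2, h1]
  exact (ψ.symm.cell _).2

/-- Complexes of dimension one have at most two vertices. -/
theorem not_three_vertices {Ω : BraneComplex (0 + 1) S}
    (h : ConnectedOn (Set.univ : Set Ω.Cell)) {p q r : Ω.Vertex} (hpq : p ≠ q) (hpr : p ≠ r)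
    (hqr : q ≠ r) {x : Ω.Cell} (hp : p.1 < x) (hq : q.1 < x) : False := by
  have hx : Ω.dim x = 1 := by
    have := Ω.dim_lt hp
    have := SimpleComplex.dim_le x
    omega
  by_cases hr : r.1 < x
  -- an edge has only two signs for its vertices
  · have h1 := Ω.ori_vertex_flip p.2 q.2 hx hp hq fun h => hpq (Subtype.ext h)
    have h2 := Ω.ori_vertex_flip p.2 r.2 hx hp hr fun h => hpr (Subtype.ext h)
    have h3 := Ω.ori_vertex_flip q.2 r.2 hx hq hr fun h => hqr (Subtype.ext h)
    rw [h1, h2] at h3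
    exact units_ne_neg_self _ h3
  -- vertex complexes are points, so that an edge with its vertices is a component
  · have hup : ∀ (s : Ω.Vertex) (y : Ω.Cell), s.1 < x → s.1 < y → y = x := fun s y hs hy =>
      congrArg Subtype.val (ConnectedOn.subsingleton (c := (Ω.link s).1.toSimpleComplex)
        (Ω.link s).2 ⟨y, hy⟩ ⟨x, hs⟩)
    have hC : ∀ y z : Ω.Cell, y ≤ z → (y ∈ Set.Iic x ↔ z ∈ Set.Iic x) := by
      intro y z hyz
      refine ⟨fun hy => ?_, fun hz => hyz.trans hz⟩
      rcases hyz.lt_or_eq with hyz | rfl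
      · obtain ⟨s, hs⟩ := SimpleComplex.exists_vertex_le y
        have hsz := hs.trans_lt hyz
        have hsx : s.1 < x := lt_of_le_of_ne (hs.trans hy) fun h' => by
          have := s.2
          rw [h'] at this
          omega
        exact (hup s z hsx hsz).le
      · exact hy
    have := (SameComponent.mem_iff hC (h.sameComponent x r.1)).1 le_rfl
    exact hr (lt_of_le_of_ne this fun h' => by
      have := r.2
      rw [h'] at this
      omega)

variable {σ : Fin 3 → ColorClass D S} (e : Compatible Ω σ) (e' : Compatible Ω' σ)
  (φ : ∀ i, ColoredComplex.Iso (Ω.link (e.vert i)).1 (Ω'.link (e'.vert i)).1)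

include e e' in
/-- An edge between two vertices is mapped to an edge between the corresponding vertices: otherwise
the signs of a flag and of its image, given by the coherence, would be opposite. -/
theorem vert_le_link_edge {i j : Fin 3} (hij : i ≠ j) {x y : Ω.Cell}
    (hi : (e.vert i).1 < x) (hj : (e.vert j).1 < x) (hxy : x < y) (hx : Ω.dim x = 1)
    (hy : Ω.dim y = 2) : (e'.vert j).1 ≤ ((φ i).cell ⟨x, hi⟩).1 := by
  obtain ⟨p, hp, hpx⟩ := SimpleComplex.exists_other_vertex ((φ i).cell ⟨x, hi⟩).2
  obtain ⟨k, rfl⟩ := e'.vert.surjective p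
  by_cases hkj : k = j
  · rwa [← hkj]
  exfalso
  -- the edge `x` joins `i` to `j` and its image joins `i` to the third vertex `k`, within 2-cells
  -- that contain all three vertices
  have hik : i ≠ k := fun h => hp (by rw [h])
  let y' := ((φ i).cell ⟨y, hi.trans hxy⟩).1
  have hxy' : ((φ i).cell ⟨x, hi⟩).1 < y' :=
    (φ i).cell.strictMono (show (⟨x, hi⟩ : {x // (e.vert i).1 < x}) < ⟨y, hi.trans hxy⟩ from hxy)
  have hky : (e.vert k).1 < y :=
    link_lt_of_lt e.connected (φ i) (φ k) (hi.trans hxy) hy.ge (hpx.trans_lt hxy')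
  have hjy : (e'.vert j).1 ≤ y' := by
    have := link_agree_of_two_le e'.connected (φ i) (φ j) (hi.trans hxy) (hj.trans hxy) hy.ge
    exact le_of_lt (lt_of_lt_of_eq ((φ j).cell ⟨y, hj.trans hxy⟩).2 this.symm)
  have h1 := e.ori_eq hij hik (Ne.symm hkj) (isFlag_triple hi hxy (e.vert i).2 hx hy) hj.le hky.le
  have h2 := e'.ori_eq hik hij hkj
    (isFlag_triple ((φ i).cell ⟨x, hi⟩).2 hxy' (e'.vert i).2 ((link_dim _ _).trans hx)
      ((link_dim _ _).trans hy)) hpx hjy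
  rw [link_ori (φ i) hi hxy hx hy, h1] at h2
  clear h1 hjy hky hpx hp hj hi hxy' y'
  revert h2
  decide +revert

include e e' in
theorem agree_of_compatible : Agree e.vert e'.vert φ := by
  intro i j x hi hj
  by_cases hij : i = j
  · subst hij
    rfl
  by_cases hd : 2 ≤ Ω.dim x
  · exact link_agree_of_two_le e'.connected _ _ _ _ hd
  have hx : Ω.dim x = 1 := by
    have := Ω.dim_lt hi
    omega
  rcases Nat.eq_zero_or_pos D with rfl | hD
  -- in dimension one there is no 2-cell to compare orientations in
  · obtain ⟨k, hik, hjk⟩ : ∃ k : Fin 3, i ≠ k ∧ j ≠ k := by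
      clear hi hj
      decide +revert
    have hv : ∀ {a b : Fin 3}, a ≠ b → e.vert a ≠ e.vert b := fun h h' => h (e.vert.injective h')
    exact (not_three_vertices e.connected (hv hij) (hv hik) (hv hjk) hi hj).elim
  obtain ⟨⟨y, hiy⟩, hxy, hy⟩ := SimpleComplex.exists_edge (c := (Ω.link (e.vert i)).1.toSimpleComplex)
    hD ⟨⟨x, hi⟩, show Ω.dim x - 1 = 0 by omega⟩
  have hxy : x < y := hxy
  have hy : Ω.dim y = 2 := by
    have h1 : Ω.dim y - 1 = 1 := hy
    omega
  have hyy := link_agree_of_two_le e'.connected (φ i) (φ j) hiy (hj.trans hxy) hy.ge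
  have hle := vert_le_link_edge e e' φ hij hi hj hxy hx hy
  have hle' := vert_le_link_edge e e' φ (Ne.symm hij) hj hi hxy hx hy
  by_contra hne
  -- Two distinct edges `a`, `b` between the vertices `i` and `j` in the 2-cell `c`: the flags of
  -- `(i, a)` and `(j, b)` have equal signs, those of `(i, x)` and `(j, x)` opposite signs.
  have hoi := link_ori (φ i) hi hxy hx hy
  have hoj := link_ori (φ j) hj hxy hx hy
  have hxi := ((φ i).cell ⟨x, hi⟩).2
  have hxj := ((φ j).cell ⟨x, hj⟩).2
  have hdi := (link_dim (φ i) hi).trans hx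
  have hdj := (link_dim (φ j) hj).trans hx
  have hdy := (link_dim (φ j) (hj.trans hxy)).trans hy
  have hlti : ((φ i).cell ⟨x, hi⟩).1 < ((φ i).cell ⟨y, hiy⟩).1 :=
    (φ i).cell.strictMono (show (⟨x, hi⟩ : {x // (e.vert i).1 < x}) < ⟨y, hiy⟩ from hxy)
  have hltj : ((φ j).cell ⟨x, hj⟩).1 < ((φ j).cell ⟨y, hj.trans hxy⟩).1 :=
    (φ j).cell.strictMono
      (show (⟨x, hj⟩ : {x // (e.vert j).1 < x}) < ⟨y, hj.trans hxy⟩ from hxy)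
  rw [hyy] at hoi hlti
  generalize ((φ i).cell ⟨x, hi⟩).1 = a at *
  generalize ((φ j).cell ⟨x, hj⟩).1 = b at *
  generalize ((φ j).cell ⟨y, hj.trans hxy⟩).1 = c at *
  have hfi := isFlag_triple hxi hlti (e'.vert i).2 hdi hdy
  have hfj := isFlag_triple hxj hltj (e'.vert j).2 hdj hdy
  have hne' : e'.vert j ≠ e'.vert i := fun h => hij (e'.vert.injective h).symm
  have h1 : Ω.ori 1 ![(e.vert j).1, x, y] = - Ω.ori 1 ![(e.vert i).1, x, y] :=
    ori_cons_flip (c := Ω.toColoredComplex) (f := ![x, y])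
      (isFlag_triple hi hxy (e.vert i).2 hx hy) hj.le fun h => hij (e.vert.injective h)
  have h2 : Ω'.ori 1 ![(e'.vert i).1, b, c] = - Ω'.ori 1 ![(e'.vert j).1, b, c] :=
    ori_cons_flip (c := Ω'.toColoredComplex) (f := ![b, c]) hfj hle' hne'
  have h3 : Ω'.ori 1 ![(e'.vert i).1, b, c] = - Ω'.ori 1 ![(e'.vert i).1, a, c] := by
    refine Ω'.ori_flip 1 _ _ hfi (isFlag_cons_of_le (f := ![b, c]) hfj hle') rfl ⟨1, hne, ?_⟩
    intro k hk
    fin_cases k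
    · rfl
    · exact absurd rfl hk
    · rfl
  rw [h2, hoj, hoi, h1, neg_neg] at h3
  exact units_ne_neg_self _ h3

/-- The sums over coverings of a complex with three vertices depend on the classes of the vertex
complexes only. -/
theorem partition_three_vertices (X : Fin 3 → CoveringClass G D S → 𝕂) :
    Ω.partition (fun q => X (e.vert.symm q)) = Ω'.partition (fun q => X (e'.vert.symm q)) := by
  have h : ∀ i, Nonempty (ColoredComplex.Iso (Ω.link (e.vert i)).1 (Ω'.link (e'.vert i)).1) :=
    fun i => Quotient.exact ((e.cls i).symm.trans (e'.cls i))
  exact (agree_of_compatible e e' fun i => (h i).some).partition_eq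
    (agree_of_compatible e' e fun i => (h i).some.symm) X

end Three

/-! ### The two sides of a cut of a complex with four vertices -/

section Renumber

variable {D : ℕ} {S : Type u} {Ω : BraneComplex (D + 1) S}

/-- Numberings of vertices shifted along the cyclic order. -/
def Compatible.rotate {n : ℕ} {σ : Fin n → ColorClass D S} (e : Compatible Ω σ) :
    Compatible Ω fun i => σ (finRotate n i) where
  connected := e.connected
  coherent := e.coherent
  vert := (finRotate n).trans e.vert
  cls _ := e.cls _
  next _ := e.next _

/-- A numbering for an equal sequence of classes. -/
def Compatible.congr {n : ℕ} {σ σ' : Fin n → ColorClass D S} (e : Compatible Ω σ)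
    (h : ∀ i, σ' i = σ i) : Compatible Ω σ' where
  connected := e.connected
  coherent := e.coherent
  vert := e.vert
  cls i := (h i).trans (e.cls i)
  next := e.next

end Renumber

section Side

variable {D : ℕ} {S : Type u} {Ω Ω' : BraneComplex (D + 1) S} {A : Set Ω.Vertex}
  (s : CutSide Ω Ω' A)

theorem SameComponent.symm {P : Type*} [PartialOrder P] {x y : P} (h : SameComponent x y) :
    SameComponent y x := by
  induction h with
  | refl => exact Relation.ReflTransGen.refl
  | tail _ hbc ih => exact ih.head hbc.symm

/-- The cells of one side of a cut complex. -/
def CutSide.part : Set Ω'.Cell := {y | y = s.point.1 ∨ y ∈ Set.range s.emb}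

variable (hC : ∀ x y, x ≤ y → (x ∈ s.part ↔ y ∈ s.part))

theorem CutSide.connected_part (hA : ConnectedOn {x | Ω.Meets A x}) :
    ConnectedOn (Set.univ : Set (Ω'.sub s.part hC).Cell) := by
  obtain ⟨⟨x, -⟩, -⟩ := (Ω'.link s.point).2
  have key : ∀ z, Relation.ReflTransGen (fun a b => a ∈ {x | Ω.Meets A x} ∧
      b ∈ {x | Ω.Meets A x} ∧ (a ≤ b ∨ b ≤ a)) (s.crossEmb x).1 z →
      ∀ hz : Ω.Meets A z, SameComponent s.point.1 (s.emb ⟨z, hz⟩) := by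
    intro z hz
    induction hz with
    | refl =>
      intro hz
      refine Relation.ReflTransGen.single (Or.inl ?_)
      rw [s.point_le]
      exact s.crossEmb_mem x
    | tail _ hbc ih =>
      intro hz
      exact (ih hbc.1).tail (hbc.2.2.imp s.emb.le_iff_le.2 s.emb.le_iff_le.2)
  have hpt : ∀ y ∈ s.part, SameComponent s.point.1 y := by
    rintro y (rfl | ⟨u, rfl⟩)
    · exact Relation.ReflTransGen.refl
    · exact key u.1 (hA.2 _ (s.crossEmb x).2 _ u.2) u.2
  let p : (Ω'.sub s.part hC).Cell := ⟨s.point.1, Or.inl rfl⟩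
  have hp : ∀ y, SameComponent p y := fun y => (sameComponent_sub_iff hC p y).2 (hpt y.1 y.2)
  refine ⟨⟨p, trivial⟩, fun y _ z _ => ?_⟩
  exact Relation.ReflTransGen.mono (fun _ _ h => ⟨trivial, trivial, h⟩) _ _
    ((hp y).symm.trans (hp z))

theorem CutSide.ori_emb {a : Ω.Vertex} (ha : a ∈ A) {x y : {x // Ω.Meets A x}}
    (hf : Ω'.IsFlag (n := 2) ![s.emb ⟨a.1, a, ha, le_rfl⟩, s.emb x, s.emb y]) :
    Ω.IsFlag (n := 2) ![a.1, x.1, y.1] ∧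
      Ω'.ori 1 ![s.emb ⟨a.1, a, ha, le_rfl⟩, s.emb x, s.emb y] = Ω.ori 1 ![a.1, x.1, y.1] := by
  have h1 : (⟨a.1, a, ha, le_rfl⟩ : {x // Ω.Meets A x}) < x :=
    s.emb.lt_iff_lt.1 (hf.1 (show (0 : Fin 3) < 1 by decide))
  have h2 : x < y := s.emb.lt_iff_lt.1 (hf.1 (show (1 : Fin 3) < 2 by decide))
  have h3 : Ω.IsFlag (n := 2) ![a.1, x.1, y.1] :=
    isFlag_triple h1 h2 a.2 ((s.dim x).symm.trans (hf.2 1)) ((s.dim y).symm.trans (hf.2 2))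
  have e1 : (fun i => ((![⟨a.1, a, ha, le_rfl⟩, x, y] : Fin 3 → {x // Ω.Meets A x}) i).1) =
      ![a.1, x.1, y.1] := by
    funext i
    fin_cases i <;> rfl
  have e2 : s.emb ∘ (![⟨a.1, a, ha, le_rfl⟩, x, y] : Fin 3 → {x // Ω.Meets A x}) =
      ![s.emb ⟨a.1, a, ha, le_rfl⟩, s.emb x, s.emb y] := by
    funext i
    fin_cases i <;> rfl
  have h4 := s.ori 1 ![⟨a.1, a, ha, le_rfl⟩, x, y] (by rw [e1]; exact h3)
  rw [e1, e2] at h4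
  exact ⟨h3, h4⟩

theorem eq_of_cyclicallyOrdered_three {d : ℕ} {Ω : CyclicComplex d S} {V : Fin 3 → Ω.Vertex}
    (hV : Function.Injective V) (h : ∀ i, Ω.next (V i) = V (finRotate 3 i)) {i j k : Fin 3}
    (hc : Ω.CyclicallyOrdered (V i) (V j) (V k)) : j = i + 1 ∧ k = i + 2 := by
  obtain ⟨a, b, ha, hab, hj, hk, hne⟩ := hc
  obtain ⟨h1, h2, h3⟩ := finRotate_three_pow i
  have hb : b < 3 := by
    by_contra hb
    refine hne 3 (by omega) (by omega) ?_
    rw [next_pow_of_next h, h3]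
  obtain rfl : a = 1 := by omega
  obtain rfl : b = 2 := by omega
  rw [next_pow_of_next h] at hj hk
  exact ⟨(hV hj).symm.trans h1, (hV hk).symm.trans h2⟩

/-- One side of a cut that separates two neighboring vertices from the others is a coherent complex
with three vertices. The new vertex takes the place of the vertices `c` on the other side. -/
def CutSide.compatible {a b : Ω.Vertex} (hA : ∀ q, q ∈ A ↔ q = a ∨ q = b) (hab : a ≠ b)
    (hconn : ConnectedOn {x | Ω.Meets A x}) (hcoh : Ω.Coherent)
    (hcyc : ∀ c ∉ A, Ω.CyclicallyOrdered a b c ∧ Ω.CyclicallyOrdered b c a ∧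
      Ω.CyclicallyOrdered c a b) {a' b' : Ω'.Vertex}
    (ha' : a'.1 = s.emb ⟨a.1, a, (hA a).2 (Or.inl rfl), le_rfl⟩)
    (hb' : b'.1 = s.emb ⟨b.1, b, (hA b).2 (Or.inr rfl), le_rfl⟩)
    (h1 : Ω'.next a' = b') (h2 : Ω'.next b' = s.point) (h3 : Ω'.next s.point = a') :
    {e : Compatible (Ω'.sub s.part hC) ![Ω.cls a, Ω.cls b, Ω'.cls s.point] //
      ∀ i, subVertex Ω'.toCyclicComplex s.part hC (e.vert i) = ![a', b', s.point] i} := by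
  have haA : a ∈ A := (hA a).2 (Or.inl rfl)
  have hbA : b ∈ A := (hA b).2 (Or.inr rfl)
  let V : Fin 3 → (Ω'.sub s.part hC).Vertex :=
    ![⟨⟨a'.1, Or.inr ⟨_, ha'.symm⟩⟩, a'.2⟩, ⟨⟨b'.1, Or.inr ⟨_, hb'.symm⟩⟩, b'.2⟩,
      ⟨⟨s.point.1, Or.inl rfl⟩, s.point.2⟩]
  have hV : ∀ i, subVertex Ω'.toCyclicComplex s.part hC (V i) = ![a', b', s.point] i := by
    intro i
    fin_cases i <;> rfl
  have hap : a' ≠ s.point := fun h => s.ne _ (ha'.symm.trans (congrArg Subtype.val h))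
  have hbp : b' ≠ s.point := fun h => s.ne _ (hb'.symm.trans (congrArg Subtype.val h))
  have hab' : a' ≠ b' := fun h => by
    have h4 := s.emb.injective (ha'.symm.trans ((congrArg Subtype.val h).trans hb'))
    have h5 := congrArg Subtype.val h4
    exact hab (Subtype.ext h5)
  have hinj : Function.Injective V := by
    intro i j hij
    have h4 : (![a', b', s.point] : Fin 3 → Ω'.Vertex) i = ![a', b', s.point] j := by
      rw [← hV, ← hV, hij]
    fin_cases i <;> fin_cases j <;>
      first
      | rfl
      | exact absurd h4 hab'
      | exact absurd h4 hap
      | exact absurd h4 hbp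
      | exact absurd h4.symm hab'
      | exact absurd h4.symm hap
      | exact absurd h4.symm hbp
  have hsurj : Function.Surjective V := by
    rintro ⟨⟨y, hy⟩, hy0⟩
    rcases hy with rfl | ⟨x, rfl⟩
    · exact ⟨2, rfl⟩
    · have hx : Ω.dim x.1 = 0 := (s.dim x).symm.trans hy0
      rcases (hA _).1 (CutCells.meets_vertex hx x.2) with h | h
      · refine ⟨0, Subtype.ext (Subtype.ext (ha'.trans (congrArg s.emb (Subtype.ext ?_))))⟩
        exact (congrArg Subtype.val h).symm
      · refine ⟨1, Subtype.ext (Subtype.ext (hb'.trans (congrArg s.emb (Subtype.ext ?_))))⟩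
        exact (congrArg Subtype.val h).symm
  have hnext : ∀ i, (Ω'.sub s.part hC).next (V i) = V (finRotate 3 i) := by
    intro i
    refine subVertex_injective _ _ hC ?_
    rw [hV]
    refine (congrArg Ω'.next (hV i)).trans ?_
    fin_cases i
    · exact h1
    · exact h2
    · exact h3
  have hcross : ∀ x : {x // Ω.Meets A x}, s.point.1 ≤ s.emb x → ∃ c ∉ A, c.1 ≤ x.1 :=
    fun x hx => ((s.point_le x).1 hx).2
  refine ⟨⟨s.connected_part hC hconn, ?_, Equiv.ofBijective V ⟨hinj, hsurj⟩, ?_, hnext⟩, hV⟩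
  · intro p q r f hf hfp hq hr hpqr
    obtain ⟨i, rfl⟩ := hsurj p
    obtain ⟨j, rfl⟩ := hsurj q
    obtain ⟨k, rfl⟩ := hsurj r
    obtain ⟨rfl, rfl⟩ := eq_of_cyclicallyOrdered_three hinj hnext hpqr
    have hf01 : (f 0).1 < (f 1).1 := hf.1 (show (0 : Fin 3) < 1 by decide)
    have hf12 : (f 1).1 < (f 2).1 := hf.1 (show (1 : Fin 3) < 2 by decide)
    have hf0 : (f 0).1 = (![a', b', s.point] i : Ω'.Vertex).1 := by
      rw [hfp, ← hV i]
      rfl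
    have hq' : (![a', b', s.point] (i + 1) : Ω'.Vertex).1 ≤ (f 1).1 := by
      rw [← hV]
      exact hq
    have hr' : (![a', b', s.point] (i + 2) : Ω'.Vertex).1 ≤ (f 2).1 := by
      rw [← hV]
      exact hr
    have hmem : ∀ z, (f 0).1 < z → ∃ x, s.emb x = z := by
      intro z hz
      rcases (f 0).2 with h | ⟨x, hx⟩
      · exact s.point_upper z (h ▸ hz)
      · exact s.upper x z (by rw [hx]; exact hz.le)
    obtain ⟨x, hx⟩ := hmem _ hf01
    obtain ⟨y, hy⟩ := hmem _ (hf01.trans hf12)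
    have hff : (fun i => (f i).1) = ![(f 0).1, s.emb x, s.emb y] := by
      funext i
      fin_cases i
      · rfl
      · exact hx.symm
      · exact hy.symm
    have hfl : Ω'.IsFlag (n := 2) ![(f 0).1, s.emb x, s.emb y] := by
      rw [← hff]
      exact ⟨fun i j hij => hf.1 hij, hf.2⟩
    change Ω'.ori 1 (fun i => (f i).1) = 1
    rw [hff]
    rw [← hx] at hq'
    rw [← hy] at hr'
    rw [hf0] at hfl ⊢
    fin_cases i
    · replace hfl : Ω'.IsFlag (n := 2) ![a'.1, s.emb x, s.emb y] := hfl
      change Ω'.ori 1 ![a'.1, s.emb x, s.emb y] = 1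
      obtain ⟨c, hc, hcy⟩ := hcross y hr'
      have hbx : b'.1 ≤ s.emb x := hq'
      rw [ha'] at hfl ⊢
      rw [hb', s.emb.le_iff_le] at hbx
      obtain ⟨h4, h5⟩ := s.ori_emb haA hfl
      rw [h5]
      exact hcoh a b c _ h4 rfl hbx hcy (hcyc c hc).1
    · replace hfl : Ω'.IsFlag (n := 2) ![b'.1, s.emb x, s.emb y] := hfl
      change Ω'.ori 1 ![b'.1, s.emb x, s.emb y] = 1
      obtain ⟨c, hc, hcx⟩ := hcross x hq'
      have hay : a'.1 ≤ s.emb y := hr'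
      rw [hb'] at hfl ⊢
      rw [ha', s.emb.le_iff_le] at hay
      obtain ⟨h4, h5⟩ := s.ori_emb hbA hfl
      rw [h5]
      exact hcoh b c a _ h4 rfl hcx hay (hcyc c hc).2.1
    · replace hfl : Ω'.IsFlag (n := 2) ![s.point.1, s.emb x, s.emb y] := hfl
      change Ω'.ori 1 ![s.point.1, s.emb x, s.emb y] = 1
      obtain ⟨c, hc, hcx⟩ := hcross x
        (le_of_lt (hfl.1 (show (0 : Fin 3) < 1 by decide) : s.point.1 < s.emb x))
      have hax : a'.1 ≤ s.emb x := hq'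
      have hby : b'.1 ≤ s.emb y := hr'
      -- The edge `x` crosses the cut, from `a` to `c` in `Ω` and from `a'` to the new point in `Ω'`.
      -- In both complexes the flags at its two ends have opposite signs.
      have hfl' : Ω'.IsFlag (n := 2) ![a'.1, s.emb x, s.emb y] :=
        isFlag_cons_of_le (f := ![s.emb x, s.emb y]) hfl hax
      have h6 : Ω'.ori 1 ![a'.1, s.emb x, s.emb y] = - Ω'.ori 1 ![s.point.1, s.emb x, s.emb y] :=
        ori_cons_flip (c := Ω'.toColoredComplex) (f := ![s.emb x, s.emb y]) hfl hax hap.symm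
      rw [ha'] at hfl' h6
      rw [hb', s.emb.le_iff_le] at hby
      obtain ⟨h4, h5⟩ := s.ori_emb haA hfl'
      have h7 : Ω.ori 1 ![c.1, x.1, y.1] = - Ω.ori 1 ![a.1, x.1, y.1] :=
        ori_cons_flip (c := Ω.toColoredComplex) (f := ![x.1, y.1]) h4 hcx
          fun h => hc (h ▸ haA)
      have h8 := hcoh c a b _ (isFlag_cons_of_le (f := ![x.1, y.1]) h4 hcx) rfl
        (le_of_lt (h4.1 (show (0 : Fin 3) < 1 by decide) : a.1 < x.1)) hby (hcyc c hc).2.2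
      have h9 : Ω.ori 1 ![c.1, x.1, y.1] = 1 := h8
      rw [h9] at h7
      rw [h5] at h6
      rw [h7, h6, neg_neg]
  · intro i
    have h4 : (Ω'.sub s.part hC).cls (V i) = Ω'.cls (![a', b', s.point] i) := by
      rw [cls_sub, ← hV]
    refine Eq.trans ?_ h4.symm
    fin_cases i
    · exact cls_eq_of_iso (s.linkIso a haA a' ha')
    · exact cls_eq_of_iso (s.linkIso b hbA b' hb')
    · rfl

end Side

/-! ### The trilinear forms -/

section Trilinear

variable {𝕂 : Type v} [Field 𝕂] {G : Type w} [Group G] [Finite G] {D : ℕ} {S : Type u}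

variable (𝕂 G) in
/-- The sums over coverings as a multilinear form in the functions at the vertices. -/
def BraneComplex.partitionForm (Ω : BraneComplex (D + 1) S) :
    MultilinearMap 𝕂 (fun _ : Ω.Vertex => CoveringClass G D S → 𝕂) 𝕂 :=
  ∑ R : Frame G Ω.Cell, R.weight 𝕂 •
    (MultilinearMap.mkPiAlgebra 𝕂 Ω.Vertex 𝕂).compLinearMap fun q =>
      LinearMap.proj (Ω.frameInvariant q R)

theorem BraneComplex.partitionForm_apply (Ω : BraneComplex (D + 1) S)
    (X : Ω.Vertex → CoveringClass G D S → 𝕂) : Ω.partitionForm 𝕂 G X = Ω.partition X := by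
  simp [partitionForm, partition, integral]

open Classical in
variable (𝕂 G) in
/-- The trilinear form of the connected coherent complexes with three vertices with the given
vertex complexes; it is zero if there are none. -/
def tripleForm (σ : Fin 3 → ColorClass D S) :
    MultilinearMap 𝕂 (fun _ : Fin 3 => CoveringClass G D S → 𝕂) 𝕂 :=
  if h : CompatibleExists σ then
    (h.choose.partitionForm 𝕂 G).domDomCongr h.choose_spec.some.vert.symm
  else 0

theorem tripleForm_eq {σ : Fin 3 → ColorClass D S} {Ω : BraneComplex (D + 1) S}
    (e : Compatible Ω σ) (X : Fin 3 → CoveringClass G D S → 𝕂) :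
    tripleForm 𝕂 G σ X = Ω.partition fun q => X (e.vert.symm q) := by
  have h : CompatibleExists σ := ⟨Ω, ⟨e⟩⟩
  unfold tripleForm
  rw [dif_pos h, MultilinearMap.domDomCongr_apply, BraneComplex.partitionForm_apply]
  exact partition_three_vertices _ e X

theorem tripleForm_eq_zero {σ : Fin 3 → ColorClass D S} (h : ¬ CompatibleExists σ) :
    tripleForm 𝕂 G σ = 0 := dif_neg h

end Trilinear

/-! ### Cuts of complexes with four vertices -/

section Four

variable {D : ℕ} {S : Type u} {Ω Ω' : BraneComplex (D + 1) S} {σ : Fin 4 → ColorClass D S}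

theorem finRotate_four_pow (i j : Fin 4) : (finRotate 4 ^ (j - i).val) i = j := by
  decide +revert

theorem finRotate_four_pow_ne (i : Fin 4) : ∀ m < 4, 0 < m → (finRotate 4 ^ m) i ≠ i := by
  decide +revert

theorem Compatible.cyclicallyOrdered_four (e : Compatible Ω σ) {i j k : Fin 4}
    (h : 0 < (j - i).val ∧ (j - i).val < (k - i).val) :
    Ω.CyclicallyOrdered (e.vert i) (e.vert j) (e.vert k) :=
  e.cyclicallyOrdered _ _ h.1 h.2 (finRotate_four_pow i j) (finRotate_four_pow i k)
    fun m hm hm0 => finRotate_four_pow_ne i m (by omega) hm0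

theorem fin_four_order {i k : Fin 4} (h : k ≠ i) (h' : k ≠ i + 1) :
    (0 < (i + 1 - i).val ∧ (i + 1 - i).val < (k - i).val) ∧
    (0 < (k - (i + 1)).val ∧ (k - (i + 1)).val < (i - (i + 1)).val) ∧
    (0 < (i - k).val ∧ (i - k).val < (i + 1 - k).val) := by
  decide +revert

theorem Compatible.cyclicallyOrdered_of_ne (e : Compatible Ω σ) (i : Fin 4) {c : Ω.Vertex}
    (h : c ≠ e.vert i) (h' : c ≠ e.vert (i + 1)) :
    Ω.CyclicallyOrdered (e.vert i) (e.vert (i + 1)) c ∧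
      Ω.CyclicallyOrdered (e.vert (i + 1)) c (e.vert i) ∧
      Ω.CyclicallyOrdered c (e.vert i) (e.vert (i + 1)) := by
  obtain ⟨k, rfl⟩ := e.vert.surjective c
  obtain ⟨h1, h2, h3⟩ := fin_four_order (fun hk => h (congrArg e.vert hk))
    (fun hk => h' (congrArg e.vert hk))
  exact ⟨e.cyclicallyOrdered_four h1, e.cyclicallyOrdered_four h2, e.cyclicallyOrdered_four h3⟩

theorem CutCells.mem_leftSide_part_iff (η : CutCells Ω Ω') (x y : Ω'.Cell) (h : x ≤ y) :
    x ∈ η.leftSide.part ↔ y ∈ η.leftSide.part := by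
  constructor
  · intro hx
    obtain ⟨u, hu⟩ := η.isAmalgam_sides.upperU ⟨x, hx⟩ y h
    exact hu ▸ u.2
  · intro hy
    rcases η.isAmalgam_sides.cover x with ⟨u, hu⟩ | ⟨v, hv⟩
    · exact hu ▸ u.2
    · obtain ⟨v', hv'⟩ := η.isAmalgam_sides.upperV v y (hv ▸ h)
      obtain ⟨z, -⟩ := η.isAmalgam_sides.pull ⟨y, hy⟩ v' hv'.symm
      exact z.elim0

theorem CutCells.mem_rightSide_part_iff_notMem (η : CutCells Ω Ω') (x : Ω'.Cell) :
    x ∈ η.rightSide.part ↔ x ∉ η.leftSide.part := by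
  constructor
  · intro hx hx'
    obtain ⟨z, -⟩ := η.isAmalgam_sides.pull ⟨x, hx'⟩ ⟨x, hx⟩ rfl
    exact z.elim0
  · intro hx
    rcases η.isAmalgam_sides.cover x with ⟨u, hu⟩ | ⟨v, hv⟩
    · exact absurd (hu ▸ u.2) hx
    · exact hv ▸ v.2

theorem CutCells.mem_rightSide_part_iff (η : CutCells Ω Ω') (x y : Ω'.Cell) (h : x ≤ y) :
    x ∈ η.rightSide.part ↔ y ∈ η.rightSide.part := by
  rw [η.mem_rightSide_part_iff_notMem, η.mem_rightSide_part_iff_notMem,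
    η.mem_leftSide_part_iff x y h]

variable {𝕂 : Type v} [Field 𝕂] [CharZero 𝕂] {G : Type w} [Group G] [Finite G]

/-- A cut that separates two neighboring vertices from the two others gives a complex with two
components with three vertices each. -/
theorem CutMorphism.partition_eq_mul (η : CutMorphism Ω Ω') (e : Compatible Ω σ)
    (hA : η.A = {e.vert 0, e.vert 1}) (X : Ω'.Vertex → CoveringClass G D S → 𝕂) :
    Ω'.partition X =
      tripleForm 𝕂 G ![σ 0, σ 1, Ω'.cls η.plus]
        ![X (η.vert (e.vert 0)), X (η.vert (e.vert 1)), X η.plus] *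
      tripleForm 𝕂 G ![Ω'.cls η.minus, σ 2, σ 3]
        ![X η.minus, X (η.vert (e.vert 2)), X (η.vert (e.vert 3))] := by
  have hv : ∀ {i j : Fin 4}, i ≠ j → e.vert i ≠ e.vert j := fun h h' => h (e.vert.injective h')
  have hl : ∀ q, q ∈ η.A ↔ q = e.vert 0 ∨ q = e.vert 1 := fun q => by
    rw [hA]
    exact Iff.rfl
  have hr : ∀ q, q ∈ η.Aᶜ ↔ q = e.vert 2 ∨ q = e.vert 3 := fun q => by
    obtain ⟨i, rfl⟩ := e.vert.surjective q
    rw [Set.mem_compl_iff, hl]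
    simp only [e.vert.injective.eq_iff]
    decide +revert
  have m0 : e.vert 0 ∈ η.A := (hl _).2 (Or.inl rfl)
  have m1 : e.vert 1 ∈ η.A := (hl _).2 (Or.inr rfl)
  have m2 : e.vert 2 ∉ η.A := (hr _).2 (Or.inl rfl)
  have m3 : e.vert 3 ∉ η.A := (hr _).2 (Or.inr rfl)
  have n0 : Ω.next (e.vert 0) = e.vert 1 := e.next 0
  have n1 : Ω.next (e.vert 1) = e.vert 2 := e.next 1
  have n2 : Ω.next (e.vert 2) = e.vert 3 := e.next 2
  have n3 : Ω.next (e.vert 3) = e.vert 0 := e.next 3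
  have s0 := η.next_same (e.vert 0) (by rw [n0]; exact iff_of_true m0 m1)
  have s2 := η.next_same (e.vert 2) (by rw [n2]; exact iff_of_false m2 m3)
  have s1 := η.next_leave (e.vert 1) m1 (by rw [n1]; exact m2)
  have s3 := η.next_enter (e.vert 3) m3 (by rw [n3]; exact m0)
  rw [n0] at s0
  rw [n1] at s1
  rw [n2] at s2
  rw [n3] at s3
  have hcut := Ω.hasCut _ η.arc
  have hconn : ConnectedOn {x | Ω.Meets η.Aᶜ x} := by
    have h1 : {x | Ω.Meets η.Aᶜ x} =
        {x | Ω.Meets η.Aᶜ x ∧ ∃ a ∈ η.A, SameComponent a.1 x} :=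
      Set.ext fun x => ⟨fun h => ⟨h, _, m0, e.connected.sameComponent _ _⟩, fun h => h.1⟩
    rw [h1]
    exact hcut.connected_right
  obtain ⟨eL, hL⟩ := η.leftSide.compatible η.mem_leftSide_part_iff hl (hv (by decide))
    hcut.connected_left e.coherent
    (fun c hc => e.cyclicallyOrdered_of_ne 0 (fun h => hc (h ▸ m0)) fun h => hc (h ▸ m1))
    (η.vert_of_mem m0) (η.vert_of_mem m1) s0 s1.1 s3.2
  obtain ⟨eR, hR⟩ := η.rightSide.compatible η.mem_rightSide_part_iff hr (hv (by decide))
    hconn e.coherent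
    (fun c hc => e.cyclicallyOrdered_of_ne 2 (fun h => hc (h ▸ m2)) fun h => hc (h ▸ m3))
    (η.vert_of_notMem m2) (η.vert_of_notMem m3) s2 s3.1 s1.2
  have eL' : Σ' e' : Compatible (Ω'.sub _ η.mem_leftSide_part_iff)
      ![σ 0, σ 1, Ω'.cls η.plus], ∀ i, e'.vert i = eL.vert i :=
    ⟨eL.congr fun i => by
      fin_cases i
      · exact e.cls 0
      · exact e.cls 1
      · rfl, fun _ => rfl⟩
  -- `CutSide.compatible` puts the new vertex last; on the right side it has to come first
  have eR' : Σ' e' : Compatible (Ω'.sub _ η.mem_rightSide_part_iff)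
      ![Ω'.cls η.minus, σ 2, σ 3], ∀ i, e'.vert i = eR.vert (finRotate 3 (finRotate 3 i)) :=
    ⟨eR.rotate.rotate.congr fun i => by
      fin_cases i
      · rfl
      · exact e.cls 2
      · exact e.cls 3, fun _ => rfl⟩
  rw [(disjointUnionSub Ω' _ η.mem_leftSide_part_iff _ η.mem_rightSide_part_iff
    η.mem_rightSide_part_iff_notMem).partition_eq, tripleForm_eq eL'.1, tripleForm_eq eR'.1]
  congr 2
  · funext q
    obtain ⟨i, rfl⟩ := eL'.1.vert.surjective q
    rw [Equiv.symm_apply_apply]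
    refine (congrArg X ((congrArg _ (eL'.2 i)).trans (hL i))).trans ?_
    fin_cases i <;> rfl
  · funext q
    obtain ⟨i, rfl⟩ := eR'.1.vert.surjective q
    rw [Equiv.symm_apply_apply]
    refine (congrArg X ((congrArg _ (eR'.2 i)).trans (hR _))).trans ?_
    fin_cases i <;> rfl

/-- The sums over coverings of a complex with four vertices in terms of the trilinear forms. -/
theorem partition_four_vertices (e : Compatible Ω σ) {τ : ColorClass D S}
    (hτ : IsCutClass Ω {e.vert 0, e.vert 1} τ) (X : Fin 4 → CoveringClass G D S → 𝕂) :
    Ω.partition (fun q => X (e.vert.symm q)) = ∑ γ : Upsilon G τ, (classNorm 𝕂 γ.1)⁻¹ *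
      (tripleForm 𝕂 G ![σ 0, σ 1, τ] ![X 0, X 1, classFun (Finsupp.single γ 1)] *
        tripleForm 𝕂 G ![τ.star, σ 2, σ 3] ![classFun (Finsupp.single γ.star 1), X 2, X 3]) := by
  classical
  obtain ⟨Ω', η, hA, rfl⟩ := hτ
  rw [η.partition_eq_sum (fun q => X (e.vert.symm q))
    (Function.extend η.vert (fun q => X (e.vert.symm q)) 0)
    fun q => η.vert_injective.extend_apply _ _ q]
  refine Finset.sum_congr rfl fun γ _ => ?_
  rw [η.partition_eq_mul e hA, η.cls_minus]
  simp only [Function.update_of_ne (η.vert_ne_minus _), Function.update_of_ne (η.vert_ne_plus _),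
    η.vert_injective.extend_apply, Equiv.symm_apply_apply, Function.update_self,
    Function.update_of_ne η.plus_ne_minus]

end Four

/-! ### Bilinear and trilinear forms on direct sums -/

section Forms

variable {𝕂 : Type v} [Field 𝕂]

/-- The trilinear form of a multilinear form in three variables. -/
def trilinear {F : Type*} [AddCommGroup F] [Module 𝕂 F]
    (M : MultilinearMap 𝕂 (fun _ : Fin 3 => F) 𝕂) : F →ₗ[𝕂] F →ₗ[𝕂] F →ₗ[𝕂] 𝕂 :=
  have h0 : ∀ a x y z : F, Function.update ![a, y, z] 0 x = ![x, y, z] := fun a x y z => by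
    funext i
    fin_cases i <;> rfl
  have h1 : ∀ a x y z : F, Function.update ![x, a, z] 1 y = ![x, y, z] := fun a x y z => by
    funext i
    fin_cases i <;> rfl
  have h2 : ∀ a x y z : F, Function.update ![x, y, a] 2 z = ![x, y, z] := fun a x y z => by
    funext i
    fin_cases i <;> rfl
  LinearMap.mk₂ 𝕂 (fun x y => M.toLinearMap ![x, y, 0] 2)
    (fun x x' y => LinearMap.ext fun z => by
      have := M.map_update_add ![0, y, z] 0 x x'
      simpa [h0, h2] using this)
    (fun c x y => LinearMap.ext fun z => by
      have := M.map_update_smul ![0, y, z] 0 c x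
      simpa [h0, h2] using this)
    (fun x y y' => LinearMap.ext fun z => by
      have := M.map_update_add ![x, 0, z] 1 y y'
      simpa [h1, h2] using this)
    (fun c x y => LinearMap.ext fun z => by
      have := M.map_update_smul ![x, 0, z] 1 c y
      simpa [h1, h2] using this)

theorem trilinear_apply {F : Type*} [AddCommGroup F] [Module 𝕂 F]
    (M : MultilinearMap 𝕂 (fun _ : Fin 3 => F) 𝕂) (x y z : F) :
    trilinear M x y z = M ![x, y, z] := by
  refine congrArg M (funext fun i => ?_)
  fin_cases i <;> rfl

variable {ι : Type*} [DecidableEq ι] {B : ι → Type*} [∀ i, AddCommGroup (B i)]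
  [∀ i, Module 𝕂 (B i)]

/-- The bilinear form on a direct sum with given components. -/
def liftPair (f : ∀ i j, B i →ₗ[𝕂] B j →ₗ[𝕂] 𝕂) : (⨁ i, B i) →ₗ[𝕂] (⨁ i, B i) →ₗ[𝕂] 𝕂 :=
  DirectSum.toModule 𝕂 ι _ fun i =>
    (DirectSum.toModule 𝕂 ι _ fun j => (f i j).flip).flip

theorem liftPair_lof (f : ∀ i j, B i →ₗ[𝕂] B j →ₗ[𝕂] 𝕂) (i j : ι) (x : B i) (y : B j) :
    liftPair f (DirectSum.lof 𝕂 ι B i x) (DirectSum.lof 𝕂 ι B j y) = f i j x y := by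
  unfold liftPair
  rw [DirectSum.toModule_lof, LinearMap.flip_apply, DirectSum.toModule_lof, LinearMap.flip_apply]

/-- The trilinear form on a direct sum with given components. -/
def liftTriple (f : ∀ i j k, B i →ₗ[𝕂] B j →ₗ[𝕂] B k →ₗ[𝕂] 𝕂) :
    (⨁ i, B i) →ₗ[𝕂] (⨁ i, B i) →ₗ[𝕂] (⨁ i, B i) →ₗ[𝕂] 𝕂 :=
  DirectSum.toModule 𝕂 ι _ fun i => (DirectSum.toModule 𝕂 ι _ fun j =>
    (TensorProduct.curry
      (DirectSum.toModule 𝕂 ι _ fun k => (TensorProduct.lift (f i j k)).flip).flip).flip).flip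

theorem liftTriple_lof (f : ∀ i j k, B i →ₗ[𝕂] B j →ₗ[𝕂] B k →ₗ[𝕂] 𝕂) (i j k : ι) (x : B i)
    (y : B j) (z : B k) :
    liftTriple f (DirectSum.lof 𝕂 ι B i x) (DirectSum.lof 𝕂 ι B j y)
      (DirectSum.lof 𝕂 ι B k z) = f i j k x y z := by
  unfold liftTriple
  rw [DirectSum.toModule_lof, LinearMap.flip_apply, DirectSum.toModule_lof, LinearMap.flip_apply,
    TensorProduct.curry_apply, LinearMap.flip_apply, DirectSum.toModule_lof, LinearMap.flip_apply,
    TensorProduct.lift.tmul]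

/-- The tensor given by the inverse matrix of a nondegenerate form in a pair of bases does not
depend on the bases: it turns the functional `w = p z` on `W` into the vector `z`. -/
theorem sum_inverse_matrix {V W : Type*} [AddCommGroup V] [Module 𝕂 V] [AddCommGroup W]
    [Module 𝕂 W] (p : V →ₗ[𝕂] W →ₗ[𝕂] 𝕂) (hp : ∀ x, (∀ y, p x y = 0) → x = 0) {m : ℕ}
    (b : Module.Basis (Fin m) 𝕂 V) (b' : Module.Basis (Fin m) 𝕂 W) (u : V →ₗ[𝕂] 𝕂)
    (w : W →ₗ[𝕂] 𝕂) (z : V) (hz : ∀ y, p z y = w y) :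
    ∑ i, ∑ j, u (b i) * (Matrix.of fun i j => p (b i) (b' j)).transpose⁻¹ i j * w (b' j) =
      u z := by
  set N : Matrix (Fin m) (Fin m) 𝕂 := (Matrix.of fun i j => p (b i) (b' j)).transpose with hN
  have hsep : ∀ t : Fin m → 𝕂, ∀ y : V, (∀ j, (N.mulVec t) j = p y (b' j)) →
      ∑ i, t i • b i = y := by
    intro t y ht
    refine sub_eq_zero.1 (hp _ fun y' => ?_)
    have h0 : p (∑ i, t i • b i - y) = 0 := by
      refine b'.ext fun j => ?_
      have h1 := ht j
      simp only [Matrix.mulVec, dotProduct, hN, Matrix.transpose_apply, Matrix.of_apply] at h1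
      simp only [map_sub, map_sum, map_smul, LinearMap.sub_apply, LinearMap.sum_apply,
        LinearMap.smul_apply, smul_eq_mul, LinearMap.zero_apply, ← h1]
      rw [sub_eq_zero]
      exact Finset.sum_congr rfl fun i _ => mul_comm _ _
    rw [h0, LinearMap.zero_apply]
  have hunit : IsUnit N := by
    rw [← Matrix.mulVec_injective_iff_isUnit]
    intro t t' htt
    have h1 : ∑ i, (t - t') i • b i = 0 := hsep _ 0 fun j => by
      rw [Matrix.mulVec_sub, htt, sub_self]
      simp
    have h2 := fun i => Fintype.linearIndependent_iff.1 b.linearIndependent _ h1 i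
    exact sub_eq_zero.1 (funext h2)
  have hmul : N * N⁻¹ = 1 := Matrix.mul_nonsing_inv _ ((Matrix.isUnit_iff_isUnit_det _).1 hunit)
  have h3 := hsep (N⁻¹.mulVec fun j => w (b' j)) z fun j => by
    rw [Matrix.mulVec_mulVec, hmul, Matrix.one_mulVec, hz]
  rw [← h3, map_sum]
  refine Finset.sum_congr rfl fun i _ => ?_
  rw [map_smul, smul_eq_mul, Matrix.mulVec, dotProduct, Finset.sum_mul]
  exact Finset.sum_congr rfl fun j _ => by ring

end Forms

/-! ### The algebra of `G`-coverings -/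

section Foam

variable {𝕂 : Type v} [Field 𝕂] {G : Type w} [Group G] {D : ℕ} {S : Type u}

variable (𝕂 G) in
/-- Vectors of `C_σ^G` as functions on all classes of coverings. -/
def classFunₗ (σ : ColorClass D S) : hurwitzSpace 𝕂 G σ →ₗ[𝕂] CoveringClass G D S → 𝕂 where
  toFun := classFun
  map_add' x y := by
    funext β
    by_cases h : β.base = σ <;> simp [classFun, h]
  map_smul' c x := by
    funext β
    by_cases h : β.base = σ <;> simp [classFun, h]

theorem classFun_of_base_ne {σ : ColorClass D S} (x : hurwitzSpace 𝕂 G σ)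
    {β : CoveringClass G D S} (h : β.base ≠ σ) : classFun x β = 0 := dif_neg h

variable [Finite G]

variable (𝕂 G) in
/-- The form of the complexes with two vertices, as a form on `C_σ^G × C_τ^G`; it is zero unless
`τ` is the class inverse to `σ`. -/
def foamPair (σ τ : ColorClass D S) :
    hurwitzSpace 𝕂 G σ →ₗ[𝕂] hurwitzSpace 𝕂 G τ →ₗ[𝕂] 𝕂 :=
  ∑ γ : Upsilon G σ, classNorm 𝕂 γ.1 •
    (LinearMap.mul 𝕂 𝕂).compl₁₂ (LinearMap.proj γ.1 ∘ₗ classFunₗ 𝕂 G σ)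
      (LinearMap.proj γ.1.star ∘ₗ classFunₗ 𝕂 G τ)

theorem foamPair_apply {σ τ : ColorClass D S} (x : hurwitzSpace 𝕂 G σ)
    (y : hurwitzSpace 𝕂 G τ) : foamPair 𝕂 G σ τ x y =
      ∑ γ : Upsilon G σ, classFun x γ.1 * classFun y γ.1.star * classNorm 𝕂 γ.1 := by
  simp only [foamPair, LinearMap.sum_apply, LinearMap.smul_apply, smul_eq_mul]
  exact Finset.sum_congr rfl fun γ _ => mul_comm _ _

theorem foamPair_eq_zero {σ τ : ColorClass D S} (h : σ ≠ τ.star) (x : hurwitzSpace 𝕂 G σ)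
    (y : hurwitzSpace 𝕂 G τ) : foamPair 𝕂 G σ τ x y = 0 := by
  rw [foamPair_apply]
  refine Finset.sum_eq_zero fun γ _ => ?_
  rw [classFun_of_base_ne y, mul_zero, zero_mul]
  rw [γ.1.base_star, γ.2]
  rintro rfl
  exact h σ.star_star.symm

theorem foamPair_single_right {σ τ : ColorClass D S} (x : hurwitzSpace 𝕂 G σ) {δ : Upsilon G τ}
    {γ : CoveringClass G D S} (h : γ.star = δ.1) :
    foamPair 𝕂 G σ τ x (Finsupp.single δ 1) = classFun x γ * classNorm 𝕂 γ := by
  rw [foamPair_apply]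
  by_cases hγ : γ.base = σ
  · rw [Finset.sum_eq_single ⟨γ, hγ⟩]
    · rw [classFun_single, if_pos h, mul_one]
    · intro γ' _ hne
      rw [classFun_single, if_neg, mul_zero, zero_mul]
      intro h'
      refine hne (Subtype.ext ?_)
      rw [← γ'.1.star_star, h', ← h, CoveringClass.star_star]
    · simp
  · rw [classFun_of_base_ne x hγ, zero_mul]
    refine Finset.sum_eq_zero fun γ' _ => ?_
    rw [classFun_single, if_neg, mul_zero, zero_mul]
    intro h'
    refine hγ ?_
    rw [← γ.star_star, h, ← h', CoveringClass.star_star, γ'.2]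

theorem foamPair_single_left {σ τ : ColorClass D S} (γ : Upsilon G σ) (y : hurwitzSpace 𝕂 G τ) :
    foamPair 𝕂 G σ τ (Finsupp.single γ 1) y = classFun y γ.1.star * classNorm 𝕂 γ.1 := by
  rw [foamPair_apply, Finset.sum_eq_single γ]
  · rw [classFun_single, if_pos rfl, one_mul]
  · intro γ' _ hne
    rw [classFun_single, if_neg fun h => hne (Subtype.ext h), zero_mul, zero_mul]
  · simp

variable (𝕂 G) in
/-- The form of the complexes with three vertices, as a form on `C_ρ^G × C_σ^G × C_τ^G`. -/
def foamTriple (ρ σ τ : ColorClass D S) :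
    hurwitzSpace 𝕂 G ρ →ₗ[𝕂] hurwitzSpace 𝕂 G σ →ₗ[𝕂] hurwitzSpace 𝕂 G τ →ₗ[𝕂] 𝕂 :=
  ((trilinear (tripleForm 𝕂 G ![ρ, σ, τ])).compl₁₂ (classFunₗ 𝕂 G ρ) (classFunₗ 𝕂 G σ)).compr₂
    (LinearMap.lcomp 𝕂 𝕂 (classFunₗ 𝕂 G τ))

theorem foamTriple_apply {ρ σ τ : ColorClass D S} (x : hurwitzSpace 𝕂 G ρ)
    (y : hurwitzSpace 𝕂 G σ) (z : hurwitzSpace 𝕂 G τ) : foamTriple 𝕂 G ρ σ τ x y z =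
      tripleForm 𝕂 G ![ρ, σ, τ] ![classFun x, classFun y, classFun z] :=
  trilinear_apply _ _ _ _

open Classical in
/-- Vectors of the algebra as functions on all classes of coverings. -/
def foamFun : (⨁ σ : AdmissibleClass D S, hurwitzSpace 𝕂 G σ.1) →ₗ[𝕂]
    CoveringClass G D S → 𝕂 :=
  DirectSum.toModule 𝕂 _ _ fun σ => classFunₗ 𝕂 G σ.1

omit [Finite G] in
open Classical in
theorem foamFun_lof (σ : AdmissibleClass D S) (x : hurwitzSpace 𝕂 G σ.1) :
    foamFun (DirectSum.lof 𝕂 _ (fun σ : AdmissibleClass D S => hurwitzSpace 𝕂 G σ.1) σ x) =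
      classFun x :=
  DirectSum.toModule_lof (M := fun σ : AdmissibleClass D S => hurwitzSpace 𝕂 G σ.1) 𝕂 σ x

omit [Finite G] in
theorem foamFun_apply (X : ⨁ σ : AdmissibleClass D S, hurwitzSpace 𝕂 G σ.1)
    (σ : AdmissibleClass D S) (γ : Upsilon G σ.1) : foamFun X γ.1 = X σ γ := by
  classical
  induction X using DirectSum.induction_on with
  | zero => simp
  | of τ x =>
    refine (congrFun (foamFun_lof τ x) γ.1).trans ?_
    by_cases h : τ = σ
    · subst h
      rw [DirectSum.of_eq_same, classFun_of_base x γ.2]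
    · rw [DirectSum.of_eq_of_ne _ _ _ (Ne.symm h), classFun_of_base_ne x, Finsupp.zero_apply]
      rw [γ.2]
      exact fun h' => h (Subtype.ext h').symm
  | add X Y hX hY =>
    rw [map_add, Pi.add_apply, hX, hY, DirectSum.add_apply, Finsupp.add_apply]

open Classical in
variable (𝕂 G D S) in
/-- The bilinear form of the algebra. -/
def foamBilinear : (⨁ σ : AdmissibleClass D S, hurwitzSpace 𝕂 G σ.1) →ₗ[𝕂]
    (⨁ σ : AdmissibleClass D S, hurwitzSpace 𝕂 G σ.1) →ₗ[𝕂] 𝕂 :=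
  liftPair fun σ τ => foamPair 𝕂 G σ.1 τ.1

open Classical in
variable (𝕂 G D S) in
/-- The trilinear form of the algebra. -/
def foamTrilinear : (⨁ σ : AdmissibleClass D S, hurwitzSpace 𝕂 G σ.1) →ₗ[𝕂]
    (⨁ σ : AdmissibleClass D S, hurwitzSpace 𝕂 G σ.1) →ₗ[𝕂]
    (⨁ σ : AdmissibleClass D S, hurwitzSpace 𝕂 G σ.1) →ₗ[𝕂] 𝕂 :=
  liftTriple fun ρ σ τ => foamTriple 𝕂 G ρ.1 σ.1 τ.1

open Classical in
theorem foamBilinear_single_right (X : ⨁ σ : AdmissibleClass D S, hurwitzSpace 𝕂 G σ.1)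
    (τ : AdmissibleClass D S) (δ : Upsilon G τ.1) {γ : CoveringClass G D S} (h : γ.star = δ.1) :
    foamBilinear 𝕂 G D S X (DirectSum.lof 𝕂 _
      (fun σ : AdmissibleClass D S => hurwitzSpace 𝕂 G σ.1) τ (Finsupp.single δ 1)) =
      foamFun X γ * classNorm 𝕂 γ := by
  induction X using DirectSum.induction_on with
  | zero => simp
  | of σ x =>
    refine (liftPair_lof (B := fun σ : AdmissibleClass D S => hurwitzSpace 𝕂 G σ.1)
      (fun σ τ => foamPair 𝕂 G σ.1 τ.1) σ τ x (Finsupp.single δ 1)).trans ?_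
    rw [foamPair_single_right x h]
    exact congrArg (· * classNorm 𝕂 γ) (congrFun (foamFun_lof σ x) γ).symm
  | add X Y hX hY => rw [map_add, LinearMap.add_apply, hX, hY, map_add, Pi.add_apply, add_mul]

open Classical in
theorem foamBilinear_single_left (Y : ⨁ σ : AdmissibleClass D S, hurwitzSpace 𝕂 G σ.1)
    (σ : AdmissibleClass D S) (γ : Upsilon G σ.1) :
    foamBilinear 𝕂 G D S (DirectSum.lof 𝕂 _
      (fun σ : AdmissibleClass D S => hurwitzSpace 𝕂 G σ.1) σ (Finsupp.single γ 1)) Y =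
      foamFun Y γ.1.star * classNorm 𝕂 γ.1 := by
  induction Y using DirectSum.induction_on with
  | zero => simp
  | of τ y =>
    refine (liftPair_lof (B := fun σ : AdmissibleClass D S => hurwitzSpace 𝕂 G σ.1)
      (fun σ τ => foamPair 𝕂 G σ.1 τ.1) σ τ (Finsupp.single γ 1) y).trans ?_
    rw [foamPair_single_left γ y]
    exact congrArg (· * classNorm 𝕂 γ.1) (congrFun (foamFun_lof τ y) γ.1.star).symm
  | add X Y hX hY => rw [map_add, hX, hY, map_add, Pi.add_apply, add_mul]

variable [CharZero 𝕂]

theorem foamBilinear_nondegenerate : (foamBilinear 𝕂 G D S).Nondegenerate := by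
  classical
  constructor
  · intro X hX
    refine DFinsupp.ext fun σ => Finsupp.ext fun γ => ?_
    have h := hX (DirectSum.lof 𝕂 _ (fun σ : AdmissibleClass D S => hurwitzSpace 𝕂 G σ.1)
      σ.star (Finsupp.single γ.star 1))
    have h' := foamBilinear_single_right X σ.star γ.star (γ := γ.1) rfl
    have h2 : foamFun X γ.1 * classNorm 𝕂 γ.1 = 0 := by
      rw [← h']
      convert h
    rw [foamFun_apply] at h2
    exact (mul_eq_zero.1 h2).resolve_right (classNorm_ne_zero _)
  · intro Y hY
    refine DFinsupp.ext fun σ => Finsupp.ext fun γ => ?_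
    have h := hY (DirectSum.lof 𝕂 _ (fun σ : AdmissibleClass D S => hurwitzSpace 𝕂 G σ.1)
      σ.star (Finsupp.single γ.star 1))
    have h' := foamBilinear_single_left Y σ.star γ.star
    have h2 : foamFun Y γ.1 * classNorm 𝕂 γ.star.1 = 0 := by
      have h3 : γ.star.1.star = γ.1 := γ.1.star_star
      rw [← h3, ← h']
      convert h
    rw [foamFun_apply] at h2
    exact (mul_eq_zero.1 h2).resolve_right (classNorm_ne_zero _)

omit [CharZero 𝕂] in
open Classical in
theorem foamTrilinear_lof (σ : Fin 3 → AdmissibleClass D S)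
    (x : ∀ i, hurwitzSpace 𝕂 G (σ i).1) :
    foamTrilinear 𝕂 G D S
      (DirectSum.lof 𝕂 _ (fun σ : AdmissibleClass D S => hurwitzSpace 𝕂 G σ.1) (σ 0) (x 0))
      (DirectSum.lof 𝕂 _ (fun σ : AdmissibleClass D S => hurwitzSpace 𝕂 G σ.1) (σ 1) (x 1))
      (DirectSum.lof 𝕂 _ (fun σ : AdmissibleClass D S => hurwitzSpace 𝕂 G σ.1) (σ 2) (x 2)) =
      tripleForm 𝕂 G (fun i => (σ i).1) fun i => classFun (x i) := by
  refine (liftTriple_lof (B := fun σ : AdmissibleClass D S => hurwitzSpace 𝕂 G σ.1)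
    (fun ρ σ τ => foamTriple 𝕂 G ρ.1 σ.1 τ.1) _ _ _ (x 0) (x 1) (x 2)).trans ?_
  rw [foamTriple_apply]
  have h1 : ![(σ 0).1, (σ 1).1, (σ 2).1] = fun i => (σ i).1 := by
    funext i
    fin_cases i <;> rfl
  have h2 : ![classFun (x 0), classFun (x 1), classFun (x 2)] = fun i => classFun (x i) := by
    funext i
    fin_cases i <;> rfl
  rw [h1, h2]

open Classical in
/-- The sum of the associativity axiom is the sum over coverings of the complex with four
vertices. -/
theorem sum_foamTrilinear {σ₀ σ₁ σ₂ σ₃ : AdmissibleClass D S} {Ω : BraneComplex (D + 1) S}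
    (e : Compatible Ω ![σ₀.1, σ₁.1, σ₂.1, σ₃.1]) (τ : AdmissibleClass D S)
    (hτ : IsCutClass Ω {e.vert 0, e.vert 1} τ.1) (x₀ : hurwitzSpace 𝕂 G σ₀.1)
    (x₁ : hurwitzSpace 𝕂 G σ₁.1) (x₂ : hurwitzSpace 𝕂 G σ₂.1) (x₃ : hurwitzSpace 𝕂 G σ₃.1) {m : ℕ}
    (b : Module.Basis (Fin m) 𝕂 (hurwitzSpace 𝕂 G τ.1))
    (b' : Module.Basis (Fin m) 𝕂 (hurwitzSpace 𝕂 G τ.star.1)) :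
    let X := DirectSum.lof 𝕂 _ (fun σ : AdmissibleClass D S => hurwitzSpace 𝕂 G σ.1)
    let b₁ := fun i => DirectSum.lof 𝕂 _
      (fun σ : AdmissibleClass D S => hurwitzSpace 𝕂 G σ.1) τ (b i)
    let b₂ := fun i => DirectSum.lof 𝕂 _
      (fun σ : AdmissibleClass D S => hurwitzSpace 𝕂 G σ.1) τ.star (b' i)
    ∑ i, ∑ j, foamTrilinear 𝕂 G D S (X σ₀ x₀) (X σ₁ x₁) (b₁ i) *
      (Matrix.of fun i j => foamBilinear 𝕂 G D S (b₁ i) (b₂ j)).transpose⁻¹ i j *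
      foamTrilinear 𝕂 G D S (b₂ j) (X σ₂ x₂) (X σ₃ x₃) =
      Ω.partition fun q =>
        (![classFun x₀, classFun x₁, classFun x₂, classFun x₃] : Fin 4 → _) (e.vert.symm q) := by
  intro X b₁ b₂
  let p := foamPair 𝕂 G τ.1 τ.1.star
  let u := foamTriple 𝕂 G σ₀.1 σ₁.1 τ.1 x₀ x₁
  let w := ((foamTriple 𝕂 G τ.1.star σ₂.1 σ₃.1).flip x₂).flip x₃
  have hu : ∀ i, foamTrilinear 𝕂 G D S (X σ₀ x₀) (X σ₁ x₁) (b₁ i) = u (b i) := fun i =>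
    liftTriple_lof (B := fun σ : AdmissibleClass D S => hurwitzSpace 𝕂 G σ.1)
      (fun ρ σ τ => foamTriple 𝕂 G ρ.1 σ.1 τ.1) _ _ _ _ _ _
  have hw : ∀ j, foamTrilinear 𝕂 G D S (b₂ j) (X σ₂ x₂) (X σ₃ x₃) = w (b' j) := fun j =>
    liftTriple_lof (B := fun σ : AdmissibleClass D S => hurwitzSpace 𝕂 G σ.1)
      (fun ρ σ τ => foamTriple 𝕂 G ρ.1 σ.1 τ.1) _ _ _ _ _ _
  have hp : ∀ i j, foamBilinear 𝕂 G D S (b₁ i) (b₂ j) = p (b i) (b' j) := fun i j =>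
    liftPair_lof (B := fun σ : AdmissibleClass D S => hurwitzSpace 𝕂 G σ.1)
      (fun σ τ => foamPair 𝕂 G σ.1 τ.1) _ _ _ _
  -- the vector that represents the functional `w`
  let z : hurwitzSpace 𝕂 G τ.1 :=
    ∑ γ : Upsilon G τ.1, ((classNorm 𝕂 γ.1)⁻¹ * w (Finsupp.single γ.star 1)) •
      Finsupp.single γ 1
  have hpz : p z = w := by
    refine Finsupp.basisSingleOne.ext fun δ => ?_
    rw [Finsupp.coe_basisSingleOne]
    simp only [z, map_sum, map_smul, LinearMap.sum_apply, LinearMap.smul_apply, smul_eq_mul]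
    have hδ : δ.1.star.base = τ.1 := by rw [δ.1.base_star, δ.2, ColorClass.star_star]
    rw [Finset.sum_eq_single ⟨δ.1.star, hδ⟩]
    · have h1 : Upsilon.star (⟨δ.1.star, hδ⟩ : Upsilon G τ.1) = δ :=
        Subtype.ext δ.1.star_star
      rw [h1, foamPair_single_left, CoveringClass.star_star, classFun_single, if_pos rfl, one_mul,
        mul_right_comm, inv_mul_cancel₀ (classNorm_ne_zero _), one_mul]
    · intro γ _ hne
      rw [foamPair_single_left, classFun_single, if_neg, zero_mul, mul_zero]
      intro h
      exact hne (Subtype.ext (γ.1.star_star.symm.trans (congrArg CoveringClass.star h)))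
    · simp
  have hsep : ∀ y, (∀ y', p y y' = 0) → y = 0 := by
    intro y hy
    refine Finsupp.ext fun γ => ?_
    have h1 := hy (Finsupp.single γ.star 1)
    rw [foamPair_single_right y (γ := γ.1) rfl, classFun_of_base y γ.2] at h1
    exact (mul_eq_zero.1 h1).resolve_right (classNorm_ne_zero _)
  simp only [hu, hw, hp]
  refine (sum_inverse_matrix p hsep b b' u w z fun y => by rw [hpz]).trans ?_
  rw [partition_four_vertices e hτ]
  simp only [z, map_sum, map_smul, smul_eq_mul]
  refine Finset.sum_congr rfl fun γ _ => ?_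
  have h1 : u (Finsupp.single γ 1) = tripleForm 𝕂 G ![σ₀.1, σ₁.1, τ.1]
      ![classFun x₀, classFun x₁, classFun (Finsupp.single γ 1)] := foamTriple_apply _ _ _
  have h2 : w (Finsupp.single γ.star 1) = tripleForm 𝕂 G ![τ.1.star, σ₂.1, σ₃.1]
      ![classFun (Finsupp.single γ.star 1), classFun x₂, classFun x₃] :=
    foamTriple_apply _ _ _
  rw [h1, h2, mul_assoc, mul_comm (tripleForm _ _ _ _) (tripleForm _ _ _ _)]
  rfl

theorem hurwitzForm_place {n : ℕ} {Ω : BraneComplex (D + 1) S} {σ : Fin n → ColorClass D S}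
    (e : Compatible Ω σ) (x : ∀ i, hurwitzSpace 𝕂 G (σ i)) :
    hurwitzForm 𝕂 G Ω (e.place x) = Ω.partition fun q => classFun (x (e.vert.symm q)) := by
  unfold Compatible.place
  rw [hurwitzForm_tprod]
  simp only [classFun_transport]

open Classical in
variable (𝕂 G D S) in
/-- The colored Frobenius algebra of `G`-coverings. -/
def foam : ColoredFrobeniusAlgebra 𝕂
    (fun σ : AdmissibleClass D S => hurwitzSpace 𝕂 G σ.1) where
  finite σ := inferInstance
  pair := foamBilinear 𝕂 G D S
  triple := foamTrilinear 𝕂 G D S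
  nondegenerate := foamBilinear_nondegenerate
  pair_eq_zero σ τ h x y := (liftPair_lof
    (B := fun σ : AdmissibleClass D S => hurwitzSpace 𝕂 G σ.1)
    (fun σ τ => foamPair 𝕂 G σ.1 τ.1) σ τ x y).trans
      (foamPair_eq_zero (fun h' => h (Subtype.ext h')) x y)
  triple_eq_zero σ h x := by
    rw [foamTrilinear_lof, tripleForm_eq_zero h, zero_apply]
  assoc σ Ω e τ υ hτ hυ x m n b b' c c' := by
    have e₁ : {e₁ : Compatible Ω ![(σ 0).1, (σ 1).1, (σ 2).1, (σ 3).1] // e₁.vert = e.vert} :=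
      ⟨e.congr fun i => by fin_cases i <;> rfl, rfl⟩
    -- the second cut is of the same kind as the first one if the numbering starts at the last vertex
    have e₂ : {e₂ : Compatible Ω ![(σ 3).1, (σ 0).1, (σ 1).1, (σ 2).1] //
        e₂.vert = (finRotate 4).trans ((finRotate 4).trans ((finRotate 4).trans e.vert))} :=
      ⟨e.rotate.rotate.rotate.congr fun i => by fin_cases i <;> rfl, rfl⟩
    have h₁ := sum_foamTrilinear e₁.1 τ (by rw [e₁.2]; exact hτ) (x 0) (x 1) (x 2) (x 3) b b'
    have h₂ := sum_foamTrilinear e₂.1 υ (by rw [e₂.2]; exact hυ) (x 3) (x 0) (x 1) (x 2) c c'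
    refine h₁.trans (Eq.trans ?_ h₂.symm)
    congr 1
    funext q
    obtain ⟨i, rfl⟩ := e₂.1.vert.surjective q
    have h : e₁.1.vert.symm (e₂.1.vert i) = finRotate 4 (finRotate 4 (finRotate 4 i)) := by
      rw [e₁.2, e₂.2]
      exact e.vert.symm_apply_apply _
    rw [Equiv.symm_apply_apply, h]
    fin_cases i <;> rfl

open Classical in
theorem foam_isGeneratedBy :
    (foam 𝕂 G D S).IsGeneratedBy (B := hurwitzSpace 𝕂 G) (hurwitzForm 𝕂 G) where
  pair σ Ω e x := by
    refine (liftPair_lof (B := fun σ : AdmissibleClass D S => hurwitzSpace 𝕂 G σ.1)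
      (fun σ τ => foamPair 𝕂 G σ.1 τ.1) _ _ (x 0) (x 1)).trans ?_
    have h01 : e.vert 0 ≠ e.vert 1 := fun h => absurd (e.vert.injective h) (by decide)
    have hcov : ∀ q, q = e.vert 0 ∨ q = e.vert 1 := fun q => by
      obtain ⟨i, rfl⟩ := e.vert.surjective q
      fin_cases i
      · exact Or.inl rfl
      · exact Or.inr rfl
    rw [hurwitzForm_place, partition_two_vertices h01 hcov, foamPair_apply]
    have key : ∀ (ρ τ : ColorClass D S) (_ : ρ = τ) (f : CoveringClass G D S → 𝕂),
        ∑ γ : Upsilon G ρ, f γ.1 = ∑ γ : Upsilon G τ, f γ.1 := by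
      rintro ρ _ rfl f
      rfl
    have hx : ∀ i, classFun (x (e.vert.symm (e.vert i))) = classFun (x i) := fun i =>
      congrArg (fun j => classFun (x j)) (e.vert.symm_apply_apply i)
    refine (key _ _ (e.cls 0)
      fun γ => classFun (x 0) γ * classFun (x 1) γ.star * classNorm 𝕂 γ).trans ?_
    refine Finset.sum_congr rfl fun γ _ => ?_
    rw [← hx 0, ← hx 1]
  triple σ Ω e x := by
    refine (foamTrilinear_lof σ x).trans ?_
    rw [hurwitzForm_place, tripleForm_eq e]

end Foam

end Brane

end

theorem theorem5p1 {𝕂 : Type*} [Field 𝕂] [CharZero 𝕂] (G : Type*) [Group G] [Finite G]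
    (D : ℕ) (S : Type*) :
    Brane.IsBraneTFT (B := Brane.hurwitzSpace (D := D) (S := S) 𝕂 G) (Brane.hurwitzForm 𝕂 G) ∧
      ∃ C : Brane.ColoredFrobeniusAlgebra 𝕂
          (fun σ : Brane.AdmissibleClass D S => Brane.hurwitzSpace 𝕂 G σ.1),
        C.IsGeneratedBy (Brane.hurwitzForm 𝕂 G) := by
  exact ⟨Brane.isBraneTFT_hurwitzForm, Brane.foam 𝕂 G D S, Brane.foam_isGeneratedBy⟩
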